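/- Let $m\ge 1$ and $n\ge 0$. The complex reflection group $G(m,1,n+1)$ is generated by $s_1,\dots,s_n,t$ with defining relations $s_i^2=1$; $s_is_{i+1}s_i=s_{i+1}s_is_{i+1}$; $s_is_j=s_js_i$ for $|i-j|>1$; $ts_1ts_1=s_1ts_1t$; $s_it=ts_i$ for $i\ge 2$; $t^m=1$. Let $\{\xi_1,\dots,\xi_m\}$ be the set of all $m$-th roots of unity, ordered arbitrarily. An $m$-partition is an $m$-tuple of Young diagrams; a node in row $x$ and column $y$ of the $k$-th diagram has content $y-x$ and position $\xi_k$. A standard $m$-tableau of shape $\mu$ is a filling of the nodes of $\mu$, an $m$-partition with $n+1$ nodes in total, by $1,\dots,n+1$, each used once, ascending along the rows and columns of each diagram. For a standard $m$-tableau $T$ let $c_i(T)$ and $p_i(T)$ be the content and the position of the node with the number $i$. The irreducible representation $V_\mu$ of $G(m,1,n+1)$ has the semi-normal basis $e_T$, $T$ running over the standard $m$-tableaux of shape $\mu$, with $t\,e_T=p_1(T)e_T$ and $s_i e_T=a\,e_T+(1+a)\,e_{s_iT}$, where $a=\delta_{p_i(T),p_{i+1}(T)}/(c_{i+1}(T)-c_i(T))$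 (read as $0$ if $p_i(T)\ne p_{i+1}(T)$), $s_iT$ is $T$ with $i$ and $i+1$ interchanged, and $e_{s_iT}:=0$ if $s_iT$ is not standard. For a standard $m$-tableau $T$ of shape $\lambda^{(m)}$, $E_T\in\mathbb{C}G(m,1,n+1)$ denotes the corresponding primitive idempotent: the unique element that acts on $V_{\lambda^{(m)}}$ as the projector onto $e_T$ along the other basis vectors, and as $0$ on $V_\mu$ for every $\mu\neq\lambda^{(m)}$. Put $s_i(p,p',a,a'):=s_i+\frac{\delta_{p,p'}}{a-a'}$ (the second term being $0$ if $p\neq p'$), $t(v):=\frac1m\sum_{k=0}^{m-1}v^{m-k}t^k$, $\phi_1(v,u):=t(v)$ and, for $k=1,\dots,n$, $$\phi_{k+1}(v_1,\dots,v_k,v,u_1,\dots,u_k,u):=s_k(v,v_k,u,u_k)\,\phi_k(v_1,\dots,v_{k-1},v,u_1,\dots,u_{k-1},u)\,s_k ,$$ and let $$\Phi(v_1,\dots,v_{n+1},u_1,\dots,u_{n+1}):=\phi_{n+1}(v_1,\dots,v_{n+1},u_1,\dots,u_{n+1})\cdots\phi_2(v_1,v_2,u_1,u_2)\,\phi_1(v_1,u_1).$$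 **Theorem.** Let $\lambda^{(m)}$ be an $m$-partition with $n+1$ nodes, $T$ a standard $m$-tableau of shape $\lambda^{(m)}$, $p_i:=p_i(T)$, $c_i:=c_i(T)$, and let $f_{\lambda^{(m)}}$ be the inverse of the product of the hook lengths of all nodes of $\lambda^{(m)}$ (the hook length of a node being taken in its own diagram). Then $$E_T=f_{\lambda^{(m)}}\,\Phi(v_1,\dots,v_{n+1},u_1,\dots,u_{n+1})\Big|_{v_i=p_i,\ i=1,\dots,n+1}\Big|_{u_1=c_1}\cdots\Big|_{u_n=c_n}\Big|_{u_{n+1}=c_{n+1}} ,$$ where the evaluations in $u_1,\dots,u_{n+1}$ are made one after another in this order, each of them being the evaluation of a rational function with values in $\mathbb{C}G(m,1,n+1)$ that is non-singular at the point of evaluation. -/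

import Mathlib

namespace CyclotomicFusion

/-! ### The complex reflection group `G(m,1,n+1)` -/

/-- Generators `t, s₁, …, sₙ` of `G(m,1,n+1)`; `s i` with `i : Fin n` (counted from `0`) stands for
the generator `s_{i+1}`. -/
inductive Gen (n : ℕ) : Type
  | t : Gen n
  | s (i : Fin n) : Gen n

/-- The generator `t` in the free group. -/
def ft (n : ℕ) : FreeGroup (Gen n) := FreeGroup.of Gen.t

/-- The generator `s_{i+1}` in the free group. -/
def fs {n : ℕ} (i : Fin n) : FreeGroup (Gen n) := FreeGroup.of (Gen.s i)

/-- The defining relators of `G(m,1,n+1)`. -/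
inductive IsRelator (m n : ℕ) : FreeGroup (Gen n) → Prop
  | s_sq (i : Fin n) : IsRelator m n (fs i * fs i)
  | s_braid (i j : Fin n) (h : (j : ℕ) = i + 1) :
      IsRelator m n (fs i * fs j * fs i * (fs j * fs i * fs j)⁻¹)
  | s_comm (i j : Fin n) (h : (i : ℕ) + 1 < j) :
      IsRelator m n (fs i * fs j * (fs j * fs i)⁻¹)
  | t_braid (i : Fin n) (h : (i : ℕ) = 0) :
      IsRelator m n (ft n * fs i * ft n * fs i * (fs i * ft n * fs i * ft n)⁻¹)
  | t_comm (i : Fin n) (h : 0 < (i : ℕ)) :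
      IsRelator m n (fs i * ft n * (ft n * fs i)⁻¹)
  | t_pow : IsRelator m n (ft n ^ m)

/-- The complex reflection group `G(m,1,n+1)`, given by generators and relations. -/
abbrev G (m n : ℕ) : Type := PresentedGroup {r | IsRelator m n r}

/-- The element `t` of `G(m,1,n+1)`. -/
def gt (m n : ℕ) : G m n := PresentedGroup.of Gen.t

/-- The element `s_{i+1}` of `G(m,1,n+1)`. -/
def gs (m : ℕ) {n : ℕ} (i : Fin n) : G m n := PresentedGroup.of (Gen.s i)

/-! ### `m`-partitions, standard `m`-tableaux, contents and hooks

An `m`-partition is a family `μ : Fin m → YoungDiagram`; an `m`-node is a pair `(k, (x, y))` with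
position `k`, row `x` and column `y`. -/

/-- An `m`-node: position, and (row, column) in the diagram at that position. -/
abbrev Node (m : ℕ) : Type := Fin m × (ℕ × ℕ)

/-- The content `column - row` of an `m`-node. -/
def content {m : ℕ} (q : Node m) : ℤ := (q.2.2 : ℤ) - (q.2.1 : ℤ)

/-- `w`, listing the nodes that carry the numbers `1, …, n+1`, is a standard filling of the
`m`-partition `μ`: each node of `μ` carries exactly one number, and the numbers ascend along the
rows and the columns of each diagram. -/
structure IsStandard {m n : ℕ} (μ : Fin m → YoungDiagram) (w : Fin (n + 1) → Node m) : Prop where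
  inj : Function.Injective w
  mem_range : ∀ q : Node m, (∃ a, w a = q) ↔ q.2 ∈ μ q.1
  row : ∀ a b, (w a).1 = (w b).1 → (w a).2.1 = (w b).2.1 → (w a).2.2 < (w b).2.2 → a < b
  col : ∀ a b, (w a).1 = (w b).1 → (w a).2.2 = (w b).2.2 → (w a).2.1 < (w b).2.1 → a < b

/-- A standard `m`-tableau of shape `μ` with entries `1, …, n+1`; `node i` is the node carrying the
number `i + 1`. -/
structure StdTableau {m : ℕ} (n : ℕ) (μ : Fin m → YoungDiagram) where
  node : Fin (n + 1) → Node m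
  std : IsStandard μ node

namespace StdTableau

variable {m n : ℕ} {μ : Fin m → YoungDiagram}

/-- The content `c_{i+1}` of the node carrying `i + 1`. -/
def c (T : StdTableau n μ) (i : Fin (n + 1)) : ℤ := content (T.node i)

/-- The root of unity `p_{i+1}` attached to the position of the node carrying `i + 1`; `ξ` is the
chosen ordering of the `m`-th roots of unity. -/
noncomputable def p (ξ : Fin m ≃ rootsOfUnity m ℂ) (T : StdTableau n μ) (i : Fin (n + 1)) : ℂ :=
  ((ξ (T.node i).1 : ℂˣ) : ℂ)

end StdTableau

/-- Hook length of the node `q` in the Young diagram `ν`. -/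
def hookLength (ν : YoungDiagram) (q : ℕ × ℕ) : ℕ :=
  (ν.cells.filter fun r => (r.1 = q.1 ∧ q.2 ≤ r.2) ∨ (r.2 = q.2 ∧ q.1 ≤ r.1)).card

/-- `f_μ`, the inverse of the product of all hook lengths of the `m`-partition `μ`. -/
noncomputable def fCoeff {m : ℕ} (μ : Fin m → YoungDiagram) : ℂ :=
  (∏ k, ∏ q ∈ (μ k).cells, (hookLength (μ k) q : ℂ))⁻¹

/-! ### The semi-normal representations -/

/-- The space `V_μ` with basis the standard `m`-tableaux of shape `μ`. -/
abbrev V {m : ℕ} (n : ℕ) (μ : Fin m → YoungDiagram) : Type := StdTableau n μ →₀ ℂ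

/-- Interchange of the numbers `i + 1` and `i + 2`. -/
def swapFilling {m n : ℕ} (w : Fin (n + 1) → Node m) (i : Fin n) : Fin (n + 1) → Node m :=
  w ∘ Equiv.swap i.castSucc i.succ

/-- `δ_{p,p'} / (c' - c)` for two nodes `q`, `r` with data `(p, c)`, `(p', c')`. -/
noncomputable def axialCoeff {m : ℕ} (q r : Node m) : ℂ :=
  if q.1 = r.1 then ((content r - content q : ℤ) : ℂ)⁻¹ else 0

/-- `axialCoeff` for the nodes carrying the numbers `i + 1` and `i + 2`. -/
noncomputable def axial {m n : ℕ} (w : Fin (n + 1) → Node m) (i : Fin n) : ℂ :=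
  axialCoeff (w i.castSucc) (w i.succ)

open Classical in
/-- The basis vector of `V_μ` attached to a filling, understood to be zero if the filling is not
standard. -/
noncomputable def vec {m n : ℕ} (μ : Fin m → YoungDiagram) (w : Fin (n + 1) → Node m) : V n μ :=
  if h : IsStandard μ w then Finsupp.single ⟨w, h⟩ 1 else 0

/-- The semi-normal action of `s_{i+1}`:
`s e_T = a e_T + (1 + a) e_{sT}` with `a = δ_{p,p'} / (c' - c)`, where `e_{sT} = 0` if `sT`
is not standard. -/
noncomputable def sOp {m n : ℕ} (μ : Fin m → YoungDiagram) (i : Fin n) : V n μ →ₗ[ℂ] V n μ :=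
  Finsupp.linearCombination ℂ fun T : StdTableau n μ =>
    axial T.node i • vec μ T.node + (1 + axial T.node i) • vec μ (swapFilling T.node i)

/-- The semi-normal action of `t`: `t e_T = p_1 e_T`. -/
noncomputable def tOp {m : ℕ} (n : ℕ) (ξ : Fin m ≃ rootsOfUnity m ℂ) (μ : Fin m → YoungDiagram) :
    V n μ →ₗ[ℂ] V n μ :=
  Finsupp.linearCombination ℂ fun T : StdTableau n μ => T.p ξ 0 • vec μ T.node

section Relations

variable {m n : ℕ} {μ : Fin m → YoungDiagram}

theorem IsStandard.mono {w : Fin (n + 1) → Node m} (h : IsStandard μ w) {a b : Fin (n + 1)}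
    (hk : (w a).1 = (w b).1) (hx : (w a).2.1 ≤ (w b).2.1) (hy : (w a).2.2 ≤ (w b).2.2) : a ≤ b := by
  obtain ⟨d, hd⟩ := (h.mem_range ((w b).1, ((w a).2.1, (w b).2.2))).2
    ((μ (w b).1).isLowerSet (show ((w a).2.1, (w b).2.2) ≤ (w b).2 from ⟨hx, le_rfl⟩)
      ((h.mem_range (w b)).1 ⟨b, rfl⟩))
  have h1 : a ≤ d := by
    rcases hy.lt_or_eq with hy | hy
    · exact (h.row a d (by simp [hd, hk]) (by simp [hd]) (by simpa [hd] using hy)).le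
    · refine (h.inj ?_).le
      rw [hd, ← hy, ← hk]
  have h2 : d ≤ b := by
    rcases hx.lt_or_eq with hx | hx
    · exact (h.col d b (by simp [hd]) (by simp [hd]) (by simpa [hd] using hx)).le
    · refine (h.inj ?_).le
      rw [hd, hx]
  exact h1.trans h2

theorem IsStandard.exists_between {w : Fin (n + 1) → Node m} (h : IsStandard μ w)
    {a b : Fin (n + 1)} (hk : (w a).1 = (w b).1) {x y : ℕ} (hx : (w a).2.1 ≤ x)
    (hx' : x ≤ (w b).2.1) (hy : (w a).2.2 ≤ y) (hy' : y ≤ (w b).2.2) :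
    ∃ d, w d = ((w a).1, (x, y)) ∧ a ≤ d ∧ d ≤ b := by
  obtain ⟨d, hd⟩ := (h.mem_range ((w b).1, (x, y))).2
    ((μ (w b).1).isLowerSet (show (x, y) ≤ (w b).2 from ⟨hx', hy'⟩)
      ((h.mem_range (w b)).1 ⟨b, rfl⟩))
  exact ⟨d, by rw [hd, hk], h.mono (by simp [hd, hk]) (by simpa [hd] using hx)
    (by simpa [hd] using hy), h.mono (by simp [hd]) (by simpa [hd] using hx')
    (by simpa [hd] using hy')⟩

theorem isStandard_comp {w : Fin (n + 1) → Node m} (h : IsStandard μ w)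
    (σ : Equiv.Perm (Fin (n + 1)))
    (H : ∀ a b, a < b → (w a).1 = (w b).1 → (w a).2.1 ≤ (w b).2.1 → (w a).2.2 ≤ (w b).2.2 →
      σ.symm a < σ.symm b) : IsStandard μ (w ∘ σ) where
  inj := h.inj.comp σ.injective
  mem_range q := by
    rw [← h.mem_range q]
    exact ⟨fun ⟨a, ha⟩ => ⟨σ a, ha⟩, fun ⟨a, ha⟩ => ⟨σ.symm a, by simpa using ha⟩⟩
  row a b h1 h2 h3 := by
    have := H (σ a) (σ b) (h.row _ _ h1 h2 h3) h1 h2.le h3.le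
    simpa using this
  col a b h1 h2 h3 := by
    have := H (σ a) (σ b) (h.col _ _ h1 h2 h3) h1 h3.le h2.le
    simpa using this

/-- Two nodes of equal position and content carry numbers that differ by at least `3`. -/
theorem IsStandard.content_ne {w : Fin (n + 1) → Node m} (h : IsStandard μ w)
    {a b : Fin (n + 1)} (hab : a < b) (hab' : (b : ℕ) ≤ a + 2) (hk : (w a).1 = (w b).1) :
    content (w b) - content (w a) ≠ 0 := by
  intro hc
  simp only [content] at hc
  have hlt : (w a).2.1 < (w b).2.1 := by
    by_contra hle
    exact absurd (h.mono hk.symm (by omega) (by omega)) (not_le.2 hab)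
  obtain ⟨d, hd, had, hdb⟩ := h.exists_between hk (x := (w a).2.1 + 1) (y := (w a).2.2)
    (by omega) (by omega) le_rfl (by omega)
  obtain ⟨e, he, hae, heb⟩ := h.exists_between hk (x := (w a).2.1) (y := (w a).2.2 + 1)
    le_rfl (by omega) (by omega) (by omega)
  have h1 : d ≠ a := by rintro rfl; have := congrArg (fun q => q.2.1) hd; simp at this
  have h2 : e ≠ a := by rintro rfl; have := congrArg (fun q => q.2.2) he; simp at this
  have h3 : d ≠ e := by
    rintro rfl; have := congrArg (fun q => q.2.1) (hd.symm.trans he); simp at this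
  have h4 : d ≠ b := by
    rintro rfl; have := congrArg (fun q => q.2.2) hd; simp at this; omega
  have h5 : e ≠ b := by
    rintro rfl; have := congrArg (fun q => q.2.1) he; simp at this; omega
  omega

theorem swapFilling_swapFilling (w : Fin (n + 1) → Node m) (i : Fin n) :
    swapFilling (swapFilling w i) i = w := by
  funext a; simp [swapFilling]

@[simp] theorem swapFilling_castSucc (w : Fin (n + 1) → Node m) (i : Fin n) :
    swapFilling w i i.castSucc = w i.succ := by simp [swapFilling]

@[simp] theorem swapFilling_succ (w : Fin (n + 1) → Node m) (i : Fin n) :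
    swapFilling w i i.succ = w i.castSucc := by simp [swapFilling]

theorem swapFilling_of_ne (w : Fin (n + 1) → Node m) (i : Fin n) {a : Fin (n + 1)}
    (h1 : a ≠ i.castSucc) (h2 : a ≠ i.succ) : swapFilling w i a = w a := by
  simp [swapFilling, Equiv.swap_apply_of_ne_of_ne h1 h2]

theorem axialCoeff_swap (q r : Node m) : axialCoeff r q = - axialCoeff q r := by
  simp only [axialCoeff]
  split_ifs with h1 h2 h2
  · rw [← inv_neg, ← Int.cast_neg, neg_sub]
  · exact absurd h1.symm h2
  · exact absurd h2.symm h1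
  · simp

theorem axial_swap (w : Fin (n + 1) → Node m) (i : Fin n) :
    axial (swapFilling w i) i = - axial w i := by
  simp only [axial, swapFilling_castSucc, swapFilling_succ]
  exact axialCoeff_swap _ _

/-- The order on nodes: same diagram, weakly above and weakly to the left. -/
def NodeLE (q r : Node m) : Prop := q.1 = r.1 ∧ q.2.1 ≤ r.2.1 ∧ q.2.2 ≤ r.2.2

theorem isStandard_swap {w : Fin (n + 1) → Node m} (h : IsStandard μ w) (i : Fin n)
    (hr : ¬ NodeLE (w i.castSucc) (w i.succ)) : IsStandard μ (swapFilling w i) := by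
  refine isStandard_comp h (Equiv.swap i.castSucc i.succ) ?_
  intro a b hab hk hx hy
  rw [Equiv.symm_swap]
  have hne : ¬ (a = i.castSucc ∧ b = i.succ) := by
    rintro ⟨rfl, rfl⟩; exact hr ⟨hk, hx, hy⟩
  simp only [Equiv.swap_apply_def]
  simp only [Fin.lt_def, Fin.ext_iff, Fin.val_castSucc, Fin.val_succ] at *
  split_ifs <;> simp <;> omega

/-- If the interchange of `i + 1` and `i + 2` is not standard, the two nodes are neighbours. -/
theorem axial_sq {w : Fin (n + 1) → Node m} (h : IsStandard μ w) (i : Fin n)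
    (h' : ¬ IsStandard μ (swapFilling w i)) : axial w i ^ 2 = 1 := by
  have hlt : i.castSucc < i.succ := Fin.castSucc_lt_succ
  by_cases hr : NodeLE (w i.castSucc) (w i.succ)
  · obtain ⟨hk, hx, hy⟩ := hr
    have key : ∀ d, i.castSucc ≤ d → d ≤ i.succ → d = i.castSucc ∨ d = i.succ := by
      intro d h1 h2
      simp only [Fin.le_def, Fin.ext_iff, Fin.val_castSucc, Fin.val_succ] at *
      omega
    have hc : content (w i.succ) - content (w i.castSucc) = 1 ∨
        content (w i.succ) - content (w i.castSucc) = -1 := by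
      rcases hx.lt_or_eq with hx1 | hx1
      · obtain ⟨d, hd, h1, h2⟩ := h.exists_between hk (x := (w i.castSucc).2.1 + 1)
          (y := (w i.castSucc).2.2) (by omega) (by omega) le_rfl (by omega)
        rcases key d h1 h2 with rfl | rfl
        · have := congrArg (fun q => q.2.1) hd; simp at this
        · right; simp [content, hd]
      · rcases hy.lt_or_eq with hy1 | hy1
        · obtain ⟨d, hd, h1, h2⟩ := h.exists_between hk (x := (w i.castSucc).2.1)
            (y := (w i.castSucc).2.2 + 1) (by omega) (by omega) (by omega) (by omega)
          rcases key d h1 h2 with rfl | rfl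
          · have := congrArg (fun q => q.2.2) hd; simp at this
          · left; simp [content, hd]
        · exact absurd (h.inj (Prod.ext hk (Prod.ext hx1 hy1))) hlt.ne
    rw [axial, axialCoeff, if_pos hk]
    rcases hc with hc | hc <;> rw [hc] <;> norm_num
  · exact absurd (isStandard_swap h i hr) h'

open Classical in
/-- The off-diagonal coefficient, cut off outside the standard fillings. -/
noncomputable def offDiag (μ : Fin m → YoungDiagram) (w : Fin (n + 1) → Node m) (i : Fin n) : ℂ :=
  if IsStandard μ w ∧ IsStandard μ (swapFilling w i) then 1 + axial w i else 0

theorem vec_of_not {w : Fin (n + 1) → Node m} (h : ¬ IsStandard μ w) : vec μ w = 0 := by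
  simp [vec, h]

theorem vec_coe (T : StdTableau n μ) : vec μ T.node = Finsupp.single T 1 := by
  simp [vec, T.std]

theorem sOp_vec (w : Fin (n + 1) → Node m) (i : Fin n) :
    sOp μ i (vec μ w) = axial w i • vec μ w + offDiag μ w i • vec μ (swapFilling w i) := by
  by_cases h : IsStandard μ w
  · have : vec μ w = Finsupp.single (⟨w, h⟩ : StdTableau n μ) 1 := by simp [vec, h]
    conv_lhs => rw [this]
    rw [sOp, Finsupp.linearCombination_single, one_smul]
    by_cases h' : IsStandard μ (swapFilling w i)
    · simp [offDiag, h, h']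
    · simp [offDiag, h', vec_of_not h']
  · simp [vec_of_not h, offDiag, h]

theorem tOp_vec (ξ : Fin m ≃ rootsOfUnity m ℂ) (w : Fin (n + 1) → Node m) :
    tOp n ξ μ (vec μ w) = ((ξ (w 0).1 : ℂˣ) : ℂ) • vec μ w := by
  by_cases h : IsStandard μ w
  · have : vec μ w = Finsupp.single (⟨w, h⟩ : StdTableau n μ) 1 := by simp [vec, h]
    conv_lhs => rw [this]
    rw [tOp, Finsupp.linearCombination_single, one_smul]
    rfl
  · simp [vec_of_not h]

theorem linearMap_ext {f g : V n μ →ₗ[ℂ] V n μ}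
    (h : ∀ w, IsStandard μ w → f (vec μ w) = g (vec μ w)) : f = g := by
  refine Finsupp.lhom_ext' fun T => LinearMap.ext_ring ?_
  have := h T.node T.std
  rw [vec_coe] at this
  simpa using this

theorem offDiag_mul {w : Fin (n + 1) → Node m} (h : IsStandard μ w) (i : Fin n) :
    offDiag μ w i * offDiag μ (swapFilling w i) i = 1 - axial w i ^ 2 := by
  by_cases h' : IsStandard μ (swapFilling w i)
  · simp only [offDiag, h, h', swapFilling_swapFilling, axial_swap, and_self, if_true]
    ring
  · simp [offDiag, h', axial_sq h i h']

theorem sOp_sq (i : Fin n) : sOp μ i * sOp μ i = 1 := by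
  refine linearMap_ext fun w hw => ?_
  have := offDiag_mul hw i
  simp only [Module.End.mul_apply, Module.End.one_apply, sOp_vec, map_add, map_smul,
    swapFilling_swapFilling, axial_swap]
  match_scalars
  · linear_combination this
  · ring

theorem offDiag_of_le {w : Fin (n + 1) → Node m} {i : Fin n}
    (hr : NodeLE (w i.castSucc) (w i.succ)) : offDiag μ w i = 0 := by
  refine if_neg ?_
  rintro ⟨-, h'⟩
  have := h'.mono (a := i.succ) (b := i.castSucc) (by simpa using hr.1) (by simpa using hr.2.1)
    (by simpa using hr.2.2)
  exact absurd this (not_le.2 Fin.castSucc_lt_succ)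

theorem offDiag_of_not_le {w : Fin (n + 1) → Node m} (h : IsStandard μ w) {i : Fin n}
    (hr : ¬ NodeLE (w i.castSucc) (w i.succ)) : offDiag μ w i = 1 + axial w i :=
  if_pos ⟨h, isStandard_swap h i hr⟩

theorem swapFilling_comm (w : Fin (n + 1) → Node m) {i j : Fin n} (hij : (i : ℕ) + 1 < j) :
    swapFilling (swapFilling w i) j = swapFilling (swapFilling w j) i := by
  have key : Equiv.swap i.castSucc i.succ * Equiv.swap j.castSucc j.succ =
      Equiv.swap j.castSucc j.succ * Equiv.swap i.castSucc i.succ := by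
    rw [Equiv.mul_swap_eq_swap_mul]
    congr 2 <;> apply Equiv.swap_apply_of_ne_of_ne <;>
      simp only [ne_eq, Fin.ext_iff, Fin.val_castSucc, Fin.val_succ] <;> omega
  funext a
  exact congrArg w (DFunLike.congr_fun key a)

theorem far_aux (w : Fin (n + 1) → Node m) {i j : Fin n} (hij : (i : ℕ) + 1 < j ∨ (j : ℕ) + 1 < i) :
    swapFilling w i j.castSucc = w j.castSucc ∧ swapFilling w i j.succ = w j.succ := by
  constructor <;> apply swapFilling_of_ne <;>
    simp only [ne_eq, Fin.ext_iff, Fin.val_castSucc, Fin.val_succ] <;> omega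

theorem axial_far (w : Fin (n + 1) → Node m) {i j : Fin n}
    (hij : (i : ℕ) + 1 < j ∨ (j : ℕ) + 1 < i) : axial (swapFilling w i) j = axial w j := by
  simp [axial, far_aux w hij]

theorem offDiag_far {w : Fin (n + 1) → Node m} (h : IsStandard μ w) {i j : Fin n}
    (hij : (i : ℕ) + 1 < j) :
    offDiag μ w j * offDiag μ (swapFilling w j) i =
      offDiag μ w i * offDiag μ (swapFilling w i) j := by
  have f1 := far_aux w (Or.inl hij)
  have f2 := far_aux w (i := j) (j := i) (Or.inr hij)
  by_cases h1 : NodeLE (w i.castSucc) (w i.succ)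
  · rw [offDiag_of_le h1, offDiag_of_le (w := swapFilling w j) (by rwa [f2.1, f2.2])]; simp
  by_cases h2 : NodeLE (w j.castSucc) (w j.succ)
  · rw [offDiag_of_le h2, offDiag_of_le (w := swapFilling w i) (by rwa [f1.1, f1.2])]; simp
  rw [offDiag_of_not_le h h1, offDiag_of_not_le h h2,
    offDiag_of_not_le (isStandard_swap h j h2) (by rwa [f2.1, f2.2]),
    offDiag_of_not_le (isStandard_swap h i h1) (by rwa [f1.1, f1.2]),
    axial_far w (Or.inl hij), axial_far w (Or.inr hij)]
  ring

theorem sOp_comm (i j : Fin n) (hij : (i : ℕ) + 1 < j) :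
    sOp μ i * sOp μ j = sOp μ j * sOp μ i := by
  refine linearMap_ext fun w hw => ?_
  have := offDiag_far hw hij
  simp only [Module.End.mul_apply, sOp_vec, map_add, map_smul, swapFilling_comm w hij,
    axial_far w (Or.inl hij), axial_far w (i := j) (j := i) (Or.inr hij)]
  match_scalars
  · ring
  · ring
  · ring
  · linear_combination this

/-- The three nodes carrying consecutive numbers. -/
theorem axial_triple {w : Fin (n + 1) → Node m} (h : IsStandard μ w) {a b c : Fin (n + 1)}
    (hb : (b : ℕ) = a + 1) (hc : (c : ℕ) = a + 2) :
    axialCoeff (w a) (w b) * axialCoeff (w b) (w c) =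
      axialCoeff (w a) (w c) * (axialCoeff (w a) (w b) + axialCoeff (w b) (w c)) := by
  have hab : a < b := by rw [Fin.lt_def]; omega
  have hbc : b < c := by rw [Fin.lt_def]; omega
  simp only [axialCoeff]
  by_cases h1 : (w a).1 = (w b).1
  · by_cases h2 : (w b).1 = (w c).1
    · have d1 : ((content (w b) - content (w a) : ℤ) : ℂ) ≠ 0 :=
        Int.cast_ne_zero.2 (h.content_ne hab (by omega) h1)
      have d2 : ((content (w c) - content (w b) : ℤ) : ℂ) ≠ 0 :=
        Int.cast_ne_zero.2 (h.content_ne hbc (by omega) h2)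
      have d3 : ((content (w c) - content (w a) : ℤ) : ℂ) ≠ 0 :=
        Int.cast_ne_zero.2 (h.content_ne (hab.trans hbc) (by omega) (h1.trans h2))
      rw [if_pos h1, if_pos h2, if_pos (h1.trans h2)]
      field_simp
      push_cast
      ring
    · have h3 : ¬ (w a).1 = (w c).1 := fun h3 => h2 (h1.symm.trans h3)
      simp [h2, h3]
  · by_cases h2 : (w b).1 = (w c).1
    · have h3 : ¬ (w a).1 = (w c).1 := fun h3 => h1 (h3.trans h2.symm)
      simp [h1, h3]
    · simp [h1, h2]

theorem swapFilling_braid (w : Fin (n + 1) → Node m) {i j : Fin n} (hij : (j : ℕ) = i + 1) :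
    swapFilling (swapFilling (swapFilling w i) j) i =
      swapFilling (swapFilling (swapFilling w j) i) j := by
  have hj : j.castSucc = i.succ := by ext; simp [hij]
  have h1 : i.succ ≠ i.castSucc := Fin.castSucc_lt_succ.ne'
  have h2 : i.succ ≠ j.succ := by simp only [ne_eq, Fin.ext_iff, Fin.val_succ]; omega
  have h3 : i.castSucc ≠ j.succ := by
    simp only [ne_eq, Fin.ext_iff, Fin.val_castSucc, Fin.val_succ]; omega
  have key : Equiv.swap i.castSucc i.succ * Equiv.swap i.succ j.succ *
      Equiv.swap i.castSucc i.succ =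
      Equiv.swap i.succ j.succ * Equiv.swap i.castSucc i.succ * Equiv.swap i.succ j.succ := by
    rw [Equiv.swap_mul_swap_mul_swap h1.symm h3, Equiv.swap_comm i.castSucc i.succ,
      Equiv.swap_comm i.succ j.succ, Equiv.swap_mul_swap_mul_swap h2.symm h3.symm]
    exact Equiv.swap_comm _ _
  funext a
  have := congrArg w (DFunLike.congr_fun key a)
  simpa [swapFilling, hj] using this

theorem sOp_braid (i j : Fin n) (hij : (j : ℕ) = i + 1) :
    sOp μ i * sOp μ j * sOp μ i = sOp μ j * sOp μ i * sOp μ j := by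
  refine linearMap_ext fun w hw => ?_
  have hj : j.castSucc = i.succ := by ext; simp [hij]
  have e1 : ∀ w : Fin (n + 1) → Node m, swapFilling w i j.succ = w j.succ := fun w =>
    swapFilling_of_ne w i (by simp only [ne_eq, Fin.ext_iff, Fin.val_castSucc, Fin.val_succ]; omega)
      (by simp only [ne_eq, Fin.ext_iff, Fin.val_succ]; omega)
  have e2 : ∀ w : Fin (n + 1) → Node m, swapFilling w j i.castSucc = w i.castSucc := fun w =>
    swapFilling_of_ne w j (by simp only [ne_eq, Fin.ext_iff, Fin.val_castSucc]; omega)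
      (by simp only [ne_eq, Fin.ext_iff, Fin.val_castSucc, Fin.val_succ]; omega)
  have e3 : ∀ w : Fin (n + 1) → Node m, swapFilling w j i.succ = w j.succ := fun w => by
    rw [← hj, swapFilling_castSucc]
  have e4 : ∀ w : Fin (n + 1) → Node m, swapFilling w j j.succ = w i.succ := fun w => by
    rw [← hj, swapFilling_succ]
  have hR := axial_triple hw (a := i.castSucc) (b := i.succ) (c := j.succ) (by simp)
    (by simp [hij])
  have hb1 := offDiag_mul hw i
  have hb2 := offDiag_mul hw j
  have hprod : offDiag μ w i * offDiag μ (swapFilling w i) j *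
        offDiag μ (swapFilling (swapFilling w i) j) i =
      offDiag μ w j * offDiag μ (swapFilling w j) i *
        offDiag μ (swapFilling (swapFilling w j) i) j := by
    by_cases h1 : NodeLE (w i.castSucc) (w i.succ)
    · rw [offDiag_of_le h1,
        offDiag_of_le (w := swapFilling (swapFilling w j) i) (by simpa [hj, e1, e2, e3, e4] using h1)]
      simp
    by_cases h2 : NodeLE (w i.succ) (w j.succ)
    · rw [offDiag_of_le (i := j) (w := w) (by simpa [hj] using h2),
        offDiag_of_le (w := swapFilling (swapFilling w i) j) (by simpa [hj, e1, e2, e3, e4] using h2)]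
      simp
    by_cases h3 : NodeLE (w i.castSucc) (w j.succ)
    · rw [offDiag_of_le (i := j) (w := swapFilling w i) (by simpa [hj, e1, e2, e3, e4] using h3),
        offDiag_of_le (i := i) (w := swapFilling w j) (by simpa [hj, e1, e2, e3, e4] using h3)]
      simp
    have s1 := isStandard_swap hw i h1
    have s2 := isStandard_swap hw j (by rwa [hj])
    have s3 := isStandard_swap s1 j (by simpa [hj, e1, e2, e3, e4] using h3)
    have s4 := isStandard_swap s2 i (by simpa [hj, e1, e2, e3, e4] using h3)
    rw [offDiag_of_not_le hw h1, offDiag_of_not_le hw (i := j) (by rwa [hj]),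
      offDiag_of_not_le s1 (i := j) (by simpa [hj, e1, e2, e3, e4] using h3),
      offDiag_of_not_le s2 (i := i) (by simpa [hj, e1, e2, e3, e4] using h3),
      offDiag_of_not_le s3 (i := i) (by simpa [hj, e1, e2, e3, e4] using h2),
      offDiag_of_not_le s4 (i := j) (by simpa [hj, e1, e2, e3, e4] using h1)]
    simp only [axial, hj, e1, e2, e3, e4, swapFilling_castSucc, swapFilling_succ]
    ring
  simp only [Module.End.mul_apply, sOp_vec, map_add, map_smul, swapFilling_swapFilling]
  rw [swapFilling_braid w hij]
  simp only [axial, hj, e1, e2, e3, e4, swapFilling_castSucc, swapFilling_succ] at *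
  rw [axialCoeff_swap (w i.castSucc) (w i.succ), axialCoeff_swap (w i.succ) (w j.succ)]
  match_scalars
  · linear_combination axialCoeff (w i.castSucc) (w j.succ) * (hb1 - hb2) +
      (axialCoeff (w i.castSucc) (w i.succ) - axialCoeff (w i.succ) (w j.succ)) * hR
  · linear_combination offDiag μ w i * hR
  · linear_combination -offDiag μ w j * hR
  · ring
  · ring
  · linear_combination hprod

theorem tOp_sOp_comm (ξ : Fin m ≃ rootsOfUnity m ℂ) (i : Fin n) (hi : 0 < (i : ℕ)) :
    sOp μ i * tOp n ξ μ = tOp n ξ μ * sOp μ i := by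
  refine linearMap_ext fun w _ => ?_
  have h0 : swapFilling w i 0 = w 0 := by
    apply swapFilling_of_ne <;>
      simp only [ne_eq, Fin.ext_iff, Fin.val_castSucc, Fin.val_succ, Fin.val_zero] <;> omega
  simp only [Module.End.mul_apply, sOp_vec, tOp_vec, map_add, map_smul, h0]
  match_scalars <;> ring

theorem tOp_sOp_braid (ξ : Fin m ≃ rootsOfUnity m ℂ) (i : Fin n) (hi : (i : ℕ) = 0) :
    tOp n ξ μ * sOp μ i * tOp n ξ μ * sOp μ i = sOp μ i * tOp n ξ μ * sOp μ i * tOp n ξ μ := by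
  refine linearMap_ext fun w _ => ?_
  have hi0 : (0 : Fin (n + 1)) = i.castSucc := by ext; simp [hi]
  have key : axial w i * (((ξ (w i.castSucc).1 : ℂˣ) : ℂ) - ((ξ (w i.succ).1 : ℂˣ) : ℂ)) = 0 := by
    by_cases h : (w i.castSucc).1 = (w i.succ).1
    · rw [h]; ring
    · simp [axial, axialCoeff, h]
  simp only [Module.End.mul_apply, sOp_vec, tOp_vec, map_add, map_smul, hi0, swapFilling_castSucc,
    swapFilling_swapFilling, axial_swap]
  match_scalars
  · ring
  · linear_combination (-offDiag μ w i *
      (((ξ (w i.castSucc).1 : ℂˣ) : ℂ) - ((ξ (w i.succ).1 : ℂˣ) : ℂ))) * key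

theorem tOp_pow (ξ : Fin m ≃ rootsOfUnity m ℂ) : tOp n ξ μ ^ m = 1 := by
  refine linearMap_ext fun w _ => ?_
  have h : ∀ k : ℕ, (tOp n ξ μ ^ k) (vec μ w) = ((ξ (w 0).1 : ℂˣ) : ℂ) ^ k • vec μ w := by
    intro k
    induction k with
    | zero => simp
    | succ k ih => rw [pow_succ', Module.End.mul_apply, ih, map_smul, tOp_vec, smul_smul, pow_succ]
  rw [h, (mem_rootsOfUnity' m _).1 (ξ (w 0).1).2]
  simp

end Relations

/-- `t` as an invertible operator on `V_μ` (with inverse `t^(m-1)`). -/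
noncomputable def tUnit {m : ℕ} (n : ℕ) (ξ : Fin m ≃ rootsOfUnity m ℂ) (μ : Fin m → YoungDiagram) :
    (V n μ →ₗ[ℂ] V n μ)ˣ where
  val := tOp n ξ μ
  inv := tOp n ξ μ ^ (m - 1)
  val_inv := by
    obtain _ | m := m
    · refine linearMap_ext fun w _ => (w 0).1.elim0
    · rw [← pow_succ']; exact tOp_pow ξ
  inv_val := by
    obtain _ | m := m
    · refine linearMap_ext fun w _ => (w 0).1.elim0
    · rw [← pow_succ]; exact tOp_pow ξ

/-- The generators of `G(m,1,n+1)` as invertible operators on `V_μ`. -/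
noncomputable def genUnit {m n : ℕ} (ξ : Fin m ≃ rootsOfUnity m ℂ) (μ : Fin m → YoungDiagram) :
    Gen n → (V n μ →ₗ[ℂ] V n μ)ˣ
  | Gen.t => tUnit n ξ μ
  | Gen.s i => ⟨sOp μ i, sOp μ i, sOp_sq i, sOp_sq i⟩

theorem genUnit_relator {m n : ℕ} (ξ : Fin m ≃ rootsOfUnity m ℂ) (μ : Fin m → YoungDiagram) :
    ∀ r ∈ {r | IsRelator m n r}, FreeGroup.lift (genUnit ξ μ) r = 1 := by
  rintro r (⟨i⟩ | ⟨i, j, h⟩ | ⟨i, j, h⟩ | ⟨i, h⟩ | ⟨i, h⟩ | _)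
  · simp only [map_mul, fs, FreeGroup.lift_apply_of]
    exact Units.ext (sOp_sq i)
  · simp only [map_mul, map_inv, fs, FreeGroup.lift_apply_of, mul_inv_eq_one]
    exact Units.ext (sOp_braid i j h)
  · simp only [map_mul, map_inv, fs, FreeGroup.lift_apply_of, mul_inv_eq_one]
    exact Units.ext (sOp_comm i j h)
  · simp only [map_mul, map_inv, fs, ft, FreeGroup.lift_apply_of, mul_inv_eq_one]
    exact Units.ext (tOp_sOp_braid ξ i h)
  · simp only [map_mul, map_inv, fs, ft, FreeGroup.lift_apply_of, mul_inv_eq_one]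
    exact Units.ext (tOp_sOp_comm ξ i h)
  · simp only [map_pow, ft, FreeGroup.lift_apply_of]
    exact Units.ext (by simpa [genUnit, tUnit] using tOp_pow ξ)

/-- The semi-normal representation of `G(m,1,n+1)` on `V_μ`: the irreducible representation attached
to the `m`-partition `μ`, with `s_{i+1}` acting by `sOp μ i` and `t` by `tOp n ξ μ`. (If `μ` does
not have `n+1` boxes, then `V_μ = 0`.) -/
noncomputable def seminormalRep {m : ℕ} (n : ℕ) (ξ : Fin m ≃ rootsOfUnity m ℂ)
    (μ : Fin m → YoungDiagram) : Representation ℂ (G m n) (V n μ) :=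
  (Units.coeHom (V n μ →ₗ[ℂ] V n μ)).comp (PresentedGroup.toGroup (genUnit_relator ξ μ))

theorem seminormalRep_s {m n : ℕ} (ξ : Fin m ≃ rootsOfUnity m ℂ) (μ : Fin m → YoungDiagram)
    (i : Fin n) : seminormalRep n ξ μ (gs m i) = sOp μ i := by
  simp [seminormalRep, gs, genUnit]

theorem seminormalRep_t {m n : ℕ} (ξ : Fin m ≃ rootsOfUnity m ℂ) (μ : Fin m → YoungDiagram) :
    seminormalRep n ξ μ (gt m n) = tOp n ξ μ := by
  simp [seminormalRep, gt, genUnit, tUnit]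

/-! ### The idempotent attached to a standard `m`-tableau -/

/-- Primitive idempotents of a ring. -/
def IsPrimitiveIdempotent {R : Type*} [Ring R] (e : R) : Prop :=
  IsIdempotentElem e ∧ e ≠ 0 ∧
    ∀ a b : R, IsIdempotentElem a → IsIdempotentElem b → a * b = 0 → b * a = 0 → a + b = e →
      a = 0 ∨ b = 0

/-- `E` is the diagonal matrix unit attached to the vector `e_T` of the semi-normal basis: it acts on
`V_lam` as the projector onto `e_T` along the other basis vectors, and as `0` on `V_μ` for every
`μ ≠ lam`. -/
structure IsTableauIdempotent {m n : ℕ} (ξ : Fin m ≃ rootsOfUnity m ℂ) {lam : Fin m → YoungDiagram}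
    (T : StdTableau n lam) (E : MonoidAlgebra ℂ (G m n)) : Prop where
  self : (seminormalRep n ξ lam).asAlgebraHom E (Finsupp.single T 1) = Finsupp.single T 1
  of_ne : ∀ S : StdTableau n lam, S ≠ T →
    (seminormalRep n ξ lam).asAlgebraHom E (Finsupp.single S 1) = 0
  of_shape_ne : ∀ μ : Fin m → YoungDiagram, μ ≠ lam → (seminormalRep n ξ μ).asAlgebraHom E = 0

/-! ### The rational function `Φ`

Let `K` be a field containing `ℂ`. The spectral parameters `u_1, …, u_{n+1}` are elements of `K`
(below they are the variables of a field of rational functions), the parameters `v_1, …, v_{n+1}` are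
complex numbers. -/

section Phi

variable {K : Type*} [Field K] [Algebra ℂ K] (m : ℕ) {n : ℕ}

open Classical in
/-- `s_{i+1}(p, p', a, a') = s_{i+1} + δ_{p,p'} / (a - a')`. -/
noncomputable def bs (i : Fin n) (p p' : ℂ) (a a' : K) : MonoidAlgebra K (G m n) :=
  MonoidAlgebra.single (gs m i) 1 + MonoidAlgebra.single 1 (if p = p' then 1 / (a - a') else 0)

/-- `t(v) = (1/m) ∑_{k=0}^{m-1} v^{m-k} t^k`. -/
noncomputable def bt (K : Type*) [Field K] [Algebra ℂ K] (n : ℕ) (v : ℂ) :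
    MonoidAlgebra K (G m n) :=
  ∑ k ∈ Finset.range m,
    MonoidAlgebra.single (gt m n ^ k) (algebraMap ℂ K ((1 / (m : ℂ)) * v ^ (m - k)))

/-- `φ_{k+1}(v_1, …, v_k, v, u_1, …, u_k, u)`, where `φ_1 = t(v)` and
`φ_{k+1} = s_k(v, v_k, u, u_k) φ_k s_k`. The argument `k` runs from `0` to `n`, and the values
`vs i`, `us i` are `v_{i+1}`, `u_{i+1}`; only those with `i < k` are used. -/
noncomputable def phi (vs : Fin (n + 1) → ℂ) (us : Fin (n + 1) → K) (v : ℂ) (u : K)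
    (k : Fin (n + 1)) : MonoidAlgebra K (G m n) :=
  Fin.induction (motive := fun _ => MonoidAlgebra K (G m n)) (bt m K n v)
    (fun i X => bs m i v (vs i.castSucc) u (us i.castSucc) * X * MonoidAlgebra.single (gs m i) 1) k

/-- `Φ(v_1, …, v_{n+1}, u_1, …, u_{n+1}) = φ_{n+1} φ_n ⋯ φ_1`, where `φ_{k+1}` is taken at
`(v_1, …, v_k, v_{k+1}, u_1, …, u_k, u_{k+1})`. -/
noncomputable def Phi (vs : Fin (n + 1) → ℂ) (us : Fin (n + 1) → K) : MonoidAlgebra K (G m n) :=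
  ((List.finRange (n + 1)).reverse.map fun k => phi m vs us (vs k) (us k) k).prod

end Phi

/-! ### Consecutive evaluations of rational functions -/

/-- The field `ℂ(u_1, …, u_N)` of rational functions. -/
abbrev RatField (N : ℕ) : Type := FractionRing (MvPolynomial (Fin N) ℂ)

/-- The variable `u_{i+1}` as a rational function. -/
noncomputable def uVar {N : ℕ} (i : Fin N) : RatField N :=
  algebraMap (MvPolynomial (Fin N) ℂ) (RatField N) (MvPolynomial.X i)

/-- Substitution of the number `c` for the variable with index `i` in a polynomial, the other
variables being kept. -/
noncomputable def substVar {N : ℕ} (i : Fin N) (c : ℂ) :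
    MvPolynomial (Fin N) ℂ →ₐ[ℂ] MvPolynomial (Fin N) ℂ :=
  MvPolynomial.aeval (Function.update MvPolynomial.X i (MvPolynomial.C c))

/-- The rational function `r` is non-singular along `u_{i+1} = c` and `r'` is its restriction: `r`
can be written as a fraction whose denominator does not vanish identically for `u_{i+1} = c`, and
`r'` is obtained by substituting `c` for `u_{i+1}` in this fraction. -/
def EvaluatesTo {N : ℕ} (i : Fin N) (c : ℂ) (r r' : RatField N) : Prop :=
  ∃ a b : MvPolynomial (Fin N) ℂ, substVar i c b ≠ 0 ∧
    r = algebraMap _ (RatField N) a / algebraMap _ (RatField N) b ∧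
    r' = algebraMap _ (RatField N) (substVar i c a) / algebraMap _ (RatField N) (substVar i c b)

/-- `X` is the value of the consecutive evaluations
`F |_{u_1 = c_1} |_{u_2 = c_2} ⋯ |_{u_N = c_N}` of a rational function `F` with values in the group
algebra `ℂ[Γ]`: each rational function in the chain is non-singular along the hyperplane at which it
is evaluated, and the last one is the constant `X`. -/
def ConsecutiveEvaluation {N : ℕ} {Γ : Type*} [Group Γ] (F : MonoidAlgebra (RatField N) Γ)
    (c : Fin N → ℂ) (X : MonoidAlgebra ℂ Γ) : Prop :=
  ∃ R : Fin (N + 1) → MonoidAlgebra (RatField N) Γ,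
    R 0 = F ∧
    (∀ (i : Fin N) (g : Γ), EvaluatesTo i (c i) ((R i.castSucc).coeff g) ((R i.succ).coeff g)) ∧
    R (Fin.last N) = MonoidAlgebra.mapRingHom Γ (algebraMap ℂ (RatField N)) X

end CyclotomicFusion

/-! Everything is read off in the semi-normal representations. Let `S` be a standard tableau that
agrees with `T` on the numbers up to `k`. With the earlier parameters set to the positions and
contents of `T`, the factor `φ_{k+1}` acts on `e_S` by a scalar. This scalar is `0` if the node of
`S` carrying `k + 1` has a position other than `p_{k+1}`. Otherwise it is `u / (u - c)`, where `c`
is the content of that node, times the product of `1 - 1 / (u - c_i)^2` over the earlier nodes at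
this position (`matAlg_phi_mulVec`). The induction on `k` is a computation in the span of `e_S` and
its image under one interchange, where the shift in `s_k(p,p',a,a')` is exactly what kills the
off-diagonal entry.

The product over the nodes telescopes (`prod_cells_telescope`) to a rational function whose zeros
and poles are governed by the row ends of the current diagram. At `u = c_{k+1}(T)` it is regular.
Its value is `0` if `S` has `k + 1` in another node. If the nodes agree, the value is the inverse of
a residue, which the hook formula `hookProd_eq_mul_residue` identifies with the ratio of the
coefficients `f` before and after adding the node (`phiScalar_evaluatesTo`). Hence, after `k`
evaluations, `φ_k ⋯ φ_1` becomes a constant element `Y_k` acting by `f⁻¹` of the shape of the first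
`k` nodes on those `e_S` that agree with `T` up to `k`, and by `0` on the others. For `k = n + 1`
this is `f⁻¹ E_T`.

To return from matrices to the group algebra one needs joint faithfulness, in the explicit form of a
Plancherel formula: the sum of the characters weighted by `f_μ` is `m^(n+1)` at `1` and `0`
elsewhere (`plancherel_eq`). It is proved by induction on `n`: every element of `G(m,1,n+2)` is
either a product of an element from `G(m,1,n+1)` with a power of a conjugate of `t`, or lies in the
double coset of the last `s` (`isSplit`). The corresponding sums over addable nodes come from
Lagrange interpolation (`sum_residue`, `sum_residue_div`). The formula expresses the coefficients of
an element acting diagonally as constant linear combinations of its eigenvalues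
(`coeff_of_diagonal`), so regularity and values transfer from eigenvalues to coefficients. It also
yields finiteness of the presented group, uniqueness of `E_T`, and, since `E_T` has rank one in a
single representation, primitivity. -/

namespace CyclotomicFusion

/-! ### Hook lengths, addable rows and residues at the row ends -/

open Finset

/-- The content of the first cell to the right of row `i`. -/
def rowContent (ν : YoungDiagram) (i : ℕ) : ℤ := (ν.rowLen i : ℤ) - i

theorem rowContent_strictAnti (ν : YoungDiagram) : StrictAnti (rowContent ν) := by
  intro i j h
  have := ν.rowLen_anti i j h.le
  simp only [rowContent]
  omega

theorem rowLen_eq_zero {ν : YoungDiagram} {L : ℕ} (hL : ν.colLen 0 ≤ L) : ν.rowLen L = 0 := by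
  by_contra h
  have := YoungDiagram.mem_iff_lt_colLen.1
    (YoungDiagram.mem_iff_lt_rowLen.2 (Nat.pos_of_ne_zero h))
  omega

theorem mem_iff_rows {ν : YoungDiagram} {L : ℕ} (hL : ν.colLen 0 ≤ L) (q : ℕ × ℕ) :
    q ∈ ν.cells ↔ q.1 ∈ range L ∧ q.2 ∈ range (ν.rowLen q.1) := by
  obtain ⟨i, j⟩ := q
  rw [YoungDiagram.mem_cells, YoungDiagram.mem_iff_lt_rowLen]
  simp only [mem_range]
  refine ⟨fun h => ⟨?_, h⟩, fun h => h.2⟩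
  by_contra hi
  rw [rowLen_eq_zero (hL.trans (not_lt.1 hi))] at h
  omega

theorem prod_cells {M : Type*} [CommMonoid M] {ν : YoungDiagram} {L : ℕ} (hL : ν.colLen 0 ≤ L)
    (f : ℕ × ℕ → M) : ∏ q ∈ ν.cells, f q = ∏ i ∈ range L, ∏ j ∈ range (ν.rowLen i), f (i, j) :=
  prod_finset_product _ _ _ (mem_iff_rows hL)

/-- The hook splits into its row part, which contains the node itself, and the part of its column
strictly below. The additive form avoids truncated subtraction. -/
theorem hookLength_eq {ν : YoungDiagram} {i j : ℕ} (h : (i, j) ∈ ν) :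
    hookLength ν (i, j) + (i + j + 1) = ν.rowLen i + ν.colLen j := by
  have h1 := YoungDiagram.mem_iff_lt_rowLen.1 h
  have h2 := YoungDiagram.mem_iff_lt_colLen.1 h
  have e : (ν.cells.filter fun r => (r.1 = i ∧ j ≤ r.2) ∨ (r.2 = j ∧ i ≤ r.1)) =
      (({i} : Finset ℕ) ×ˢ Ico j (ν.rowLen i)) ∪ (Ico (i + 1) (ν.colLen j) ×ˢ ({j} : Finset ℕ)) := by
    ext ⟨a, b⟩
    simp only [mem_filter, YoungDiagram.mem_cells, mem_union, mem_product, mem_singleton, mem_Ico]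
    constructor
    · rintro ⟨hm, ⟨rfl, hb⟩ | ⟨rfl, hb⟩⟩
      · exact Or.inl ⟨rfl, hb, YoungDiagram.mem_iff_lt_rowLen.1 hm⟩
      · have := YoungDiagram.mem_iff_lt_colLen.1 hm
        rcases hb.eq_or_lt with rfl | hb
        · exact Or.inl ⟨rfl, le_rfl, h1⟩
        · exact Or.inr ⟨⟨hb, this⟩, rfl⟩
    · rintro (⟨rfl, hb, hb'⟩ | ⟨⟨hb, hb'⟩, rfl⟩)
      · exact ⟨YoungDiagram.mem_iff_lt_rowLen.2 hb', Or.inl ⟨rfl, hb⟩⟩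
      · exact ⟨YoungDiagram.mem_iff_lt_colLen.2 hb', Or.inr ⟨rfl, by omega⟩⟩
  have hd : Disjoint (({i} : Finset ℕ) ×ˢ Ico j (ν.rowLen i))
      (Ico (i + 1) (ν.colLen j) ×ˢ ({j} : Finset ℕ)) := by
    rw [disjoint_left]
    rintro ⟨a, b⟩ hab hab'
    simp only [mem_product, mem_singleton, mem_Ico] at hab hab'
    omega
  rw [hookLength, e, card_union_of_disjoint hd]
  simp only [card_product, card_singleton, Nat.card_Ico]
  omega

/-- The hook lengths of row `i` and the differences of shifted row lengths fill an interval. -/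
theorem prod_hook_row {ν : YoungDiagram} {L i : ℕ} (hL : ν.colLen 0 ≤ L) (hi : i < L) :
    (∏ j ∈ range (ν.rowLen i), hookLength ν (i, j)) *
      ∏ k ∈ Ioo i L, (ν.rowLen i + k - (i + ν.rowLen k)) = (ν.rowLen i + L - 1 - i).factorial := by
  have anti := fun a b (h : a ≤ b) => ν.rowLen_anti a b h
  have canti := fun a b (h : a ≤ b) => ν.colLen_anti a b h
  have h0 := rowLen_eq_zero hL
  have hook : ∀ j, j < ν.rowLen i →
      hookLength ν (i, j) + (i + j + 1) = ν.rowLen i + ν.colLen j ∧ i < ν.colLen j ∧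
        ν.colLen j ≤ L := fun j hj => by
    have := YoungDiagram.mem_iff_lt_rowLen.2 hj
    exact ⟨hookLength_eq this, YoungDiagram.mem_iff_lt_colLen.1 this,
      (canti 0 j (Nat.zero_le _)).trans hL⟩
  set f : ℕ → ℕ := fun j => hookLength ν (i, j) with hf
  set g : ℕ → ℕ := fun k => ν.rowLen i + k - (i + ν.rowLen k) with hg
  have finj : Set.InjOn f (range (ν.rowLen i)) := by
    intro a ha b hb hab
    rw [coe_range, Set.mem_Iio] at ha hb
    have h1 := hook a ha
    have h2 := hook b hb
    simp only [hf] at hab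
    rcases lt_trichotomy a b with h | h | h
    · have := canti a b h.le; omega
    · exact h
    · have := canti b a h.le; omega
  have ginj : Set.InjOn g (Ioo i L) := by
    intro a ha b hb hab
    rw [coe_Ioo, Set.mem_Ioo] at ha hb
    have h1 := anti i a ha.1.le
    have h2 := anti i b hb.1.le
    simp only [hg] at hab
    rcases lt_trichotomy a b with h | h | h
    · have := anti a b h.le; omega
    · exact h
    · have := anti b a h.le; omega
  have hd : Disjoint ((range (ν.rowLen i)).image f) ((Ioo i L).image g) := by
    rw [disjoint_left]
    intro x hx hx'
    obtain ⟨j, hj, rfl⟩ := mem_image.1 hx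
    obtain ⟨k, hk, hjk⟩ := mem_image.1 hx'
    rw [mem_range] at hj
    rw [mem_Ioo] at hk
    have h1 := hook j hj
    have h2 := anti i k hk.1.le
    have h3 : j < ν.rowLen k ↔ k < ν.colLen j :=
      YoungDiagram.mem_iff_lt_rowLen.symm.trans YoungDiagram.mem_iff_lt_colLen
    simp only [hf, hg] at hjk
    -- Equality would force `colLen j + rowLen k = k + j + 1`. If `(k, j)` lies in the diagram the
    -- left side is at least `k + j + 2`, and otherwise it is at most `k + j`.
    by_cases h : j < ν.rowLen k
    · have := h3.1 h; omega
    · have := mt h3.2 h; omega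
  have hsub : (range (ν.rowLen i)).image f ∪ (Ioo i L).image g ⊆
      Icc 1 (ν.rowLen i + L - 1 - i) := by
    intro x hx
    rw [mem_Icc]
    rcases mem_union.1 hx with hx | hx
    · obtain ⟨j, hj, rfl⟩ := mem_image.1 hx
      rw [mem_range] at hj
      have h1 := hook j hj
      simp only [hf]; omega
    · obtain ⟨k, hk, rfl⟩ := mem_image.1 hx
      rw [mem_Ioo] at hk
      have h2 := anti i k hk.1.le
      simp only [hg]; omega
  -- Both sets have `rowLen i + (L - 1 - i)` elements, so the inclusion is an equality.
  have heq := eq_of_subset_of_card_le hsub (by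
    rw [card_union_of_disjoint hd, card_image_of_injOn finj, card_image_of_injOn ginj]
    simp only [Nat.card_Icc, card_range, Nat.card_Ioo]
    omega)
  have hfac : ∏ x ∈ Icc 1 (ν.rowLen i + L - 1 - i), x = (ν.rowLen i + L - 1 - i).factorial := by
    rw [← prod_range_add_one_eq_factorial, range_eq_Ico, prod_Ico_add' (fun x => x) 0 _ 1]
    congr 1
  rw [← hfac, ← heq, prod_union hd, prod_image finj, prod_image ginj]

theorem hookLength_pos {ν : YoungDiagram} {q : ℕ × ℕ} (h : q ∈ ν.cells) : 0 < hookLength ν q :=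
  card_pos.2 ⟨q, by simp [mem_filter, h]⟩

/-- The product of the hook lengths of a diagram. -/
noncomputable def hookProd (ν : YoungDiagram) : ℂ := ∏ q ∈ ν.cells, (hookLength ν q : ℂ)

theorem hookProd_ne_zero (ν : YoungDiagram) : hookProd ν ≠ 0 :=
  prod_ne_zero_iff.2 fun _ hq => Nat.cast_ne_zero.2 (hookLength_pos hq).ne'

/-- A cell can be added to the row `x`. -/
def IsAddable (ν : YoungDiagram) (x : ℕ) : Prop := ∀ i, i < x → ν.rowLen x < ν.rowLen i

/-- The rows to which a cell can be added. -/
abbrev AddRow (ν : YoungDiagram) : Type := {x : ℕ // IsAddable ν x}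

theorem IsAddable.le_colLen {ν : YoungDiagram} {x : ℕ} (h : IsAddable ν x) : x ≤ ν.colLen 0 := by
  by_contra hx
  have := h _ (not_le.1 hx)
  rw [rowLen_eq_zero le_rfl] at this
  omega

noncomputable instance (ν : YoungDiagram) : Fintype (AddRow ν) :=
  (Set.Finite.subset (Set.finite_Iic (ν.colLen 0)) fun _ h =>
    IsAddable.le_colLen h : {x | IsAddable ν x}.Finite).fintype

/-- The diagram with one more cell in the row `x`. -/
def addCell (ν : YoungDiagram) (x : AddRow ν) : YoungDiagram where
  cells := insert (x.1, ν.rowLen x.1) ν.cells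
  isLowerSet := by
    rintro ⟨a, b⟩ ⟨a', b'⟩ ⟨h1, h2⟩ hq
    simp only [coe_insert, Set.mem_insert_iff, mem_coe, YoungDiagram.mem_cells, Prod.mk.injEq]
      at hq ⊢
    simp only at h1 h2
    rcases hq with ⟨rfl, rfl⟩ | hq
    · rcases h1.lt_or_eq with h1 | rfl
      · have := x.2 a' h1
        exact Or.inr (YoungDiagram.mem_iff_lt_rowLen.2 (by omega))
      · rcases h2.lt_or_eq with h2 | rfl
        · exact Or.inr (YoungDiagram.mem_iff_lt_rowLen.2 h2)
        · exact Or.inl ⟨rfl, rfl⟩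
    · exact Or.inr (ν.up_left_mem h1 h2 hq)

theorem mem_addCell {ν : YoungDiagram} {x : AddRow ν} {q : ℕ × ℕ} :
    q ∈ addCell ν x ↔ q = (x.1, ν.rowLen x.1) ∨ q ∈ ν := by
  rw [← YoungDiagram.mem_cells, addCell, mem_insert, YoungDiagram.mem_cells]

theorem rowLen_addCell (ν : YoungDiagram) (x : AddRow ν) (i : ℕ) :
    (addCell ν x).rowLen i = if i = x.1 then ν.rowLen i + 1 else ν.rowLen i := by
  refine eq_of_forall_lt_iff fun j => ?_
  rw [← YoungDiagram.mem_iff_lt_rowLen, mem_addCell, YoungDiagram.mem_iff_lt_rowLen, Prod.mk.injEq]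
  split_ifs with h
  · subst h; omega
  · omega

theorem colLen_addCell_le (ν : YoungDiagram) (x : AddRow ν) {L : ℕ} (hL : ν.colLen 0 < L) :
    (addCell ν x).colLen 0 ≤ L := by
  by_contra h
  have h1 := YoungDiagram.mem_iff_lt_rowLen.1 (YoungDiagram.mem_iff_lt_colLen.2 (not_le.1 h))
  have h2 := x.2.le_colLen
  rw [rowLen_addCell, rowLen_eq_zero hL.le] at h1
  split_ifs at h1 <;> omega

theorem prod_hook_row_cast {ν : YoungDiagram} {L i : ℕ} (hL : ν.colLen 0 ≤ L) (hi : i < L) :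
    (∏ j ∈ range (ν.rowLen i), (hookLength ν (i, j) : ℂ)) *
      ∏ k ∈ Ioo i L, ((rowContent ν i : ℂ) - rowContent ν k) =
        (ν.rowLen i + L - 1 - i).factorial := by
  rw [← prod_hook_row hL hi]
  push_cast
  congr 1
  refine prod_congr rfl fun k hk => ?_
  rw [mem_Ioo] at hk
  have := ν.rowLen_anti i k hk.1.le
  rw [Nat.cast_sub (by omega)]
  simp only [rowContent]
  push_cast
  ring

theorem rowContent_sub_ne_zero (ν : YoungDiagram) {i k : ℕ} (h : i ≠ k) :
    (rowContent ν i : ℂ) - rowContent ν k ≠ 0 := by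
  refine sub_ne_zero.2 (Int.cast_injective.ne ?_)
  exact (rowContent_strictAnti ν).injective.ne h

theorem rowContent_addCell (ν : YoungDiagram) (x : AddRow ν) (i : ℕ) :
    rowContent (addCell ν x) i = if i = x.1 then rowContent ν i + 1 else rowContent ν i := by
  simp only [rowContent, rowLen_addCell]
  split_ifs <;> push_cast <;> ring

/-- In `prod_hook_row_cast`, adding a cell to row `x` moves only the end of that row. A row above
`x` feels this in the single factor `k = x`, row `x` in all its factors and in the factorial, and a
lower row not at all. -/
theorem hookRow_ratio {ν : YoungDiagram} {L : ℕ} (hL : ν.colLen 0 < L) (x : AddRow ν) {i : ℕ}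
    (hi : i < L) :
    (∏ j ∈ range (ν.rowLen i), (hookLength ν (i, j) : ℂ)) =
      (∏ j ∈ range ((addCell ν x).rowLen i), (hookLength (addCell ν x) (i, j) : ℂ)) *
      if i < x.1 then ((rowContent ν x.1 : ℂ) + 1 - rowContent ν i) /
          ((rowContent ν x.1 : ℂ) - rowContent ν i)
        else if i = x.1 then (∏ k ∈ Ioo i L, ((rowContent ν x.1 : ℂ) + 1 - rowContent ν k) /
          ((rowContent ν x.1 : ℂ) - rowContent ν k)) / ((rowContent ν x.1 : ℂ) - rowContent ν L)
        else 1 := by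
  have e1 := prod_hook_row_cast hL.le hi
  have e2 := prod_hook_row_cast (colLen_addCell_le ν x hL) hi
  have n1 : ∏ k ∈ Ioo i L, ((rowContent ν i : ℂ) - rowContent ν k) ≠ 0 :=
    prod_ne_zero_iff.2 fun k hk => rowContent_sub_ne_zero ν (mem_Ioo.1 hk).1.ne
  have n2 : ∏ k ∈ Ioo i L,
      ((rowContent (addCell ν x) i : ℂ) - rowContent (addCell ν x) k) ≠ 0 :=
    prod_ne_zero_iff.2 fun k hk => rowContent_sub_ne_zero _ (mem_Ioo.1 hk).1.ne
  have hxL : x.1 < L := x.2.le_colLen.trans_lt hL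
  rw [← eq_div_iff n1] at e1
  rw [← eq_div_iff n2] at e2
  rw [e1, e2]
  rcases lt_trichotomy i x.1 with h | rfl | h
  · rw [if_pos h, rowLen_addCell, if_neg h.ne]
    have hx : x.1 ∈ Ioo i L := mem_Ioo.2 ⟨h, hxL⟩
    have n3 := rowContent_sub_ne_zero ν h.ne'
    have n3' := rowContent_sub_ne_zero ν h.ne
    rw [← mul_prod_erase _ _ hx] at n1 n2 ⊢
    rw [← mul_prod_erase _ _ hx]
    have e3 : ∏ k ∈ (Ioo i L).erase x.1,
        ((rowContent (addCell ν x) i : ℂ) - rowContent (addCell ν x) k) =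
        ∏ k ∈ (Ioo i L).erase x.1, ((rowContent ν i : ℂ) - rowContent ν k) :=
      prod_congr rfl fun k hk => by
        rw [rowContent_addCell, rowContent_addCell, if_neg h.ne, if_neg (ne_of_mem_erase hk)]
    rw [e3] at n2 ⊢
    have n4 := left_ne_zero_of_mul n2
    have n5 := right_ne_zero_of_mul n2
    rw [rowContent_addCell, rowContent_addCell, if_neg h.ne, if_pos rfl] at n4 ⊢
    push_cast at n4 ⊢
    field_simp
    ring
  · rw [if_neg (lt_irrefl _), if_pos rfl, rowLen_addCell, if_pos rfl]
    have e3 : ∏ k ∈ Ioo x.1 L,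
        ((rowContent (addCell ν x) x.1 : ℂ) - rowContent (addCell ν x) k) =
        ∏ k ∈ Ioo x.1 L, ((rowContent ν x.1 : ℂ) + 1 - rowContent ν k) :=
      prod_congr rfl fun k hk => by
        rw [rowContent_addCell, rowContent_addCell, if_pos rfl, if_neg (mem_Ioo.1 hk).1.ne']
        push_cast; rfl
    rw [e3] at n2 ⊢
    rw [prod_div_distrib]
    have e4 : ν.rowLen x.1 + 1 + L - 1 - x.1 = (ν.rowLen x.1 + L - 1 - x.1) + 1 := by omega
    have e5 : (rowContent ν x.1 : ℂ) - rowContent ν L =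
        ((ν.rowLen x.1 + L - 1 - x.1 : ℕ) : ℂ) + 1 := by
      have : (rowContent ν x.1 - rowContent ν L : ℤ) =
          ((ν.rowLen x.1 + L - 1 - x.1 : ℕ) : ℤ) + 1 := by
        simp only [rowContent, rowLen_eq_zero hL.le]
        omega
      exact_mod_cast this
    have n6 : ((ν.rowLen x.1 + L - 1 - x.1 : ℕ) : ℂ) + 1 ≠ 0 :=
      Nat.cast_add_one_ne_zero _
    rw [e4, e5, Nat.factorial_succ]
    push_cast
    field_simp
  · rw [if_neg h.le.not_gt, if_neg h.ne', rowLen_addCell, if_neg h.ne', mul_one]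
    congr 1
    refine prod_congr rfl fun k hk => ?_
    rw [rowContent_addCell, rowContent_addCell, if_neg h.ne',
      if_neg (h.trans (mem_Ioo.1 hk).1).ne']

/-- The residue at the content of row `r` of the rational function attached to `ν`. -/
noncomputable def residue (ν : YoungDiagram) (L r : ℕ) : ℂ :=
  (∏ i ∈ range L, ((rowContent ν r : ℂ) + 1 - rowContent ν i)) /
    ∏ i ∈ (range (L + 1)).erase r, ((rowContent ν r : ℂ) - rowContent ν i)

/-- Multiplying the row ratios over all rows assembles the residue; the factor `i = x` of its
numerator is `1`. -/
theorem hookProd_eq_mul_residue {ν : YoungDiagram} {L : ℕ} (hL : ν.colLen 0 < L) (x : AddRow ν) :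
    hookProd ν = hookProd (addCell ν x) * residue ν L x.1 := by
  have hxL : x.1 < L := x.2.le_colLen.trans_lt hL
  rw [hookProd, hookProd, prod_cells hL.le, prod_cells (colLen_addCell_le ν x hL),
    prod_congr rfl fun i hi => hookRow_ratio hL x (mem_range.1 hi), prod_mul_distrib]
  congr 1
  have e1 : (range (L + 1)).erase x.1 = insert L ((range L).erase x.1) := by
    ext a; simp only [mem_erase, mem_range, mem_insert]; omega
  have e2 : (range L).erase x.1 = range x.1 ∪ Ioo x.1 L := by
    ext a; simp only [mem_erase, mem_range, mem_union, mem_Ioo]; omega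
  have hd : Disjoint (range x.1) (Ioo x.1 L) := by
    rw [disjoint_left]; intro a; simp only [mem_range, mem_Ioo]; omega
  rw [residue, e1, prod_insert (by simp), ← mul_prod_erase (range L) _ (mem_range.2 hxL),
    ← mul_prod_erase (range L) _ (mem_range.2 hxL), if_neg (lt_irrefl _), if_pos rfl, e2,
    prod_union hd, prod_union hd, prod_union hd]
  have f1 : ∀ i ∈ Ioo x.1 L, ¬ i < x.1 ∧ i ≠ x.1 := fun i hi => by
    rw [mem_Ioo] at hi; omega
  rw [prod_congr rfl fun i hi => if_pos (mem_range.1 hi),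
    prod_congr (s₁ := Ioo x.1 L) rfl fun i hi => (if_neg (f1 i hi).1).trans (if_neg (f1 i hi).2),
    prod_const_one, prod_div_distrib, prod_div_distrib]
  simp only [div_eq_mul_inv, mul_inv]
  ring

/-- A row that is not addable has the same length as the row above it, so the numerator factor with
index `r - 1` vanishes. This lets sums over addable rows run over all rows. -/
theorem residue_eq_zero {ν : YoungDiagram} {L r : ℕ} (hr : r ≤ L) (h : ¬ IsAddable ν r) :
    residue ν L r = 0 := by
  simp only [IsAddable, not_forall, not_lt] at h
  obtain ⟨i, hi, hle⟩ := h
  have h1 := ν.rowLen_anti i (r - 1) (by omega)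
  have h2 := ν.rowLen_anti (r - 1) r (by omega)
  rw [residue, div_eq_zero_iff]
  left
  refine prod_eq_zero (i := r - 1) (mem_range.2 (by omega)) ?_
  have : rowContent ν r + 1 - rowContent ν (r - 1) = 0 := by
    simp only [rowContent]; omega
  exact_mod_cast this

theorem rowContent_injOn (ν : YoungDiagram) (s : Finset ℕ) :
    Set.InjOn (fun i => (rowContent ν i : ℂ)) s :=
  (Int.cast_injective.comp (rowContent_strictAnti ν).injective).injOn

/-- Lagrange interpolation at the `L + 1` distinct row ends: the sum is the coefficient of degree
`L` of a monic polynomial of degree `L`. -/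
theorem sum_residue (ν : YoungDiagram) (L : ℕ) : ∑ r ∈ range (L + 1), residue ν L r = 1 := by
  let P : Polynomial ℂ := ∏ i ∈ range L, (Polynomial.X - Polynomial.C ((rowContent ν i : ℂ) - 1))
  have hm : P.Monic := Polynomial.monic_prod_of_monic _ _ fun i _ => Polynomial.monic_X_sub_C _
  have hd : P.degree = L := by
    simp only [P, Polynomial.degree_prod, Polynomial.degree_X_sub_C]
    simp
  have := Lagrange.leadingCoeff_eq_sum (rowContent_injOn ν (range (L + 1))) (P := P)
    (by rw [hd, card_range]; rfl)
  rw [hm.leadingCoeff] at this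
  rw [this]
  refine sum_congr rfl fun r _ => ?_
  rw [residue, Polynomial.eval_prod]
  congr 1
  refine prod_congr rfl fun i _ => ?_
  simp only [Polynomial.eval_sub, Polynomial.eval_X, Polynomial.eval_C]
  ring

/-- The division removes the factor with index `r₀` from the interpolated polynomial, whose degree
drops to `L - 1`, so its coefficient of degree `L` is zero. Row `r₀` ends in a corner, hence no row
end equals the content of that corner and no denominator vanishes. -/
theorem sum_residue_div {ν : YoungDiagram} {L r₀ : ℕ} (hr₀ : r₀ < L)
    (h : ν.rowLen (r₀ + 1) < ν.rowLen r₀) :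
    ∑ r ∈ range (L + 1), residue ν L r / ((rowContent ν r : ℂ) - (rowContent ν r₀ - 1)) = 0 := by
  let P : Polynomial ℂ :=
    ∏ i ∈ (range L).erase r₀, (Polynomial.X - Polynomial.C ((rowContent ν i : ℂ) - 1))
  have hd : P.degree = ((L - 1 : ℕ) : WithBot ℕ) := by
    simp only [P, Polynomial.degree_prod, Polynomial.degree_X_sub_C]
    simp [hr₀]
  have := Lagrange.coeff_eq_sum (rowContent_injOn ν (range (L + 1))) (P := P)
    (by rw [hd, card_range]; exact_mod_cast (by omega))
  rw [Polynomial.coeff_eq_zero_of_degree_lt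
    (by rw [hd, card_range]; exact_mod_cast (by omega))] at this
  rw [this]
  refine sum_congr rfl fun r _ => ?_
  have hne : (rowContent ν r : ℂ) - (rowContent ν r₀ - 1) ≠ 0 := by
    have : rowContent ν r - (rowContent ν r₀ - 1) ≠ 0 := by
      simp only [rowContent]
      rcases le_or_gt r r₀ with hr | hr
      · have := ν.rowLen_anti r r₀ hr; omega
      · have := ν.rowLen_anti (r₀ + 1) r hr; omega
    exact_mod_cast this
  rw [residue, ← mul_prod_erase (range L) _ (mem_range.2 hr₀), Polynomial.eval_prod]
  have e : ∀ i, Polynomial.eval (rowContent ν r : ℂ)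
      (Polynomial.X - Polynomial.C ((rowContent ν i : ℂ) - 1)) =
        (rowContent ν r : ℂ) + 1 - rowContent ν i := fun i => by
    simp only [Polynomial.eval_sub, Polynomial.eval_X, Polynomial.eval_C]; ring
  simp only [e]
  have e' : (rowContent ν r : ℂ) + 1 - rowContent ν r₀ =
    (rowContent ν r : ℂ) - (rowContent ν r₀ - 1) := by ring
  rw [e']
  field_simp

/-- Converts sums over addable cells weighted by inverse hook products into sums of residues, to
which the interpolation identities apply. -/
theorem sum_addRow (ν : YoungDiagram) {L : ℕ} (hL : ν.colLen 0 < L) (f : ℕ → ℂ) :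
    ∑ x : AddRow ν, (hookProd (addCell ν x))⁻¹ * f x.1 =
      (hookProd ν)⁻¹ * ∑ r ∈ range (L + 1), residue ν L r * f r := by
  classical
  have h1 : ∀ x : AddRow ν, (hookProd (addCell ν x))⁻¹ * f x.1 =
      (hookProd ν)⁻¹ * (residue ν L x.1 * f x.1) := fun x => by
    have := hookProd_eq_mul_residue hL x
    have n1 := hookProd_ne_zero ν
    have n2 := hookProd_ne_zero (addCell ν x)
    field_simp
    rw [this]; ring
  rw [sum_congr rfl fun x _ => h1 x, ← mul_sum]
  congr 1
  rw [← sum_filter_of_ne (p := IsAddable ν)]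
  · rw [← sum_subtype (f := fun r => residue ν L r * f r)]
    intro r
    rw [mem_filter, mem_range]
    exact ⟨fun h => h.2, fun h => ⟨by have := h.le_colLen; omega, h⟩⟩
  · intro r hr hne
    by_contra h
    rw [residue_eq_zero (by rw [mem_range] at hr; omega) h, zero_mul] at hne
    exact hne rfl

theorem sum_inv_hookProd (ν : YoungDiagram) :
    ∑ x : AddRow ν, (hookProd (addCell ν x))⁻¹ = (hookProd ν)⁻¹ := by
  have := sum_addRow ν (Nat.lt_succ_self (ν.colLen 0)) fun _ => 1
  simpa [sum_residue] using this

/-- The cell is a corner, so its content is the row end of row `r` minus one, as in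
`sum_residue_div`. This is the source of the vanishing of the weighted trace on the double coset of
the last `s`. -/
theorem sum_inv_hookProd_div {ν : YoungDiagram} {r c : ℕ} (h : (r, c) ∈ ν)
    (h1 : (r, c + 1) ∉ ν) (h2 : (r + 1, c) ∉ ν) :
    ∑ x : AddRow ν, (hookProd (addCell ν x))⁻¹ *
      ((rowContent ν x.1 - ((c : ℤ) - r) : ℤ) : ℂ)⁻¹ = 0 := by
  rw [YoungDiagram.mem_iff_lt_rowLen] at h h1 h2
  have hr : r < ν.colLen 0 := YoungDiagram.mem_iff_lt_colLen.1
    (YoungDiagram.mem_iff_lt_rowLen.2 ((Nat.zero_le _).trans_lt h))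
  have := sum_addRow ν (Nat.lt_succ_self (ν.colLen 0)) fun x =>
    ((rowContent ν x - ((c : ℤ) - r) : ℤ) : ℂ)⁻¹
  rw [this]
  have e := sum_residue_div (ν := ν) (L := (ν.colLen 0).succ) (r₀ := r) (by omega) (by omega)
  have e2 : ((rowContent ν r : ℂ) - 1) = ((c : ℤ) - r : ℤ) := by
    have : rowContent ν r - 1 = (c : ℤ) - r := by simp only [rowContent]; omega
    exact_mod_cast this
  rw [e2] at e
  rw [← mul_zero (hookProd ν)⁻¹, ← e]
  simp only [div_eq_mul_inv, Int.cast_sub]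

/-- The product over the cells telescopes along the rows. -/
theorem prod_cells_telescope {K : Type*} [Field K] {u : K} (hu : ∀ z : ℤ, u - z ≠ 0)
    {ν : YoungDiagram} {L : ℕ} (hL : ν.colLen 0 ≤ L) :
    u * ∏ q ∈ ν.cells, (1 - 1 / (u - (((q.2 : ℤ) - q.1 : ℤ) : K)) ^ 2) =
      (∏ i ∈ range (L + 1), (u - rowContent ν i)) / ∏ i ∈ range L, (u + 1 - rowContent ν i) := by
  -- Each factor is `(u - c - 1)(u - c + 1) / (u - c)^2`, and the contents along a row are
  -- consecutive, so only the two ends of the row survive.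
  have hrow : ∀ i l : ℕ, ∏ j ∈ range l, (1 - 1 / (u - (((j : ℤ) - i : ℤ) : K)) ^ 2) =
      (u - ((l - i : ℤ) : K)) / (u + 1 - ((l - i : ℤ) : K)) * ((u + (i + 1 : ℕ)) / (u + i)) := by
    intro i l
    have n0 : u + i ≠ 0 := by have := hu (-i); simpa using this
    have n0' : u + i + 1 ≠ 0 := by
      have := hu (-(i + 1)); push_cast at this; convert this using 1; ring
    induction l with
    | zero =>
      push_cast
      simp only [range_zero, prod_empty, zero_sub, sub_neg_eq_add]
      field_simp
      rw [← add_assoc, add_right_comm u 1 (i : K), div_self n0']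
    | succ l ih =>
      rw [prod_range_succ, ih]
      have n1 : u - ((l - i : ℤ) : K) ≠ 0 := hu _
      have n2 : u + 1 - ((l - i : ℤ) : K) ≠ 0 := by
        have := hu (l - i - 1); push_cast at this ⊢; convert this using 1; ring
      have n3 : u + 1 - ((((l + 1 : ℕ) : ℤ) - i : ℤ) : K) ≠ 0 := by
        have := hu (l - i); push_cast at this ⊢; convert this using 1; ring
      push_cast at n1 n2 n3 ⊢
      field_simp
      ring
  -- The left ends telescope down the first column to `(u + L) / u`; `u + L` is the factor of the
  -- empty row `L`.
  have hall : ∀ L : ℕ, u * ∏ i ∈ range L, ((u - rowContent ν i) / (u + 1 - rowContent ν i) *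
      ((u + (i + 1 : ℕ)) / (u + i))) =
        (u + L) * ((∏ i ∈ range L, (u - rowContent ν i)) /
          ∏ i ∈ range L, (u + 1 - rowContent ν i)) := by
    intro L
    induction L with
    | zero => simp
    | succ L ih =>
      have n0 : u + L ≠ 0 := by have := hu (-L); simpa using this
      rw [prod_range_succ, ← mul_assoc, ih, prod_range_succ, prod_range_succ]
      simp only [div_eq_mul_inv, mul_inv]
      field_simp
  rw [prod_cells hL, prod_congr rfl fun i _ => hrow i (ν.rowLen i)]
  have := hall L
  simp only [rowContent] at this ⊢
  rw [this, prod_range_succ, rowLen_eq_zero hL]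
  push_cast
  ring

end CyclotomicFusion

namespace CyclotomicFusion

/-! ### The tower of groups and its double cosets -/

section Group

variable {m n : ℕ}

theorem mk_eq_one {r : FreeGroup (Gen n)} (h : IsRelator m n r) :
    PresentedGroup.mk {r | IsRelator m n r} r = 1 :=
  PresentedGroup.mk_eq_one_iff.2 (Subgroup.subset_normalClosure h)

theorem gs_sq (i : Fin n) : gs m i * gs m i = 1 := mk_eq_one (IsRelator.s_sq i)

theorem gs_braid (i j : Fin n) (h : (j : ℕ) = i + 1) :
    gs m i * gs m j * gs m i = gs m j * gs m i * gs m j :=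
  mul_inv_eq_one.1 (mk_eq_one (IsRelator.s_braid i j h))

theorem gs_comm (i j : Fin n) (h : (i : ℕ) + 1 < j) : gs m i * gs m j = gs m j * gs m i :=
  mul_inv_eq_one.1 (mk_eq_one (IsRelator.s_comm i j h))

theorem gt_braid (i : Fin n) (h : (i : ℕ) = 0) :
    gt m n * gs m i * gt m n * gs m i = gs m i * gt m n * gs m i * gt m n :=
  mul_inv_eq_one.1 (mk_eq_one (IsRelator.t_braid i h))

theorem gt_comm (i : Fin n) (h : 0 < (i : ℕ)) : gs m i * gt m n = gt m n * gs m i :=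
  mul_inv_eq_one.1 (mk_eq_one (IsRelator.t_comm i h))

theorem gt_pow : gt m n ^ m = 1 := mk_eq_one IsRelator.t_pow

/-- The images of the generators of `G(m,1,n+1)` in `G(m,1,n+2)`. -/
def inclGen (m n : ℕ) : Gen n → G m (n + 1)
  | Gen.t => gt m (n + 1)
  | Gen.s i => gs m i.castSucc

theorem inclGen_relator (m n : ℕ) :
    ∀ r ∈ {r | IsRelator m n r}, FreeGroup.lift (inclGen m n) r = 1 := by
  rintro r (⟨i⟩ | ⟨i, j, h⟩ | ⟨i, j, h⟩ | ⟨i, h⟩ | ⟨i, h⟩ | _) <;>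
    simp only [map_mul, map_inv, map_pow, fs, ft, FreeGroup.lift_apply_of, mul_inv_eq_one, inclGen]
  · exact gs_sq _
  · exact gs_braid _ _ h
  · exact gs_comm _ _ h
  · exact gt_braid _ h
  · exact gt_comm _ h
  · exact gt_pow

/-- The homomorphism `G(m,1,n+1) → G(m,1,n+2)` that preserves the generators. -/
def incl (m n : ℕ) : G m n →* G m (n + 1) := PresentedGroup.toGroup (inclGen_relator m n)

@[simp] theorem incl_gt : incl m n (gt m n) = gt m (n + 1) :=
  PresentedGroup.toGroup.of (inclGen_relator m n)

@[simp] theorem incl_gs (i : Fin n) : incl m n (gs m i) = gs m i.castSucc :=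
  PresentedGroup.toGroup.of (inclGen_relator m n)

theorem generators_mem (H : Subgroup (G m n)) (ht : gt m n ∈ H) (hs : ∀ i, gs m i ∈ H) (g : G m n) :
    g ∈ H := by
  refine PresentedGroup.generated_by _ H (fun j => ?_) g
  cases j with
  | t => exact ht
  | s i => exact hs i

/-- The last generator `s_{n+1}` of `G(m,1,n+2)`. -/
def lastS (m n : ℕ) : G m (n + 1) := gs m (Fin.last n)

theorem lastS_sq : lastS m n * lastS m n = 1 := gs_sq _

theorem lastS_inv : (lastS m n)⁻¹ = lastS m n := inv_eq_of_mul_eq_one_left lastS_sq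

/-- The conjugate of `t` that multiplies the last coordinate by a root of unity. -/
def lastT (m : ℕ) : (n : ℕ) → G m n
  | 0 => gt m 0
  | n + 1 => lastS m n * incl m n (lastT m n) * lastS m n

theorem lastT_pow : ∀ n, lastT m n ^ m = 1
  | 0 => gt_pow
  | n + 1 => by
    have : lastT m (n + 1) = lastS m n * incl m n (lastT m n) * (lastS m n)⁻¹ := by
      rw [lastS_inv]; rfl
    rw [this, conj_pow, ← map_pow, lastT_pow n]
    simp

theorem lastT_succ_pow (j : ℕ) :
    lastT m (n + 1) ^ j = lastS m n * incl m n (lastT m n ^ j) * lastS m n := by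
  have : lastT m (n + 1) = lastS m n * incl m n (lastT m n) * (lastS m n)⁻¹ := by
    rw [lastS_inv]; rfl
  rw [this, conj_pow, ← map_pow, lastS_inv]

theorem lastS_commute (h : G m n) : Commute (lastS m (n + 1)) (incl m (n + 1) (incl m n h)) := by
  suffices h ∈ (Subgroup.centralizer {lastS m (n + 1)}).comap
      ((incl m (n + 1)).comp (incl m n)) by
    exact (Subgroup.mem_centralizer_singleton_iff.1 (Subgroup.mem_comap.1 this)).symm
  refine generators_mem _ ?_ (fun i => ?_) h <;>
    rw [Subgroup.mem_comap, Subgroup.mem_centralizer_singleton_iff]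
  · simpa [lastS] using (gt_comm (m := m) (Fin.last (n + 1)) (by simp)).symm
  · simpa [lastS] using gs_comm (m := m) i.castSucc.castSucc (Fin.last (n + 1)) (by simp)

theorem incl_lastS : incl m (n + 1) (lastS m n) = gs m (Fin.last n).castSucc := by
  simp [lastS]

theorem lastS_braid : lastS m (n + 1) * incl m (n + 1) (lastS m n) * lastS m (n + 1) =
    incl m (n + 1) (lastS m n) * lastS m (n + 1) * incl m (n + 1) (lastS m n) := by
  rw [incl_lastS]
  exact (gs_braid _ _ (by simp)).symm

/-- The only generator is `t`; since it has finite order, natural exponents suffice. -/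
theorem eq_gt_pow (hm : 1 ≤ m) (g : G m 0) : ∃ j : ℕ, g = gt m 0 ^ j := by
  have h : g ∈ Subgroup.zpowers (gt m 0) :=
    generators_mem _ (Subgroup.mem_zpowers _) (fun i => i.elim0) g
  have hf : IsOfFinOrder (gt m 0) := isOfFinOrder_iff_pow_eq_one.2 ⟨m, hm, gt_pow⟩
  obtain ⟨j, hj⟩ := hf.mem_powers_iff_mem_zpowers.2 h
  exact ⟨j, hj.symm⟩

theorem generators_mem' (H : Subgroup (G m (n + 1))) (hi : ∀ h, incl m n h ∈ H)
    (hs : lastS m n ∈ H) (g : G m (n + 1)) : g ∈ H := by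
  refine generators_mem H (by simpa using hi (gt m n)) (fun i => ?_) g
  refine Fin.lastCases hs (fun i => ?_) i
  simpa using hi (gs m i)

/-- For the smallest group this is the relation between `t` and `s_1`. In the step, the group one
level down commutes with the outer `s` and, by induction, with the inner conjugate of `t`.
Commutation with the remaining generator follows from the braid relation. -/
theorem lastT_commute (hm : 1 ≤ m) :
    ∀ (n : ℕ) (h : G m n), Commute (lastT m (n + 1)) (incl m n h)
  | 0, h => by
    obtain ⟨j, rfl⟩ := eq_gt_pow hm h
    rw [map_pow, incl_gt]
    refine Commute.pow_right ?_ j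
    have := gt_braid (m := m) (Fin.last 0) rfl
    simp only [Commute, SemiconjBy, lastT, incl_gt, lastS]
    rw [← this]
    simp only [mul_assoc]
  | n + 1, h => by
    suffices h ∈ (Subgroup.centralizer {lastT m (n + 2)}).comap (incl m (n + 1)) by
      exact (Subgroup.mem_centralizer_singleton_iff.1 (Subgroup.mem_comap.1 this)).symm
    refine generators_mem' _ (fun h => ?_) ?_ h <;>
      rw [Subgroup.mem_comap, Subgroup.mem_centralizer_singleton_iff]
    · have h1 := lastS_commute h
      have h2 := (lastT_commute hm n h).map (incl m (n + 1))
      exact ((h1.mul_left h2).mul_left h1).symm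
    · set a := lastS m (n + 1) with ha
      set b := incl m (n + 1) (lastS m n) with hb
      set x := incl m (n + 1) (incl m n (lastT m n)) with hx
      have hax : a * x = x * a := lastS_commute _
      have hab : a * b * a = b * a * b := lastS_braid
      have e : lastT m (n + 2) = a * (b * x * b) * a := by
        change a * incl m (n + 1) (lastS m n * incl m n (lastT m n) * lastS m n) * a = _
        simp only [map_mul, hb, hx]
      rw [e]
      calc b * (a * (b * x * b) * a) = (b * a * b) * x * b * a := by simp only [mul_assoc]
        _ = a * b * (a * x) * b * a := by rw [← hab]; simp only [mul_assoc]
        _ = a * b * x * (a * b * a) := by rw [hax]; simp only [mul_assoc]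
        _ = a * (b * x * b) * a * b := by rw [hab]; simp only [mul_assoc]

/-- `g` lies in one of the double cosets of `G(m,1,n+1)` in `G(m,1,n+2)`. -/
def IsSplit (g : G m (n + 1)) : Prop :=
  (∃ (h : G m n) (j : ℕ), g = incl m n h * lastT m (n + 1) ^ j) ∨
    ∃ h h' : G m n, g = incl m n h * lastS m n * incl m n h'

theorem IsSplit.mul_incl (hm : 1 ≤ m) {g : G m (n + 1)} (hg : IsSplit g) (k : G m n) :
    IsSplit (g * incl m n k) := by
  rcases hg with ⟨h, j, rfl⟩ | ⟨h, h', rfl⟩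
  · refine Or.inl ⟨h * k, j, ?_⟩
    rw [mul_assoc, ((lastT_commute hm n k).pow_left j).eq, map_mul, mul_assoc]
  · exact Or.inr ⟨h, h' * k, by rw [map_mul, mul_assoc]⟩

theorem IsSplit.incl_mul {g : G m (n + 1)} (hg : IsSplit g) (k : G m n) :
    IsSplit (incl m n k * g) := by
  rcases hg with ⟨h, j, rfl⟩ | ⟨h, h', rfl⟩
  · exact Or.inl ⟨k * h, j, by rw [map_mul, mul_assoc]⟩
  · exact Or.inr ⟨k * h, h', by rw [map_mul]; simp only [mul_assoc]⟩

/-- The split elements contain `1` and are stable under right multiplication by the smaller group.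
Stability under the last `s` is the only thing left, and it reduces to products `s h s`. -/
theorem IsSplit.of_step (hm : 1 ≤ m)
    (step : ∀ h : G m n, IsSplit (lastS m n * incl m n h * lastS m n)) (g : G m (n + 1)) :
    IsSplit g := by
  have hsub : g ∈ (⊤ : Subgroup (G m (n + 1))) := trivial
  have htop : Subgroup.closure (Set.range (incl m n) ∪ {lastS m n}) = ⊤ := by
    refine eq_top_iff.2 fun g _ => generators_mem' _ (fun h => ?_) ?_ g
    · exact Subgroup.subset_closure (Or.inl ⟨h, rfl⟩)
    · exact Subgroup.subset_closure (Or.inr rfl)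
  have hs : ∀ g : G m (n + 1), IsSplit g → IsSplit (g * lastS m n) := by
    rintro _ (⟨h, j, rfl⟩ | ⟨h, h', rfl⟩)
    · refine Or.inr ⟨h, lastT m n ^ j, ?_⟩
      rw [lastT_succ_pow]
      simp only [mul_assoc, lastS_sq, mul_one]
    · have := (step h').incl_mul h
      simpa only [mul_assoc] using this
  rw [← htop] at hsub
  induction hsub using Subgroup.closure_induction_right with
  | one => exact Or.inl ⟨1, 0, by simp⟩
  | mul_right x y _ hy ih =>
    rcases hy with ⟨k, rfl⟩ | rfl
    · exact ih.mul_incl hm k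
    · exact hs _ ih
  | mul_inv_cancel x y _ hy ih =>
    rcases hy with ⟨k, rfl⟩ | rfl
    · rw [← map_inv]; exact ih.mul_incl hm k⁻¹
    · rw [lastS_inv]; exact hs _ ih

/-- By induction the middle element of `s h s` is itself split. In the first case the conjugation
raises `lastT` by one level. In the second, `s` commutes past the outer factors and the braid
relation leaves a single `s`. -/
theorem isSplit (hm : 1 ≤ m) : ∀ (n : ℕ) (g : G m (n + 1)), IsSplit g
  | 0, g => by
    refine IsSplit.of_step hm (fun h => ?_) g
    obtain ⟨j, rfl⟩ := eq_gt_pow hm h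
    refine Or.inl ⟨1, j, ?_⟩
    rw [lastT_succ_pow, map_one, one_mul]
    rfl
  | n + 1, g => by
    refine IsSplit.of_step hm (fun h => ?_) g
    rcases isSplit hm n h with ⟨k, j, rfl⟩ | ⟨k, k', rfl⟩
    · refine Or.inl ⟨incl m n k, j, ?_⟩
      rw [lastT_succ_pow (n := n + 1), map_mul, ← mul_assoc, (lastS_commute k).eq]
      simp only [mul_assoc]
    · have h1 := (lastS_commute (m := m) k).eq
      have h2 := (lastS_commute (m := m) k').eq
      refine Or.inr ⟨incl m n k * lastS m n, lastS m n * incl m n k', ?_⟩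
      simp only [map_mul]
      calc _ = lastS m (n + 1) * incl m (n + 1) (incl m n k) * incl m (n + 1) (lastS m n) *
            (incl m (n + 1) (incl m n k') * lastS m (n + 1)) := by simp only [mul_assoc]
        _ = incl m (n + 1) (incl m n k) * (lastS m (n + 1) * incl m (n + 1) (lastS m n) *
            lastS m (n + 1)) * incl m (n + 1) (incl m n k') := by
          rw [h1, ← h2]; simp only [mul_assoc]
        _ = _ := by rw [lastS_braid]; simp only [mul_assoc]

end Group

end CyclotomicFusion

namespace CyclotomicFusion

open Finset

/-! ### Finiteness, restriction and extension of standard tableaux -/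

section Tableaux

variable {m n : ℕ} {μ μ' : Fin m → YoungDiagram}

theorem shape_ext (h : ∀ q : Node m, q.2 ∈ μ q.1 ↔ q.2 ∈ μ' q.1) : μ = μ' := by
  funext k
  ext q
  exact h (k, q)

theorem IsStandard.shape_unique {w : Fin (n + 1) → Node m} (h : IsStandard μ w)
    (h' : IsStandard μ' w) : μ = μ' :=
  shape_ext fun q => (h.mem_range q).symm.trans (h'.mem_range q)

theorem StdTableau.ext' {S T : StdTableau n μ} (h : S.node = T.node) : S = T := by
  cases S; cases T; cases h; rfl

theorem IsStandard.mem {w : Fin (n + 1) → Node m} (h : IsStandard μ w) (a : Fin (n + 1)) :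
    (w a).2 ∈ μ (w a).1 := (h.mem_range _).1 ⟨a, rfl⟩

/-- A node in row `x` has `x + 1` nodes weakly above it in its column, all carrying different
numbers; likewise for its column index. So all fillings live in a bounded box. -/
theorem IsStandard.lt_of_mem {w : Fin (n + 1) → Node m} (h : IsStandard μ w) {k : Fin m} {x y : ℕ}
    (hq : (x, y) ∈ μ k) : x < n + 1 ∧ y < n + 1 := by
  constructor
  · have : ∀ i : Fin (x + 1), ∃ a, w a = (k, (i.1, y)) := fun i =>
      (h.mem_range _).2 ((μ k).up_left_mem (Nat.lt_succ_iff.1 i.2) le_rfl hq)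
    choose f hf using this
    have hinj : Function.Injective f := fun i j hij => by
      have := (hf i).symm.trans ((congrArg w hij).trans (hf j))
      simpa [Fin.ext_iff] using this
    simpa using Fintype.card_le_of_injective f hinj
  · have : ∀ i : Fin (y + 1), ∃ a, w a = (k, (x, i.1)) := fun i =>
      (h.mem_range _).2 ((μ k).up_left_mem le_rfl (Nat.lt_succ_iff.1 i.2) hq)
    choose f hf using this
    have hinj : Function.Injective f := fun i j hij => by
      have := (hf i).symm.trans ((congrArg w hij).trans (hf j))
      simpa [Fin.ext_iff] using this
    simpa using Fintype.card_le_of_injective f hinj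

theorem finite_fillings (m n : ℕ) :
    {w : Fin (n + 1) → Node m | ∃ μ, IsStandard μ w}.Finite := by
  have : {w : Fin (n + 1) → Node m |
      ∀ a, w a ∈ (Set.univ ×ˢ (Set.Iio (n + 1) ×ˢ Set.Iio (n + 1)) : Set (Node m))}.Finite :=
    Set.Finite.pi' fun _ => Set.finite_univ.prod ((Set.finite_Iio _).prod (Set.finite_Iio _))
  refine this.subset ?_
  rintro w ⟨μ, h⟩ a
  have := h.lt_of_mem (x := (w a).2.1) (y := (w a).2.2) (h.mem a)
  simpa using this

instance (n : ℕ) (μ : Fin m → YoungDiagram) : Finite (StdTableau n μ) := by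
  have := (finite_fillings m n).to_subtype
  refine Finite.of_injective
    (fun T : StdTableau n μ => (⟨T.node, μ, T.std⟩ : {w | ∃ μ, IsStandard μ w})) fun S T h => ?_
  exact StdTableau.ext' (congrArg Subtype.val h)

noncomputable instance (n : ℕ) (μ : Fin m → YoungDiagram) : Fintype (StdTableau n μ) :=
  Fintype.ofFinite _

noncomputable instance (n : ℕ) (μ : Fin m → YoungDiagram) : DecidableEq (StdTableau n μ) :=
  Classical.decEq _

/-- The `m`-partitions with `n + 1` nodes, as shapes of standard `m`-tableaux. -/
abbrev Shape (m n : ℕ) : Type := {μ : Fin m → YoungDiagram // Nonempty (StdTableau n μ)}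

instance (m n : ℕ) : Finite (Shape m n) := by
  have := (finite_fillings m n).to_subtype
  refine Finite.of_surjective
    (fun w : {w : Fin (n + 1) → Node m | ∃ μ, IsStandard μ w} =>
      (⟨w.2.choose, ⟨⟨w.1, w.2.choose_spec⟩⟩⟩ : Shape m n)) ?_
  rintro ⟨μ, ⟨T⟩⟩
  refine ⟨⟨T.node, μ, T.std⟩, Subtype.ext ?_⟩
  exact IsStandard.shape_unique (Exists.choose_spec (p := fun μ => IsStandard μ T.node) _) T.std

noncomputable instance (m n : ℕ) : Fintype (Shape m n) := Fintype.ofFinite _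

/-! ### Shapes of the initial parts of a tableau -/

open Classical in
/-- The shape of the part of a standard filling with numbers at most `k`. -/
noncomputable def partialShape {w : Fin (n + 1) → Node m} (h : IsStandard μ w) (k : ℕ) (j : Fin m) :
    YoungDiagram where
  cells := (μ j).cells.filter fun q => ∃ i : Fin (n + 1), i.1 < k ∧ w i = (j, q)
  isLowerSet := by
    rintro ⟨a, b⟩ ⟨a', b'⟩ ⟨h1, h2⟩ hq
    simp only [mem_coe, mem_filter, YoungDiagram.mem_cells] at hq ⊢
    simp only at h1 h2
    obtain ⟨hm, i, hi, hw⟩ := hq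
    have hm' := (μ j).up_left_mem h1 h2 hm
    obtain ⟨d, hd⟩ := (h.mem_range (j, (a', b'))).2 hm'
    refine ⟨hm', d, ?_, hd⟩
    have := h.mono (a := d) (b := i) (by simp [hd, hw]) (by simpa [hd, hw]) (by simpa [hd, hw])
    exact lt_of_le_of_lt (Fin.le_def.1 this) hi

theorem mem_partialShape {w : Fin (n + 1) → Node m} {h : IsStandard μ w} {k : ℕ} {q : Node m} :
    q.2 ∈ partialShape h k q.1 ↔ ∃ i : Fin (n + 1), i.1 < k ∧ w i = q := by
  rw [← YoungDiagram.mem_cells, partialShape, mem_filter, YoungDiagram.mem_cells]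
  refine ⟨fun hq => hq.2, fun hq => ⟨?_, hq⟩⟩
  obtain ⟨i, _, rfl⟩ := hq
  exact h.mem i

/-- The addable nodes of an `m`-partition. -/
abbrev AddNode (μ : Fin m → YoungDiagram) : Type := Σ k : Fin m, AddRow (μ k)

/-- An addable node as a node. -/
def AddNode.node (a : AddNode μ) : Node m := (a.1, (a.2.1, (μ a.1).rowLen a.2.1))

/-- The `m`-partition with an additional node. -/
def addNode (μ : Fin m → YoungDiagram) (a : AddNode μ) : Fin m → YoungDiagram :=
  Function.update μ a.1 (addCell (μ a.1) a.2)

theorem mem_addNode {a : AddNode μ} {q : Node m} :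
    q.2 ∈ addNode μ a q.1 ↔ q = AddNode.node a ∨ q.2 ∈ μ q.1 := by
  obtain ⟨k, q⟩ := q
  obtain ⟨j, x⟩ := a
  by_cases h : k = j
  · subst h
    simp [addNode, mem_addCell, AddNode.node]
  · simp [addNode, AddNode.node, h]

theorem AddNode.node_notMem (a : AddNode μ) : (AddNode.node a).2 ∉ μ (AddNode.node a).1 := by
  simp [AddNode.node, YoungDiagram.mem_iff_lt_rowLen]

theorem AddNode.node_injective : Function.Injective (AddNode.node (μ := μ)) := by
  rintro ⟨k, x⟩ ⟨k', x'⟩ h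
  simp only [AddNode.node, Prod.mk.injEq] at h
  obtain ⟨rfl, h, _⟩ := h
  rw [Subtype.ext h]

theorem content_addNode (a : AddNode μ) : content (AddNode.node a) = rowContent (μ a.1) a.2.1 := rfl

/-- Everything to the left of and above the node `w k` carries a smaller number, and everything to
its right a larger one. Hence its row in the partial shape ends just before it, and the rows above
are longer. -/
theorem exists_addNode {w : Fin (n + 1) → Node m} (h : IsStandard μ w) (k : Fin (n + 1)) :
    ∃ a : AddNode (partialShape h k), AddNode.node a = w k ∧
      addNode (partialShape h k) a = partialShape h (k + 1) := by
  have hlen : (partialShape h k (w k).1).rowLen (w k).2.1 = (w k).2.2 := by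
    refine eq_of_forall_lt_iff fun y => ?_
    rw [← YoungDiagram.mem_iff_lt_rowLen,
      mem_partialShape (q := ((w k).1, ((w k).2.1, y)))]
    constructor
    · rintro ⟨i, hi, hw⟩
      by_contra hy
      have := h.mono (a := k) (b := i) (by simp [hw]) (by simp [hw]) (by simpa [hw] using hy)
      rw [Fin.le_def] at this
      omega
    · intro hy
      obtain ⟨d, hd⟩ := (h.mem_range ((w k).1, ((w k).2.1, y))).2
        ((μ (w k).1).up_left_mem le_rfl hy.le (h.mem k))
      exact ⟨d, h.row d k (by simp [hd]) (by simp [hd]) (by simpa [hd]), hd⟩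
  have hadd : IsAddable (partialShape h k (w k).1) (w k).2.1 := by
    intro i hi
    rw [hlen, ← YoungDiagram.mem_iff_lt_rowLen, mem_partialShape (q := ((w k).1, (i, (w k).2.2)))]
    obtain ⟨d, hd⟩ := (h.mem_range ((w k).1, (i, (w k).2.2))).2
      ((μ (w k).1).up_left_mem hi.le le_rfl (h.mem k))
    exact ⟨d, h.col d k (by simp [hd]) (by simp [hd]) (by simpa [hd]), hd⟩
  have hnode : AddNode.node (μ := partialShape h k) ⟨(w k).1, (w k).2.1, hadd⟩ = w k := by
    simp [AddNode.node, hlen]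
  refine ⟨⟨(w k).1, (w k).2.1, hadd⟩, hnode, shape_ext fun q => ?_⟩
  rw [mem_addNode, hnode, mem_partialShape, mem_partialShape]
  constructor
  · rintro (rfl | ⟨i, hi, hw⟩)
    · exact ⟨k, Nat.lt_succ_self _, rfl⟩
    · exact ⟨i, hi.trans (Nat.lt_succ_self _), hw⟩
  · rintro ⟨i, hi, hw⟩
    rcases (Nat.lt_succ_iff.1 hi).lt_or_eq with hi | hi
    · exact Or.inr ⟨i, hi, hw⟩
    · rw [← hw, Fin.ext hi]; exact Or.inl rfl

theorem partialShape_full {w : Fin (n + 1) → Node m} (h : IsStandard μ w) :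
    partialShape h (n + 1) = μ :=
  shape_ext fun q => by
    rw [mem_partialShape, ← h.mem_range]
    exact ⟨fun ⟨i, _, hi⟩ => ⟨i, hi⟩, fun ⟨i, hi⟩ => ⟨i, i.2, hi⟩⟩

theorem partialShape_zero {w : Fin (n + 1) → Node m} (h : IsStandard μ w) :
    partialShape h 0 = fun _ => ⊥ :=
  shape_ext fun q => by
    rw [mem_partialShape]
    simp

/-! ### Extension of standard fillings by one node -/

/-- The filling with one more node. -/
def extend (w : Fin (n + 1) → Node m) (q : Node m) : Fin (n + 2) → Node m :=
  Fin.snoc (α := fun _ => Node m) w q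

@[simp] theorem extend_castSucc (w : Fin (n + 1) → Node m) (q : Node m) (i : Fin (n + 1)) :
    extend w q i.castSucc = w i := Fin.snoc_castSucc (α := fun _ => Node m) _ _ _

@[simp] theorem extend_last (w : Fin (n + 1) → Node m) (q : Node m) :
    extend w q (Fin.last (n + 1)) = q := Fin.snoc_last (α := fun _ => Node m) _ _

theorem extend_init (w : Fin (n + 2) → Node m) :
    extend (fun i : Fin (n + 1) => w i.castSucc) (w (Fin.last (n + 1))) = w := by
  funext i
  refine Fin.lastCases ?_ (fun i => ?_) i <;> simp

theorem IsStandard.init {w : Fin (n + 2) → Node m} (h : IsStandard μ w) :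
    IsStandard (partialShape h (n + 1)) fun i : Fin (n + 1) => w i.castSucc where
  inj := h.inj.comp (Fin.castSucc_injective _)
  mem_range q := by
    rw [mem_partialShape]
    constructor
    · rintro ⟨i, hi⟩; exact ⟨i.castSucc, i.2, hi⟩
    · rintro ⟨i, hi, hw⟩; exact ⟨⟨i, hi⟩, hw⟩
  row a b h1 h2 h3 := h.row _ _ h1 h2 h3
  col a b h1 h2 h3 := h.col _ _ h1 h2 h3

/-- The equivalence, rather than one implication, makes the embedding of representations respect the
convention that non-standard fillings give zero vectors. -/
theorem isStandard_extend (a : AddNode μ) {w : Fin (n + 1) → Node m} :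
    IsStandard (addNode μ a) (extend w (AddNode.node a)) ↔ IsStandard μ w := by
  constructor
  · intro h
    have := h.init
    simp only [extend_castSucc] at this
    convert this using 1
    refine shape_ext fun q => ?_
    have h1 := h.mem_range q
    rw [mem_addNode] at h1
    rw [mem_partialShape]
    constructor
    · intro hq
      obtain ⟨i, hi⟩ := h1.2 (Or.inr hq)
      refine ⟨i, ?_, hi⟩
      by_contra hlt
      have : i = Fin.last (n + 1) := by ext; simp only [Fin.val_last]; omega
      rw [this, extend_last] at hi
      rw [← hi] at hq
      exact a.node_notMem hq
    · rintro ⟨i, hi, hw⟩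
      refine (h1.1 ⟨i, hw⟩).resolve_left ?_
      rintro rfl
      have := h.inj (hw.trans (extend_last w (AddNode.node a)).symm)
      rw [this] at hi
      simp at hi
  · intro h
    have hne : ∀ i, w i ≠ AddNode.node a := fun i hi => a.node_notMem (hi ▸ h.mem i)
    have hnot : ∀ (i : Fin (n + 1)), (AddNode.node a).1 = (w i).1 →
        (AddNode.node a).2 ≤ (w i).2 → False := fun i h1 h2 =>
      a.node_notMem (by rw [h1]; exact (μ (w i).1).isLowerSet h2 (h.mem i))
    refine ⟨?_, fun q => ?_, fun i => ?_, fun i => ?_⟩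
    · intro i j
      refine Fin.lastCases ?_ (fun i => ?_) i <;> refine Fin.lastCases ?_ (fun j => ?_) j
      · simp
      · simp only [extend_last, extend_castSucc]; intro hh; exact absurd hh.symm (hne j)
      · simp only [extend_last, extend_castSucc]; intro hh; exact absurd hh (hne i)
      · simp only [extend_castSucc]; intro hh; rw [h.inj hh]
    · rw [mem_addNode, ← h.mem_range]
      constructor
      · rintro ⟨i, rfl⟩
        refine Fin.lastCases ?_ (fun i => ?_) i
        · simp
        · exact Or.inr ⟨i, by simp⟩
      · rintro (rfl | ⟨i, rfl⟩)
        · exact ⟨Fin.last _, by simp⟩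
        · exact ⟨i.castSucc, by simp⟩
    · refine Fin.lastCases (fun j => ?_) (fun i j => ?_) i <;>
        refine Fin.lastCases ?_ (fun j => ?_) j <;> simp only [extend_last, extend_castSucc]
      · intro _ _ h3; exact absurd h3 (lt_irrefl _)
      · intro h1 h2 h3; exact (hnot j h1 ⟨h2.le, h3.le⟩).elim
      · intro _ _ _; exact Fin.castSucc_lt_last i
      · intro h1 h2 h3; exact h.row _ _ h1 h2 h3
    · refine Fin.lastCases (fun j => ?_) (fun i j => ?_) i <;>
        refine Fin.lastCases ?_ (fun j => ?_) j <;> simp only [extend_last, extend_castSucc]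
      · intro _ _ h3; exact absurd h3 (lt_irrefl _)
      · intro h1 h2 h3; exact (hnot j h1 ⟨h3.le, h2.le⟩).elim
      · intro _ _ _; exact Fin.castSucc_lt_last i
      · intro h1 h2 h3; exact h.col _ _ h1 h2 h3

/-- The tableau with one more node. -/
def StdTableau.extend (T : StdTableau n μ) (a : AddNode μ) : StdTableau (n + 1) (addNode μ a) :=
  ⟨CyclotomicFusion.extend T.node (AddNode.node a), (isStandard_extend a).2 T.std⟩

/-- Every standard tableau with at least two nodes is an extension. -/
theorem IsStandard.exists_extend {w : Fin (n + 2) → Node m} (h : IsStandard μ w) :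
    ∃ (ν : Fin m → YoungDiagram) (a : AddNode ν) (U : StdTableau n ν), addNode ν a = μ ∧
      CyclotomicFusion.extend U.node (AddNode.node a) = w := by
  obtain ⟨a, ha, hν⟩ := exists_addNode h (Fin.last (n + 1))
  refine ⟨_, a, ⟨_, h.init⟩, hν.trans (partialShape_full h), ?_⟩
  rw [ha]
  exact extend_init w

/-- A sum over all standard tableaux of size `n + 2` is a sum over all extensions of standard
tableaux of size `n + 1`. -/
theorem sum_extend {M : Type*} [AddCommMonoid M]
    (F : ∀ μ : Fin m → YoungDiagram, StdTableau (n + 1) μ → M) :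
    ∑ μ : Shape m (n + 1), ∑ T : StdTableau (n + 1) μ.1, F μ.1 T =
      ∑ μ : Shape m n, ∑ U : StdTableau n μ.1, ∑ a : AddNode μ.1, F _ (U.extend a) := by
  have e1 : ∀ μ : Shape m n, ∑ U : StdTableau n μ.1, ∑ a : AddNode μ.1, F _ (U.extend a) =
      ∑ p : StdTableau n μ.1 × AddNode μ.1, F _ (p.1.extend p.2) := fun μ =>
    
    (Fintype.sum_prod_type (fun p : StdTableau n μ.1 × AddNode μ.1 =>
      F _ (p.1.extend p.2))).symm
  rw [Fintype.sum_congr _ _ e1, ← Fintype.sum_sigma', ← Fintype.sum_sigma']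
  symm
  let φ : (Σ μ : Shape m n, StdTableau n μ.1 × AddNode μ.1) →
      Σ μ : Shape m (n + 1), StdTableau (n + 1) μ.1 :=
    fun x => ⟨⟨addNode x.1.1 x.2.2, ⟨x.2.1.extend x.2.2⟩⟩, x.2.1.extend x.2.2⟩
  refine Fintype.sum_bijective φ ⟨?_, ?_⟩ _ _ fun _ => rfl
  · rintro ⟨⟨μ, hμ⟩, U, a⟩ ⟨⟨μ', hμ'⟩, U', a'⟩ h
    have hnode : CyclotomicFusion.extend U.node (AddNode.node a) =
        CyclotomicFusion.extend U'.node (AddNode.node a') :=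
      congrArg (fun y : Σ μ : Shape m (n + 1), StdTableau (n + 1) μ.1 => y.2.node) h
    have h1 : U.node = U'.node := by
      funext i; simpa using congrFun hnode i.castSucc
    have h2 : AddNode.node a = AddNode.node a' := by
      simpa using congrFun hnode (Fin.last (n + 1))
    obtain rfl := U.std.shape_unique (h1 ▸ U'.std)
    rw [StdTableau.ext' h1, AddNode.node_injective h2]
  · rintro ⟨⟨μ, hμ⟩, T⟩
    obtain ⟨ν, a, U, rfl, hw⟩ := T.std.exists_extend
    refine ⟨⟨⟨ν, ⟨U⟩⟩, U, a⟩, ?_⟩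
    have : U.extend a = T := StdTableau.ext' hw
    subst this
    rfl

end Tableaux

end CyclotomicFusion

namespace CyclotomicFusion

open Finset

/-! ### Hook weights summed over addable nodes -/

section Weights

variable {m n : ℕ} {μ : Fin m → YoungDiagram}

theorem fCoeff_eq (μ : Fin m → YoungDiagram) : fCoeff μ = ∏ k, (hookProd (μ k))⁻¹ :=
  (prod_inv_distrib _).symm

theorem fCoeff_ne_zero (μ : Fin m → YoungDiagram) : fCoeff μ ≠ 0 := by
  rw [fCoeff_eq]
  exact prod_ne_zero_iff.2 fun k _ => inv_ne_zero (hookProd_ne_zero _)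

theorem fCoeff_addNode (a : AddNode μ) :
    fCoeff (addNode μ a) = fCoeff μ * hookProd (μ a.1) * (hookProd (addCell (μ a.1) a.2))⁻¹ := by
  rw [fCoeff_eq, fCoeff_eq, ← mul_prod_erase univ _ (mem_univ a.1),
    ← mul_prod_erase univ (fun k => (hookProd (μ k))⁻¹) (mem_univ a.1)]
  have e : ∏ k ∈ univ.erase a.1, (hookProd (addNode μ a k))⁻¹ =
      ∏ k ∈ univ.erase a.1, (hookProd (μ k))⁻¹ :=
    prod_congr rfl fun k hk => by
      rw [addNode, Function.update_of_ne (ne_of_mem_erase hk)]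
  rw [e, addNode, Function.update_self]
  have := hookProd_ne_zero (μ a.1)
  field_simp

/-- Each diagram contributes separately, and within one diagram the weights add up by
`sum_inv_hookProd`. -/
theorem sum_fCoeff_addNode (μ : Fin m → YoungDiagram) (c : Fin m → ℂ) :
    ∑ a : AddNode μ, fCoeff (addNode μ a) * c a.1 = fCoeff μ * ∑ k, c k := by
  rw [Fintype.sum_sigma, mul_sum]
  refine sum_congr rfl fun k _ => ?_
  simp only [fCoeff_addNode]
  rw [← sum_mul, ← mul_sum, sum_inv_hookProd]
  have := hookProd_ne_zero (μ k)
  field_simp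

/-- Only the diagram containing the last node of `U` contributes. That node carries the largest
number, so it is a corner, and `sum_inv_hookProd_div` applies to it. -/
theorem sum_fCoeff_axial (U : StdTableau n μ) :
    ∑ a : AddNode μ, fCoeff (addNode μ a) *
      axialCoeff (U.node (Fin.last n)) (AddNode.node a) = 0 := by
  rw [Fintype.sum_sigma]
  refine sum_eq_zero fun k _ => ?_
  by_cases hk : (U.node (Fin.last n)).1 = k
  · subst hk
    set q := U.node (Fin.last n) with hq
    have hlast : ∀ q' : ℕ × ℕ, q'.1 ≥ q.2.1 → q'.2 ≥ q.2.2 → q' ≠ q.2 → q' ∉ μ q.1 := by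
      intro q' h1 h2 hne hm
      obtain ⟨i, hi⟩ := (U.std.mem_range (q.1, q')).2 hm
      have := U.std.mono (a := Fin.last n) (b := i) (by rw [hi]) (by rw [hi]; exact h1)
        (by rw [hi]; exact h2)
      rw [Fin.last_le_iff.1 this] at hi
      rw [← hq] at hi
      rw [hi] at hne
      exact hne rfl
    have hm : (q.2.1, q.2.2) ∈ μ q.1 := U.std.mem _
    have := sum_inv_hookProd_div hm
      (hlast _ le_rfl (Nat.le_succ _) (fun h => by
        have := congrArg Prod.snd h; simp at this))
      (hlast _ (Nat.le_succ _) le_rfl (fun h => by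
        have := congrArg Prod.fst h; simp at this))
    calc _ = ∑ x : AddRow (μ q.1), (fCoeff μ * hookProd (μ q.1)) *
          ((hookProd (addCell (μ q.1) x))⁻¹ *
            ((rowContent (μ q.1) x.1 - ((q.2.2 : ℤ) - q.2.1) : ℤ) : ℂ)⁻¹) := by
          refine sum_congr rfl fun x _ => ?_
          rw [fCoeff_addNode, axialCoeff, if_pos (by rfl), content_addNode]
          simp only [content, mul_assoc]
      _ = 0 := by rw [← mul_sum, this, mul_zero]
  · refine sum_eq_zero fun x _ => ?_
    rw [axialCoeff, if_neg (by exact hk), mul_zero]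

end Weights

/-! ### Power sums of the roots of unity -/

section Roots

variable {m : ℕ} (ξ : Fin m ≃ rootsOfUnity m ℂ)

/-- The `k`-th root of unity as a complex number. -/
noncomputable abbrev rootVal (k : Fin m) : ℂ := ((ξ k : ℂˣ) : ℂ)

theorem rootVal_pow (k : Fin m) : rootVal ξ k ^ m = 1 := (mem_rootsOfUnity' m _).1 (ξ k).2

theorem rootVal_injective : Function.Injective (rootVal ξ) := fun _ _ h =>
  ξ.injective (Subtype.ext (Units.ext h))

/-- Multiplication by a primitive root `z` permutes the roots, so the power sum is fixed by
multiplication with `z ^ j`, which differs from `1` unless `m` divides `j`. -/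
theorem sum_rootVal_pow (hm : 1 ≤ m) (j : ℕ) :
    ∑ k, rootVal ξ k ^ j = if m ∣ j then (m : ℂ) else 0 := by
  have : NeZero m := ⟨by omega⟩
  let _ : Fintype (rootsOfUnity m ℂ) := Fintype.ofEquiv _ ξ
  split_ifs with h
  · obtain ⟨l, rfl⟩ := h
    simp [pow_mul, rootVal_pow]
  · have hp := Complex.isPrimitiveRoot_exp m (by omega)
    have h1 : ((Complex.exp (2 * Real.pi * Complex.I / m)) ^ j) ≠ 1 := fun h' =>
      h (hp.dvd_of_pow_eq_one j h')
    obtain ⟨z, hz⟩ : ∃ z : rootsOfUnity m ℂ, ((z : ℂˣ) : ℂ) =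
        Complex.exp (2 * Real.pi * Complex.I / m) :=
      ⟨hp.toRootsOfUnity, by simp⟩
    rw [← hz] at h1
    have e1 : ∑ k, rootVal ξ k ^ j = ∑ y : rootsOfUnity m ℂ, ((y : ℂˣ) : ℂ) ^ j :=
      Equiv.sum_comp ξ fun y : rootsOfUnity m ℂ => ((y : ℂˣ) : ℂ) ^ j
    have e2 : ∑ y : rootsOfUnity m ℂ, ((y : ℂˣ) : ℂ) ^ j =
        ((z : ℂˣ) : ℂ) ^ j * ∑ y : rootsOfUnity m ℂ, ((y : ℂˣ) : ℂ) ^ j := by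
      rw [mul_sum, ← Equiv.sum_comp (Equiv.mulLeft z)]
      refine sum_congr rfl fun y _ => ?_
      simp [mul_pow]
    rw [e1]
    have e3 : (((z : ℂˣ) : ℂ) ^ j - 1) * ∑ y : rootsOfUnity m ℂ, ((y : ℂˣ) : ℂ) ^ j = 0 := by
      rw [sub_mul, ← e2, one_mul, sub_self]
    exact (mul_eq_zero.1 e3).resolve_left (sub_ne_zero.2 h1)

end Roots

/-! ### Semi-normal representations restricted to the smaller group -/

section Extension

variable {m n : ℕ} {μ : Fin m → YoungDiagram} (ξ : Fin m ≃ rootsOfUnity m ℂ)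

theorem extend_injective (a : AddNode μ) :
    Function.Injective fun U : StdTableau n μ => U.extend a := fun S T h =>
  StdTableau.ext' (funext fun i => by
    have := congrArg (fun X : StdTableau (n + 1) (addNode μ a) => X.node i.castSucc) h
    simpa [StdTableau.extend] using this)

/-- The embedding `V_μ → V_λ` for an `m`-partition `λ` with one more node. -/
noncomputable def extMap (a : AddNode μ) : V n μ →ₗ[ℂ] V (n + 1) (addNode μ a) :=
  Finsupp.lmapDomain ℂ ℂ fun U => U.extend a

theorem extMap_single (a : AddNode μ) (U : StdTableau n μ) (c : ℂ) :
    extMap a (Finsupp.single U c) = Finsupp.single (U.extend a) c := by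
  simp [extMap]

theorem extMap_vec (a : AddNode μ) (w : Fin (n + 1) → Node m) :
    extMap a (vec μ w) = vec (addNode μ a) (extend w (AddNode.node a)) := by
  by_cases h : IsStandard μ w
  · have h' := (isStandard_extend a).2 h
    rw [show vec μ w = Finsupp.single (⟨w, h⟩ : StdTableau n μ) 1 by simp [vec, h], extMap_single,
      show vec (addNode μ a) (extend w (AddNode.node a)) =
        Finsupp.single (⟨_, h'⟩ : StdTableau (n + 1) (addNode μ a)) 1 by simp [vec, h']]
    rfl
  · rw [vec_of_not h, vec_of_not (mt (isStandard_extend a).1 h), map_zero]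

theorem extMap_apply_extend (a : AddNode μ) (x : V n μ) (U : StdTableau n μ) :
    extMap a x (U.extend a) = x U :=
  Finsupp.mapDomain_apply (extend_injective a) x U

theorem extMap_apply_of_ne (a : AddNode μ) (x : V n μ) (S : StdTableau (n + 1) (addNode μ a))
    (h : S.node (Fin.last (n + 1)) ≠ AddNode.node a) : extMap a x S = 0 := by
  refine Finsupp.mapDomain_of_notMem_range x S ?_
  rintro ⟨U, rfl⟩
  exact h (extend_last _ _)

theorem swapFilling_extend (w : Fin (n + 1) → Node m) (q : Node m) (i : Fin n) :
    swapFilling (extend w q) i.castSucc = extend (swapFilling w i) q := by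
  funext j
  refine Fin.lastCases ?_ (fun j => ?_) j
  · rw [swapFilling_of_ne, extend_last, extend_last] <;>
      simp only [ne_eq, Fin.ext_iff, Fin.val_last, Fin.val_castSucc, Fin.val_succ] <;> omega
  · rw [extend_castSucc]
    by_cases h1 : j = i.castSucc
    · subst h1
      rw [swapFilling_castSucc, swapFilling_castSucc, Fin.succ_castSucc, extend_castSucc]
    · by_cases h2 : j = i.succ
      · subst h2
        rw [← Fin.succ_castSucc, swapFilling_succ, swapFilling_succ, extend_castSucc]
      · rw [swapFilling_of_ne w i h1 h2, swapFilling_of_ne, extend_castSucc]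
        · simpa [Fin.ext_iff] using h1
        · simpa [Fin.ext_iff] using h2

/-- The interchange does not touch the last number, so neither the axial coefficient nor
standardness notices the extra node. -/
theorem sOp_extMap (a : AddNode μ) (i : Fin n) :
    sOp (addNode μ a) i.castSucc ∘ₗ extMap a = extMap a ∘ₗ sOp μ i := by
  refine Finsupp.lhom_ext' fun T => LinearMap.ext_ring ?_
  have e1 : axial (extend T.node (AddNode.node a)) i.castSucc = axial T.node i := by
    simp only [axial, Fin.succ_castSucc, extend_castSucc]
  have e2 : offDiag (addNode μ a) (extend T.node (AddNode.node a)) i.castSucc =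
      offDiag μ T.node i := by
    classical
    refine if_congr ?_ (by rw [e1]) rfl
    rw [swapFilling_extend, isStandard_extend, isStandard_extend]
  simp only [LinearMap.comp_apply, Finsupp.lsingle_apply]
  rw [← vec_coe, extMap_vec, sOp_vec, sOp_vec, map_add, map_smul, map_smul, extMap_vec, extMap_vec,
    e1, swapFilling_extend, e2]

theorem tOp_extMap (a : AddNode μ) :
    tOp (n + 1) ξ (addNode μ a) ∘ₗ extMap a = extMap a ∘ₗ tOp n ξ μ := by
  refine Finsupp.lhom_ext' fun T => LinearMap.ext_ring ?_
  simp only [LinearMap.comp_apply, Finsupp.lsingle_apply]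
  have e0 : extend T.node (AddNode.node a) 0 = T.node 0 := by
    rw [← Fin.castSucc_zero, extend_castSucc]
  rw [← vec_coe, extMap_vec, tOp_vec, tOp_vec, map_smul, extMap_vec, e0]

theorem seminormalRep_extMap (a : AddNode μ) (h : G m n) :
    seminormalRep (n + 1) ξ (addNode μ a) (incl m n h) ∘ₗ extMap a =
      extMap a ∘ₗ seminormalRep n ξ μ h := by
  let H : Subgroup (G m n) :=
    { carrier := {h | seminormalRep (n + 1) ξ (addNode μ a) (incl m n h) ∘ₗ extMap a =
        extMap a ∘ₗ seminormalRep n ξ μ h}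
      one_mem' := by simp [Module.End.one_eq_id]
      mul_mem' := by
        intro x y hx hy
        simp only [Set.mem_ofPred_eq, map_mul, Module.End.mul_eq_comp] at hx hy ⊢
        rw [LinearMap.comp_assoc, hy, ← LinearMap.comp_assoc, hx, LinearMap.comp_assoc]
      inv_mem' := by
        intro x hx
        simp only [Set.mem_ofPred_eq] at hx ⊢
        have h1 : seminormalRep (n + 1) ξ (addNode μ a) (incl m n x⁻¹) ∘ₗ
            seminormalRep (n + 1) ξ (addNode μ a) (incl m n x) = LinearMap.id := by
          rw [← Module.End.mul_eq_comp, ← map_mul, ← map_mul, inv_mul_cancel, map_one, map_one]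
          rfl
        have h2 : seminormalRep n ξ μ x ∘ₗ seminormalRep n ξ μ x⁻¹ = LinearMap.id := by
          rw [← Module.End.mul_eq_comp, ← map_mul, mul_inv_cancel, map_one]
          rfl
        have h3 := congrArg (fun f => (seminormalRep (n + 1) ξ (addNode μ a) (incl m n x⁻¹) ∘ₗ f) ∘ₗ
          seminormalRep n ξ μ x⁻¹) hx
        beta_reduce at h3
        rw [← LinearMap.comp_assoc, h1, LinearMap.id_comp, LinearMap.comp_assoc,
          LinearMap.comp_assoc, h2, LinearMap.comp_id] at h3
        exact h3.symm }
  refine generators_mem H ?_ (fun i => ?_) h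
  · change _ ∘ₗ _ = _ ∘ₗ _
    rw [incl_gt, seminormalRep_t, seminormalRep_t, tOp_extMap]
  · change _ ∘ₗ _ = _ ∘ₗ _
    rw [incl_gs, seminormalRep_s, seminormalRep_s, sOp_extMap]

theorem seminormalRep_extMap_apply (a : AddNode μ) (h : G m n) (x : V n μ) :
    seminormalRep (n + 1) ξ (addNode μ a) (incl m n h) (extMap a x) =
      extMap a (seminormalRep n ξ μ h x) :=
  LinearMap.congr_fun (seminormalRep_extMap ξ a h) x

/-- By induction, the conjugate of `t` from one level below acts by the position of the last node
but one. Conjugation by `s` exchanges the last two positions: the diagonal coefficient of `s` is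
nonzero only if these coincide. -/
theorem lastT_vec : ∀ (n : ℕ) (μ : Fin m → YoungDiagram) (w : Fin (n + 1) → Node m),
    seminormalRep n ξ μ (lastT m n) (vec μ w) = rootVal ξ (w (Fin.last n)).1 • vec μ w
  | 0, μ, w => by rw [lastT, seminormalRep_t, tOp_vec]; rfl
  | n + 1, μ, w => by
    by_cases hw : IsStandard μ w
    swap
    · rw [vec_of_not hw, map_zero, smul_zero]
    have key : ∀ w : Fin (n + 2) → Node m, seminormalRep (n + 1) ξ μ (incl m n (lastT m n))
        (vec μ w) = rootVal ξ (w (Fin.last n).castSucc).1 • vec μ w := by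
      intro w
      by_cases hw : IsStandard μ w
      · obtain ⟨ν, a, U, rfl, rfl⟩ := hw.exists_extend
        rw [← extMap_vec, seminormalRep_extMap_apply, lastT_vec n ν, map_smul, extend_castSucc]
      · rw [vec_of_not hw, map_zero, smul_zero]
    have hax : axial w (Fin.last n) * (rootVal ξ (w (Fin.last n).castSucc).1 -
        rootVal ξ (w (Fin.last n).succ).1) = 0 := by
      by_cases h : (w (Fin.last n).castSucc).1 = (w (Fin.last n).succ).1
      · rw [h]; ring
      · rw [axial, axialCoeff, if_neg h, zero_mul]
    have hod := offDiag_mul hw (Fin.last n)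
    rw [lastT, map_mul, map_mul, lastS, seminormalRep_s]
    simp only [Module.End.mul_apply, sOp_vec, key, map_add, map_smul, swapFilling_castSucc,
      swapFilling_swapFilling, axial_swap, ← Fin.succ_last]
    match_scalars
    · linear_combination rootVal ξ (w (Fin.last n).succ).1 * hod + axial w (Fin.last n) * hax
    · linear_combination offDiag μ w (Fin.last n) * hax

end Extension

/-! ### The Plancherel formula for the weighted sum of characters -/

section Trace

variable {m n : ℕ} (ξ : Fin m ≃ rootsOfUnity m ℂ)

/-- The weighted sum of the characters of the semi-normal representations. -/
noncomputable def plancherel (n : ℕ) (g : G m n) : ℂ :=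
  ∑ μ : Shape m n, ∑ T : StdTableau n μ.1,
    fCoeff μ.1 * seminormalRep n ξ μ.1 g (Finsupp.single T 1) T

theorem trace_eq_sum {μ : Fin m → YoungDiagram} (f : V n μ →ₗ[ℂ] V n μ) :
    LinearMap.trace ℂ (V n μ) f = ∑ T : StdTableau n μ, f (Finsupp.single T 1) T := by
  rw [LinearMap.trace_eq_matrix_trace ℂ Finsupp.basisSingleOne, Matrix.trace]
  refine sum_congr rfl fun T _ => ?_
  simp [LinearMap.toMatrix_apply]

theorem plancherel_mul_comm (g h : G m n) : plancherel ξ n (g * h) = plancherel ξ n (h * g) := by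
  simp only [plancherel, ← mul_sum]
  refine sum_congr rfl fun μ _ => ?_
  rw [← trace_eq_sum, ← trace_eq_sum, (seminormalRep n ξ μ.1).map_mul,
    (seminormalRep n ξ μ.1).map_mul, LinearMap.trace_mul_comm]

/-- On each extension of a smaller tableau, `lastT` contributes a power of the root at the new node,
and the smaller group keeps its diagonal coefficient. The weights are then summed over addable
nodes. -/
theorem plancherel_incl_mul_lastT_pow (h : G m n) (j : ℕ) :
    plancherel ξ (n + 1) (incl m n h * lastT m (n + 1) ^ j) =
      (∑ k, rootVal ξ k ^ j) * plancherel ξ n h := by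
  rw [plancherel, sum_extend fun μ T => fCoeff μ * seminormalRep (n + 1) ξ μ
    (incl m n h * lastT m (n + 1) ^ j) (Finsupp.single T 1) T, plancherel, mul_sum]
  refine sum_congr rfl fun μ _ => ?_
  rw [mul_sum]
  refine sum_congr rfl fun U _ => ?_
  have hpow : ∀ a : AddNode μ.1, seminormalRep (n + 1) ξ (addNode μ.1 a) (lastT m (n + 1) ^ j)
      (Finsupp.single (U.extend a) 1) = rootVal ξ a.1 ^ j • Finsupp.single (U.extend a) 1 := by
    intro a
    rw [map_pow]
    induction j with
    | zero => simp
    | succ j ih =>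
      rw [pow_succ', Module.End.mul_apply, ih, map_smul, ← vec_coe, lastT_vec, smul_smul,
        pow_succ]
      simp [StdTableau.extend, AddNode.node]
  have hterm : ∀ a : AddNode μ.1, fCoeff (addNode μ.1 a) *
      seminormalRep (n + 1) ξ (addNode μ.1 a) (incl m n h * lastT m (n + 1) ^ j)
        (Finsupp.single (U.extend a) 1) (U.extend a) =
      fCoeff (addNode μ.1 a) * rootVal ξ a.1 ^ j *
        seminormalRep n ξ μ.1 h (Finsupp.single U 1) U := by
    intro a
    rw [map_mul, Module.End.mul_apply, hpow, map_smul, ← extMap_single,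
      seminormalRep_extMap_apply, Finsupp.smul_apply, extMap_apply_extend, smul_eq_mul, mul_assoc]
  rw [sum_congr rfl fun a _ => hterm a, ← sum_mul, sum_fCoeff_addNode μ.1 fun k => rootVal ξ k ^ j]
  ring

/-- The interchange of the two last numbers changes the last node, which the smaller group
preserves. So only the diagonal coefficient of `s` contributes to the trace, and its weighted sum
vanishes by `sum_fCoeff_axial`. -/
theorem plancherel_incl_mul_lastS (h : G m n) :
    plancherel ξ (n + 1) (incl m n h * lastS m n) = 0 := by
  rw [plancherel, sum_extend fun μ T => fCoeff μ * seminormalRep (n + 1) ξ μ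
    (incl m n h * lastS m n) (Finsupp.single T 1) T]
  refine sum_eq_zero fun μ _ => sum_eq_zero fun U _ => ?_
  have hterm : ∀ a : AddNode μ.1, fCoeff (addNode μ.1 a) *
      seminormalRep (n + 1) ξ (addNode μ.1 a) (incl m n h * lastS m n)
        (Finsupp.single (U.extend a) 1) (U.extend a) =
      fCoeff (addNode μ.1 a) * axialCoeff (U.node (Fin.last n)) (AddNode.node a) *
        seminormalRep n ξ μ.1 h (Finsupp.single U 1) U := by
    intro a
    have hvan : ∀ (ν : Fin m → YoungDiagram) (S : StdTableau (n + 1) ν) (w : Fin (n + 2) → Node m),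
        w (Fin.last (n + 1)) ≠ S.node (Fin.last (n + 1)) →
          seminormalRep (n + 1) ξ ν (incl m n h) (vec ν w) S = 0 := by
      intro ν S w hne
      by_cases hw : IsStandard ν w
      · obtain ⟨ν', a', U', rfl, rfl⟩ := hw.exists_extend
        rw [← extMap_vec, seminormalRep_extMap_apply, extMap_apply_of_ne]
        rw [extend_last] at hne
        exact hne.symm
      · rw [vec_of_not hw, map_zero, Finsupp.zero_apply]
    have hax : axial (U.extend a).node (Fin.last n) =
        axialCoeff (U.node (Fin.last n)) (AddNode.node a) := by
      simp [axial, StdTableau.extend]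
    rw [map_mul, Module.End.mul_apply, lastS, seminormalRep_s, ← vec_coe, sOp_vec, map_add,
      Finsupp.add_apply, map_smul, map_smul, Finsupp.smul_apply, Finsupp.smul_apply,
      hvan _ _ (swapFilling _ _), vec_coe, ← extMap_single, seminormalRep_extMap_apply, extMap_apply_extend, hax]
    · simp [mul_assoc]
    · rw [← Fin.succ_last, swapFilling_succ, Fin.succ_last]
      intro hh
      have := (U.extend a).std.inj hh
      exact absurd this (Fin.castSucc_lt_last _).ne
  rw [sum_congr rfl fun a _ => hterm a, ← sum_mul, sum_fCoeff_axial, zero_mul]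

theorem isStandard_single {μ : Fin m → YoungDiagram} (hμ : μ = fun _ => ⊥) (a : AddNode μ) :
    IsStandard (addNode μ a) fun _ : Fin (0 + 1) => AddNode.node a where
  inj := fun i j _ => Fin.ext (by omega)
  mem_range q := by
    rw [mem_addNode]
    subst hμ
    simp [eq_comm]
  row _ _ _ _ h := absurd h (lt_irrefl _)
  col _ _ _ _ h := absurd h (lt_irrefl _)

/-- The counterpart of `sum_extend` at the bottom of the tower, where a tableau is one addable node
of the empty `m`-partition. -/
theorem sum_tableaux_zero {M : Type*} [AddCommMonoid M]
    (F : ∀ μ : Fin m → YoungDiagram, StdTableau 0 μ → M) :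
    ∑ μ : Shape m 0, ∑ T : StdTableau 0 μ.1, F μ.1 T =
      ∑ a : AddNode fun _ : Fin m => (⊥ : YoungDiagram), F _ ⟨_, isStandard_single rfl a⟩ := by
  rw [← Fintype.sum_sigma']
  symm
  let φ : (AddNode fun _ : Fin m => (⊥ : YoungDiagram)) →
      Σ μ : Shape m 0, StdTableau 0 μ.1 :=
    fun a => ⟨⟨addNode _ a, ⟨⟨_, isStandard_single rfl a⟩⟩⟩, ⟨_, isStandard_single rfl a⟩⟩
  refine Fintype.sum_bijective φ ⟨?_, ?_⟩ _ _ fun _ => rfl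
  · intro a a' h
    exact AddNode.node_injective
      (congrArg (fun y : Σ μ : Shape m 0, StdTableau 0 μ.1 => y.2.node 0) h)
  · rintro ⟨⟨μ, hμ⟩, T⟩
    obtain ⟨a, ha, hν⟩ := exists_addNode T.std 0
    replace hν := hν.trans (partialShape_full T.std)
    have h0 : partialShape T.std ((0 : Fin (0 + 1)) : ℕ) = fun _ => ⊥ := partialShape_zero T.std
    generalize partialShape T.std ((0 : Fin (0 + 1)) : ℕ) = ν at a ha hν h0
    subst h0 hν
    refine ⟨a, ?_⟩
    have : (⟨_, isStandard_single rfl a⟩ : StdTableau 0 (addNode _ a)) = T :=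
      StdTableau.ext' (funext fun i => by
        rw [show i = 0 from Fin.ext (by simp)]; exact ha)
    simp only [φ, this]

theorem fCoeff_bot : fCoeff (fun _ : Fin m => (⊥ : YoungDiagram)) = 1 := by
  simp [fCoeff]

theorem plancherel_zero (j : ℕ) : plancherel ξ 0 (gt m 0 ^ j) = ∑ k, rootVal ξ k ^ j := by
  rw [plancherel, sum_tableaux_zero fun μ T => fCoeff μ * seminormalRep 0 ξ μ (gt m 0 ^ j)
    (Finsupp.single T 1) T]
  have e := sum_fCoeff_addNode (fun _ : Fin m => (⊥ : YoungDiagram)) fun k => rootVal ξ k ^ j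
  rw [fCoeff_bot, one_mul] at e
  rw [← e]
  clear e
  refine sum_congr rfl fun a _ => ?_
  congr 1
  set T : StdTableau 0 (addNode _ a) := ⟨_, isStandard_single rfl a⟩ with hT
  have : seminormalRep 0 ξ _ (gt m 0 ^ j) (Finsupp.single T 1) =
      rootVal ξ a.1 ^ j • Finsupp.single T 1 := by
    rw [map_pow]
    induction j with
    | zero => simp
    | succ j ih =>
      rw [pow_succ', Module.End.mul_apply, ih, map_smul, ← vec_coe, seminormalRep_t, tOp_vec,
        smul_smul, pow_succ]
      simp [hT, AddNode.node]
  rw [this]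
  simp

open Classical in
/-- The weighted sum of characters is a multiple of the indicator function of `1`. -/
theorem plancherel_eq (hm : 1 ≤ m) : ∀ (n : ℕ) (g : G m n),
    plancherel ξ n g = if g = 1 then (m : ℂ) ^ (n + 1) else 0
  | 0, g => by
    obtain ⟨j, rfl⟩ := eq_gt_pow hm g
    rw [plancherel_zero, sum_rootVal_pow ξ hm]
    by_cases h : m ∣ j
    · obtain ⟨l, rfl⟩ := h
      rw [pow_mul, gt_pow, one_pow, if_pos rfl, if_pos (dvd_mul_right _ _), zero_add, pow_one]
    · rw [if_neg h, if_neg]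
      intro h1
      -- If `t^j` were `1`, the weighted trace of the identity would be both `0` and `m`. In
      -- particular `t` has order exactly `m`.
      have := plancherel_zero ξ j
      rw [h1, sum_rootVal_pow ξ hm, if_neg h] at this
      have h2 := plancherel_zero ξ 0
      rw [pow_zero, this, sum_rootVal_pow ξ hm, if_pos (dvd_zero m)] at h2
      exact absurd h2 (by norm_cast; omega)
  | n + 1, g => by
    have h1 : plancherel ξ (n + 1) (1 : G m (n + 1)) = (m : ℂ) ^ (n + 2) := by
      have := plancherel_incl_mul_lastT_pow ξ (1 : G m n) 0
      rw [plancherel_eq hm n, if_pos rfl, sum_rootVal_pow ξ hm, if_pos (dvd_zero m)] at this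
      rw [map_one, pow_zero, one_mul] at this
      rw [this]; ring
    by_cases hg : g = 1
    · rw [if_pos hg, hg, h1]
    rw [if_neg hg]
    rcases isSplit hm n g with ⟨h, j, rfl⟩ | ⟨h, h', rfl⟩
    · rw [plancherel_incl_mul_lastT_pow, sum_rootVal_pow ξ hm, plancherel_eq hm n]
      by_cases hj : m ∣ j
      · rw [if_neg (c := h = 1), mul_zero]
        rintro rfl
        obtain ⟨l, rfl⟩ := hj
        rw [pow_mul, lastT_pow, one_pow, map_one, one_mul] at hg
        exact hg rfl
      · rw [if_neg hj, zero_mul]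
    -- A cyclic permutation under the trace merges the two elements of the smaller group.
    · rw [plancherel_mul_comm, ← mul_assoc, ← map_mul, plancherel_incl_mul_lastS]

end Trace

end CyclotomicFusion

namespace CyclotomicFusion

open Finset

/-! ### Matrices over field extensions, inversion and faithfulness -/

section MatrixRep

variable {m n : ℕ} (ξ : Fin m ≃ rootsOfUnity m ℂ) (μ : Fin m → YoungDiagram)

/-- The semi-normal representation in matrix form. -/
noncomputable def matRep : G m n →* Matrix (StdTableau n μ) (StdTableau n μ) ℂ :=
  (LinearMap.toMatrixAlgEquiv (Finsupp.basisSingleOne (R := ℂ) (ι := StdTableau n μ)) :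
    (V n μ →ₗ[ℂ] V n μ) →* _).comp (seminormalRep n ξ μ)

theorem matRep_apply (g : G m n) (S T : StdTableau n μ) :
    matRep ξ μ g S T = seminormalRep n ξ μ g (Finsupp.single T 1) S := by
  simp [matRep, LinearMap.toMatrixAlgEquiv_apply]

variable (K : Type*) [Field K] [Algebra ℂ K]

/-- The action of the group algebra over a field extension of `ℂ` in matrix form. -/
noncomputable def matAlg :
    MonoidAlgebra K (G m n) →ₐ[K] Matrix (StdTableau n μ) (StdTableau n μ) K :=
  MonoidAlgebra.lift K _ (G m n)
    ((RingHom.mapMatrix (m := StdTableau n μ) (algebraMap ℂ K)).toMonoidHom.comp (matRep ξ μ))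

theorem matAlg_single (g : G m n) (c : K) :
    matAlg ξ μ K (MonoidAlgebra.single g c) = c • (matRep ξ μ g).map (algebraMap ℂ K) := by
  rw [matAlg, MonoidAlgebra.lift_single]
  rfl

variable {K} in
theorem matAlg_apply (a : MonoidAlgebra K (G m n)) (S T : StdTableau n μ) :
    matAlg ξ μ K a S T = a.coeff.sum fun g c => c * algebraMap ℂ K (matRep ξ μ g S T) := by
  rw [matAlg, MonoidAlgebra.lift_apply, Finsupp.sum, Matrix.sum_apply]
  rfl

theorem matAlg_mapRingHom (a : MonoidAlgebra ℂ (G m n)) :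
    matAlg ξ μ K (MonoidAlgebra.mapRingHom (G m n) (algebraMap ℂ K) a) =
      (matAlg ξ μ ℂ a).map (algebraMap ℂ K) := by
  induction a using MonoidAlgebra.induction_linear with
  | zero => simp
  | add x y hx hy => rw [map_add, map_add, hx, hy, map_add, Matrix.map_add _ (map_add _)]
  | single g c =>
    rw [MonoidAlgebra.mapRingHom_single, matAlg_single, matAlg_single]
    ext S T
    simp

theorem matAlg_eq_asAlgebraHom (a : MonoidAlgebra ℂ (G m n)) (S T : StdTableau n μ) :
    matAlg ξ μ ℂ a S T = (seminormalRep n ξ μ).asAlgebraHom a (Finsupp.single T 1) S := by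
  induction a using MonoidAlgebra.induction_linear with
  | zero => simp
  | add x y hx hy => rw [map_add, map_add, Matrix.add_apply, hx, hy]; rfl
  | single g c =>
    rw [matAlg_single, Representation.asAlgebraHom_single]
    simp [matRep_apply]

variable {μ}

/-- The vector with coordinates in the field extension. -/
def castVec (x : V n μ) : StdTableau n μ → K := fun S => algebraMap ℂ K (x S)

theorem castVec_add (x y : V n μ) : castVec K (x + y) = castVec K x + castVec K y := by
  funext S; simp [castVec]

theorem castVec_smul (c : ℂ) (x : V n μ) :
    castVec K (c • x) = algebraMap ℂ K c • castVec K x := by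
  funext S; simp [castVec]

theorem castVec_single (T : StdTableau n μ) :
    castVec K (Finsupp.single T 1) = Pi.single T 1 := by
  funext S
  by_cases h : S = T
  · subst h; simp [castVec]
  · simp [castVec, h]

theorem matAlg_single_mulVec (g : G m n) (x : V n μ) :
    (matAlg ξ μ K (MonoidAlgebra.single g 1)).mulVec (castVec K x) =
      castVec K (seminormalRep n ξ μ g x) := by
  rw [matAlg_single, one_smul]
  induction x using Finsupp.induction_linear with
  | zero => funext S; simp [castVec, Matrix.mulVec, dotProduct]
  | add x y hx hy => rw [castVec_add, Matrix.mulVec_add, hx, hy, map_add, castVec_add]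
  | single T c =>
    have : (Finsupp.single T c : V n μ) = c • Finsupp.single T 1 := by simp
    rw [this, castVec_smul, Matrix.mulVec_smul, map_smul, castVec_smul, castVec_single]
    congr 1
    funext S
    rw [Matrix.mulVec_single_one]
    simp [matRep_apply, castVec]

/-- A coefficient of an element of the group algebra is a weighted sum of traces. -/
theorem coeff_eq_sum_trace (hm : 1 ≤ m) (a : MonoidAlgebra K (G m n)) (g : G m n) :
    ∑ μ : Shape m n, algebraMap ℂ K (fCoeff μ.1) *
      (matAlg ξ μ.1 K (MonoidAlgebra.single g⁻¹ 1) * matAlg ξ μ.1 K a).trace =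
        (m : K) ^ (n + 1) * a.coeff g := by
  classical
  induction a using MonoidAlgebra.induction_linear with
  | zero => simp
  | add x y hx hy =>
    simp only [map_add, mul_add, Matrix.trace_add, sum_add_distrib, hx, hy,
      MonoidAlgebra.coeff_add, Finsupp.add_apply]
  | single h c =>
    have e : ∀ μ : Shape m n, algebraMap ℂ K (fCoeff μ.1) *
        (matAlg ξ μ.1 K (MonoidAlgebra.single g⁻¹ 1) *
          matAlg ξ μ.1 K (MonoidAlgebra.single h c)).trace =
        c * algebraMap ℂ K (∑ T : StdTableau n μ.1,
          fCoeff μ.1 * seminormalRep n ξ μ.1 (g⁻¹ * h) (Finsupp.single T 1) T) := by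
      intro μ
      rw [← map_mul, MonoidAlgebra.single_mul_single, one_mul, matAlg_single, Matrix.trace_smul,
        ← mul_sum, map_mul (algebraMap ℂ K), map_sum (algebraMap ℂ K), Matrix.trace, smul_eq_mul]
      simp only [Matrix.diag_apply, Matrix.map_apply, matRep_apply]
      ring
    rw [sum_congr rfl fun μ _ => e μ, ← mul_sum, ← map_sum]
    have := plancherel_eq ξ hm n (g⁻¹ * h)
    rw [plancherel] at this
    rw [this, MonoidAlgebra.coeff_single, Finsupp.single_apply]
    have hiff : g⁻¹ * h = 1 ↔ h = g := by rw [inv_mul_eq_one, eq_comm]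
    by_cases hg : h = g
    · rw [if_pos (hiff.2 hg), if_pos hg]; simp [mul_comm]
    · rw [if_neg (mt hiff.1 hg), if_neg hg]; simp

variable {K} in
-- The weights multiplying the eigenvalues are complex constants. Thus regularity and values of the
-- eigenvalues, as functions of a spectral parameter, pass directly to the coefficients.
theorem coeff_of_diagonal (hm : 1 ≤ m) (a : MonoidAlgebra K (G m n))
    (z : ∀ μ : Fin m → YoungDiagram, StdTableau n μ → K)
    (h : ∀ μ : Shape m n, matAlg ξ μ.1 K a = Matrix.diagonal (z μ.1)) (g : G m n) :
    a.coeff g = ∑ μ : Shape m n, ∑ T : StdTableau n μ.1,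
      algebraMap ℂ K (((m : ℂ) ^ (n + 1))⁻¹ * fCoeff μ.1 * matRep ξ μ.1 g⁻¹ T T) * z μ.1 T := by
  have := coeff_eq_sum_trace ξ K hm a g
  have hm0 : (m : K) ≠ 0 := by
    have : (m : ℂ) ≠ 0 := by norm_cast; omega
    simpa using (map_ne_zero (algebraMap ℂ K)).2 this
  have hm1 : (m : K) ^ (n + 1) ≠ 0 := pow_ne_zero _ hm0
  rw [← mul_right_inj' hm1, ← this, mul_sum]
  refine sum_congr rfl fun μ _ => ?_
  rw [h μ, mul_sum, Matrix.trace, mul_sum]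
  refine sum_congr rfl fun T _ => ?_
  rw [Matrix.diag_apply, Matrix.mul_diagonal, matAlg_single, one_smul, Matrix.map_apply]
  simp only [map_mul, map_inv₀, map_pow, map_natCast]
  field_simp

variable {K} in
/-- The semi-normal representations are jointly faithful. -/
theorem eq_zero_of_matAlg (hm : 1 ≤ m) (a : MonoidAlgebra K (G m n))
    (h : ∀ μ : Shape m n, matAlg ξ μ.1 K a = 0) : a = 0 := by
  ext g
  rw [coeff_of_diagonal ξ hm a (fun _ _ => 0) fun μ => by rw [h μ]; simp]
  simp

/-- By joint faithfulness, the group elements are linearly independent in a finite-dimensional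
product of matrix algebras. -/
theorem finite_G (ξ : Fin m ≃ rootsOfUnity m ℂ) (hm : 1 ≤ m) : Finite (G m n) := by
  let f : MonoidAlgebra ℂ (G m n) →ₗ[ℂ]
      (∀ μ : Shape m n, Matrix (StdTableau n μ.1) (StdTableau n μ.1) ℂ) :=
    LinearMap.pi fun μ => (matAlg ξ μ.1 ℂ).toLinearMap
  have hf : Function.Injective f := by
    rw [injective_iff_map_eq_zero]
    exact fun a ha => eq_zero_of_matAlg ξ hm a fun μ => congrFun ha μ
  have hli : LinearIndependent ℂ fun g : G m n => f (MonoidAlgebra.single g 1) := by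
    have : LinearIndependent ℂ fun g : G m n => (MonoidAlgebra.single g 1 : MonoidAlgebra ℂ (G m n)) :=
      (MonoidAlgebra.basis (G m n) ℂ).linearIndependent
    exact this.map' f (LinearMap.ker_eq_bot.2 hf)
  exact hli.finite

end MatrixRep

/-! ### Eigenvalues of the factors of the fusion product -/

section PhiAction

variable {m n : ℕ} (ξ : Fin m ≃ rootsOfUnity m ℂ) {μ : Fin m → YoungDiagram}
  {K : Type*} [Field K] [Algebra ℂ K]

theorem IsStandard.content_zero {w : Fin (n + 1) → Node m} (h : IsStandard μ w) :
    content (w 0) = 0 := by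
  obtain ⟨d, hd⟩ := (h.mem_range ((w 0).1, (0, 0))).2
    ((μ (w 0).1).up_left_mem (Nat.zero_le _) (Nat.zero_le _) (h.mem 0))
  have := h.mono (a := d) (b := 0) (by simp [hd]) (by simp [hd]) (by simp [hd])
  rw [Fin.le_zero_iff.1 this] at hd
  have h0 : (w 0).2 = (0, 0) := congrArg Prod.snd hd
  simp [content, h0]

/-- For distinct roots the sum times their difference is a difference of `m`-th powers, hence zero.
Thus `t(ξ_k)` is the projector onto the `ξ_k`-eigenspace of `t`. -/
theorem sum_root_eq (hm : 1 ≤ m) (k l : Fin m) :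
    ∑ j ∈ range m, (1 / (m : ℂ)) * rootVal ξ k ^ (m - j) * rootVal ξ l ^ j =
      if l = k then 1 else 0 := by
  have hm0 : (m : ℂ) ≠ 0 := by norm_cast; omega
  split_ifs with h
  · subst h
    have : ∀ j ∈ range m, (1 / (m : ℂ)) * rootVal ξ l ^ (m - j) * rootVal ξ l ^ j = 1 / m := by
      intro j hj
      rw [mul_assoc, ← pow_add, Nat.sub_add_cancel (mem_range.1 hj).le, rootVal_pow, mul_one]
    rw [sum_congr rfl this, sum_const, card_range, nsmul_eq_mul]
    field_simp
  · have h1 := (Commute.all (rootVal ξ l) (rootVal ξ k)).geom_sum₂_mul m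
    rw [rootVal_pow, rootVal_pow, sub_self] at h1
    have h2 := (mul_eq_zero.1 h1).resolve_right
      (sub_ne_zero.2 fun e => h (rootVal_injective ξ e))
    have : ∀ j ∈ range m, (1 / (m : ℂ)) * rootVal ξ k ^ (m - j) * rootVal ξ l ^ j =
        (1 / m * rootVal ξ k) * (rootVal ξ l ^ j * rootVal ξ k ^ (m - 1 - j)) := by
      intro j hj
      rw [show m - j = (m - 1 - j) + 1 by have := mem_range.1 hj; omega, pow_succ]
      ring
    rw [sum_congr rfl this, ← mul_sum, h2, mul_zero]

theorem matAlg_gs_mulVec (w : Fin (n + 1) → Node m) (i : Fin n) :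
    (matAlg ξ μ K (MonoidAlgebra.single (gs m i) 1)).mulVec (castVec K (vec μ w)) =
      algebraMap ℂ K (axial w i) • castVec K (vec μ w) +
        algebraMap ℂ K (offDiag μ w i) • castVec K (vec μ (swapFilling w i)) := by
  rw [matAlg_single_mulVec, seminormalRep_s, sOp_vec, castVec_add, castVec_smul, castVec_smul]

theorem matAlg_bt_mulVec (hm : 1 ≤ m) (w : Fin (n + 1) → Node m) (k : Fin m) :
    (matAlg ξ μ K (bt m K n (rootVal ξ k))).mulVec (castVec K (vec μ w)) =
      (if (w 0).1 = k then (1 : K) else 0) • castVec K (vec μ w) := by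
  have hpow : ∀ j : ℕ, seminormalRep n ξ μ (gt m n ^ j) (vec μ w) =
      rootVal ξ (w 0).1 ^ j • vec μ w := by
    intro j
    rw [map_pow]
    induction j with
    | zero => simp
    | succ j ih =>
      rw [pow_succ', Module.End.mul_apply, ih, map_smul, seminormalRep_t, tOp_vec, smul_smul,
        pow_succ]
  have hterm : ∀ j, (matAlg ξ μ K (MonoidAlgebra.single (gt m n ^ j)
      (algebraMap ℂ K ((1 / (m : ℂ)) * rootVal ξ k ^ (m - j))))).mulVec (castVec K (vec μ w)) =
      algebraMap ℂ K ((1 / (m : ℂ)) * rootVal ξ k ^ (m - j) * rootVal ξ (w 0).1 ^ j) •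
        castVec K (vec μ w) := by
    intro j
    have : (MonoidAlgebra.single (gt m n ^ j)
        (algebraMap ℂ K ((1 / (m : ℂ)) * rootVal ξ k ^ (m - j)))) =
        algebraMap ℂ K ((1 / (m : ℂ)) * rootVal ξ k ^ (m - j)) •
          MonoidAlgebra.single (gt m n ^ j) (1 : K) := by simp
    rw [this, map_smul, Matrix.smul_mulVec, matAlg_single_mulVec, hpow, castVec_smul, smul_smul,
      ← map_mul]
  rw [bt, map_sum, Matrix.sum_mulVec, sum_congr rfl fun j _ => hterm j, ← sum_smul, ← map_sum,
    sum_root_eq ξ hm]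
  split_ifs <;> simp

/-- The eigenvalue of `φ_{k+1}` on a vector of the semi-normal basis. -/
noncomputable def phiScalar (u : K) (κ : Fin m) (w : Fin (n + 1) → Node m) (k : Fin (n + 1)) : K :=
  if (w k).1 = κ then u / (u - content (w k)) *
    ∏ i ∈ Iio k, (if (w i).1 = κ then 1 - 1 / (u - content (w i)) ^ 2 else 1) else 0

theorem Iio_succ_eq (i : Fin n) : Iio i.succ = insert i.castSucc (Iio i.castSucc) := by
  ext j
  simp only [mem_Iio, mem_insert, Fin.lt_def, Fin.ext_iff, Fin.val_succ, Fin.val_castSucc]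
  omega

/-- The induction keeps the filling arbitrary because it is applied both to `w` and to the
interchanged filling, which agree before the interchanged numbers. Only those earlier numbers have
to match the parameters. -/
theorem matAlg_phi_mulVec (hm : 1 ≤ m) {vs : Fin (n + 1) → ℂ} {us : Fin (n + 1) → K} {u : K}
    (hu : ∀ z : ℤ, u - z ≠ 0) (κ : Fin m) (k : Fin (n + 1)) :
    ∀ w : Fin (n + 1) → Node m,
      (∀ i, i < k → vs i = rootVal ξ (w i).1 ∧ us i = content (w i)) →
      (matAlg ξ μ K (phi m vs us (rootVal ξ κ) u k)).mulVec (castVec K (vec μ w)) =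
        phiScalar u κ w k • castVec K (vec μ w) := by
  induction k using Fin.induction with
  | zero =>
    intro w _
    by_cases hw : IsStandard μ w
    swap
    · rw [vec_of_not hw]
      have : castVec K (0 : V n μ) = 0 := by funext S; simp [castVec]
      rw [this, Matrix.mulVec_zero, smul_zero]
    have h0 : u ≠ 0 := by simpa using hu 0
    rw [show phi m vs us (rootVal ξ κ) u 0 = bt m K n (rootVal ξ κ) from rfl,
      matAlg_bt_mulVec ξ hm, phiScalar, hw.content_zero]
    congr 1
    have : Iio (0 : Fin (n + 1)) = ∅ := by ext; simp
    rw [this]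
    simp [h0]
  | succ i ih =>
    intro w hw'
    by_cases hw : IsStandard μ w
    swap
    · rw [vec_of_not hw]
      have : castVec K (0 : V n μ) = 0 := by funext S; simp [castVec]
      rw [this, Matrix.mulVec_zero, smul_zero]
    have hlt : i.castSucc < i.succ := Fin.castSucc_lt_succ
    have hsame : ∀ j, j < i.castSucc → swapFilling w i j = w j := fun j hj =>
      swapFilling_of_ne w i hj.ne (hj.trans hlt).ne
    have ih1 := ih w fun j hj => hw' j (hj.trans hlt)
    have ih2 := ih (swapFilling w i) fun j hj => by
      rw [hsame j hj]; exact hw' j (hj.trans hlt)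
    obtain ⟨hv, hus⟩ := hw' i.castSucc hlt
    have hphi : phi m vs us (rootVal ξ κ) u i.succ =
        bs m i (rootVal ξ κ) (vs i.castSucc) u (us i.castSucc) *
          phi m vs us (rootVal ξ κ) u i.castSucc * MonoidAlgebra.single (gs m i) 1 := by
      rw [phi, Fin.induction_succ]; rfl
    have hod : algebraMap ℂ K (offDiag μ w i) *
        algebraMap ℂ K (offDiag μ (swapFilling w i) i) =
          1 - algebraMap ℂ K (axial w i) ^ 2 := by
      rw [← map_mul, offDiag_mul hw]; simp
    have hbs : ∀ x : StdTableau n μ → K,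
        (matAlg ξ μ K (bs m i (rootVal ξ κ) (vs i.castSucc) u (us i.castSucc))).mulVec x =
          (matAlg ξ μ K (MonoidAlgebra.single (gs m i) 1)).mulVec x +
            (if (w i.castSucc).1 = κ then 1 / (u - content (w i.castSucc)) else 0 : K) • x := by
      intro x
      have hiff : rootVal ξ κ = rootVal ξ (w i.castSucc).1 ↔ (w i.castSucc).1 = κ :=
        ⟨fun h => (rootVal_injective ξ h).symm, fun h => by rw [h]⟩
      rw [bs, map_add, Matrix.add_mulVec]
      congr 1
      rw [show ∀ c : K, MonoidAlgebra.single (1 : G m n) c = algebraMap K _ c from fun c => rfl,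
        AlgHom.commutes, Algebra.algebraMap_eq_smul_one, Matrix.smul_mulVec, Matrix.one_mulVec, hv, hus]
      congr 1
      exact if_congr hiff rfl rfl
    rw [hphi, map_mul, map_mul, ← Matrix.mulVec_mulVec, ← Matrix.mulVec_mulVec, matAlg_gs_mulVec,
      Matrix.mulVec_add, Matrix.mulVec_smul, Matrix.mulVec_smul, ih1, ih2, hbs, Matrix.mulVec_add,
      Matrix.mulVec_smul, Matrix.mulVec_smul, Matrix.mulVec_smul, Matrix.mulVec_smul,
      matAlg_gs_mulVec, matAlg_gs_mulVec, swapFilling_swapFilling, axial_swap, map_neg]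
    have hP : ∏ j ∈ Iio i.castSucc, (if (swapFilling w i j).1 = κ then
          1 - 1 / (u - (content (swapFilling w i j) : K)) ^ 2 else 1) =
        ∏ j ∈ Iio i.castSucc, (if (w j).1 = κ then 1 - 1 / (u - (content (w j) : K)) ^ 2 else 1) :=
      prod_congr rfl fun j hj => by rw [hsame j (mem_Iio.1 hj)]
    have hax : algebraMap ℂ K (axial w i) = if (w i.castSucc).1 = (w i.succ).1 then
        ((content (w i.succ) : K) - content (w i.castSucc))⁻¹ else 0 := by
      rw [axial, axialCoeff]
      split_ifs <;> simp
    simp only [phiScalar, swapFilling_castSucc, hP, Iio_succ_eq]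
    rw [prod_insert (by simp)]
    set P := ∏ j ∈ Iio i.castSucc,
      (if (w j).1 = κ then 1 - 1 / (u - (content (w j) : K)) ^ 2 else 1)
    have n1 := hu (content (w i.castSucc))
    have n2 := hu (content (w i.succ))
    rw [hax] at hod ⊢
    by_cases h1 : (w i.castSucc).1 = κ <;> by_cases h2 : (w i.succ).1 = κ
    · have n3 : (content (w i.succ) : K) - content (w i.castSucc) ≠ 0 := by
        have := hw.content_ne (a := i.castSucc) (b := i.succ) hlt (by simp) (h1.trans h2.symm)
        have h3 : ((content (w i.succ) - content (w i.castSucc) : ℤ) : ℂ) ≠ 0 :=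
          Int.cast_ne_zero.2 this
        simpa using (map_ne_zero (algebraMap ℂ K)).2 h3
      rw [if_pos (h1.trans h2.symm)] at hod ⊢
      simp only [if_pos h1, if_pos h2]
      generalize (content (w i.castSucc) : K) = x at n1 n3 hod ⊢
      generalize (content (w i.succ) : K) = y at n2 n3 hod ⊢
      match_scalars
      · have e : (y - x)⁻¹ ^ 2 * (u / (u - x)) + (1 - (y - x)⁻¹ ^ 2) * (u / (u - y)) +
            1 / (u - x) * (y - x)⁻¹ * (u / (u - x)) = u / (u - y) * (1 - 1 / (u - x) ^ 2) := by
          field_simp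
          ring
        linear_combination (u / (u - y) * P) * hod + P * e
      -- The off-diagonal entry: the shift `1 / (u - x)` cancels the difference of the two
      -- eigenvalues exactly.
      · have e : (y - x)⁻¹ * (u / (u - x)) - (y - x)⁻¹ * (u / (u - y)) +
            1 / (u - x) * (u / (u - y)) = 0 := by
          field_simp
          ring
        linear_combination (algebraMap ℂ K (offDiag μ w i) * P) * e
    · have h3 : (w i.castSucc).1 ≠ (w i.succ).1 := fun h => h2 (h.symm.trans h1)
      simp only [if_neg h2, if_neg h3]
      simp
    · have h3 : (w i.castSucc).1 ≠ (w i.succ).1 := fun h => h1 (h.trans h2)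
      rw [if_neg h3] at hod
      simp only [if_neg h1, if_pos h2, if_neg h3]
      match_scalars
      · linear_combination (u / (u - (content (w i.succ) : K)) * P) * hod
      · ring
    · simp only [if_neg h1, if_neg h2]
      simp

end PhiAction

end CyclotomicFusion

namespace CyclotomicFusion

open Finset

/-! ### Calculus of evaluations of rational functions -/

section Evaluation

variable {N : ℕ} {i : Fin N} {c : ℂ} {r r' s s' : RatField N}

theorem EvaluatesTo.add (h : EvaluatesTo i c r r') (h' : EvaluatesTo i c s s') :
    EvaluatesTo i c (r + s) (r' + s') := by
  obtain ⟨a, b, hb, rfl, rfl⟩ := h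
  obtain ⟨a', b', hb', rfl, rfl⟩ := h'
  have hi := IsFractionRing.injective (MvPolynomial (Fin N) ℂ) (RatField N)
  have n1 := (map_ne_zero_iff _ hi).2 hb
  have n2 := (map_ne_zero_iff _ hi).2 hb'
  have n3 := (map_ne_zero_iff _ hi).2 (show b ≠ 0 from fun h => hb (by rw [h, map_zero]))
  have n4 := (map_ne_zero_iff _ hi).2 (show b' ≠ 0 from fun h => hb' (by rw [h, map_zero]))
  refine ⟨a * b' + a' * b, b * b', ?_, ?_, ?_⟩
  · rw [map_mul]; exact mul_ne_zero hb hb'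
  · rw [map_add, map_mul, map_mul, map_mul]; field_simp
  · simp only [map_add, map_mul]; field_simp

theorem EvaluatesTo.mul (h : EvaluatesTo i c r r') (h' : EvaluatesTo i c s s') :
    EvaluatesTo i c (r * s) (r' * s') := by
  obtain ⟨a, b, hb, rfl, rfl⟩ := h
  obtain ⟨a', b', hb', rfl, rfl⟩ := h'
  refine ⟨a * a', b * b', ?_, ?_, ?_⟩
  · rw [map_mul]; exact mul_ne_zero hb hb'
  · rw [map_mul, map_mul, div_mul_div_comm]
  · simp only [map_mul, div_mul_div_comm]

theorem EvaluatesTo.inv (h : EvaluatesTo i c r r') (hr : r' ≠ 0) : EvaluatesTo i c r⁻¹ r'⁻¹ := by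
  obtain ⟨a, b, hb, rfl, rfl⟩ := h
  refine ⟨b, a, ?_, inv_div _ _, inv_div _ _⟩
  intro ha
  rw [ha, map_zero, zero_div] at hr
  exact hr rfl

/-- Cross-multiplication gives a polynomial identity, which survives the substitution. So the value
does not depend on the chosen fraction. -/
theorem EvaluatesTo.unique (h : EvaluatesTo i c r r') (h' : EvaluatesTo i c r s') : r' = s' := by
  obtain ⟨a, b, hb, rfl, rfl⟩ := h
  obtain ⟨a', b', hb', h1, rfl⟩ := h'
  have hi := IsFractionRing.injective (MvPolynomial (Fin N) ℂ) (RatField N)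
  have n1 := (map_ne_zero_iff _ hi).2 hb
  have n2 := (map_ne_zero_iff _ hi).2 hb'
  have n3 := (map_ne_zero_iff _ hi).2 (show b ≠ 0 from fun h => hb (by rw [h, map_zero]))
  have n4 := (map_ne_zero_iff _ hi).2 (show b' ≠ 0 from fun h => hb' (by rw [h, map_zero]))
  rw [div_eq_div_iff n3 n4, ← map_mul, ← map_mul] at h1
  rw [div_eq_div_iff n1 n2, ← map_mul, ← map_mul, ← map_mul, ← map_mul, hi h1]

theorem EvaluatesTo.const (i : Fin N) (c z : ℂ) :
    EvaluatesTo i c (algebraMap ℂ (RatField N) z) (algebraMap ℂ (RatField N) z) := by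
  refine ⟨MvPolynomial.C z, 1, by simp, ?_, ?_⟩
  · rw [map_one, div_one]; rfl
  · rw [map_one, map_one, div_one, substVar, MvPolynomial.algHom_C]; rfl

theorem EvaluatesTo.zero (i : Fin N) (c : ℂ) : EvaluatesTo i c 0 0 := by
  simpa using EvaluatesTo.const i c 0

theorem EvaluatesTo.one (i : Fin N) (c : ℂ) : EvaluatesTo i c 1 1 := by
  simpa using EvaluatesTo.const i c 1

theorem EvaluatesTo.intCast (i : Fin N) (c : ℂ) (z : ℤ) : EvaluatesTo i c z z := by
  simpa using EvaluatesTo.const i c z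

theorem EvaluatesTo.sub (h : EvaluatesTo i c r r') (h' : EvaluatesTo i c s s') :
    EvaluatesTo i c (r - s) (r' - s') := by
  have := h.add ((EvaluatesTo.intCast i c (-1)).mul h')
  simpa [sub_eq_add_neg] using this

theorem EvaluatesTo.div (h : EvaluatesTo i c r r') (h' : EvaluatesTo i c s s') (hs : s' ≠ 0) :
    EvaluatesTo i c (r / s) (r' / s') := by
  rw [div_eq_mul_inv, div_eq_mul_inv]
  exact h.mul (h'.inv hs)

theorem EvaluatesTo.sum {ι : Type*} (t : Finset ι) {f f' : ι → RatField N}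
    (h : ∀ j ∈ t, EvaluatesTo i c (f j) (f' j)) :
    EvaluatesTo i c (∑ j ∈ t, f j) (∑ j ∈ t, f' j) := by
  classical
  induction t using Finset.induction_on with
  | empty => simpa using EvaluatesTo.zero i c
  | insert a t ha ih =>
    rw [sum_insert ha, sum_insert ha]
    exact (h a (mem_insert_self _ _)).add (ih fun j hj => h j (mem_insert_of_mem hj))

theorem EvaluatesTo.prod {ι : Type*} (t : Finset ι) {f f' : ι → RatField N}
    (h : ∀ j ∈ t, EvaluatesTo i c (f j) (f' j)) :
    EvaluatesTo i c (∏ j ∈ t, f j) (∏ j ∈ t, f' j) := by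
  classical
  induction t using Finset.induction_on with
  | empty => simpa using EvaluatesTo.one i c
  | insert a t ha ih =>
    rw [prod_insert ha, prod_insert ha]
    exact (h a (mem_insert_self _ _)).mul (ih fun j hj => h j (mem_insert_of_mem hj))

theorem EvaluatesTo.uVar_self (i : Fin N) (c : ℂ) :
    EvaluatesTo i c (uVar i) (algebraMap ℂ (RatField N) c) := by
  refine ⟨MvPolynomial.X i, 1, by simp, ?_, ?_⟩
  · rw [map_one, div_one]; rfl
  · rw [map_one, map_one, div_one, substVar, MvPolynomial.aeval_X, Function.update_self]; rfl

theorem EvaluatesTo.uVar_ne {i j : Fin N} (h : j ≠ i) (c : ℂ) :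
    EvaluatesTo i c (uVar j) (uVar j) := by
  refine ⟨MvPolynomial.X j, 1, by simp, ?_, ?_⟩
  · rw [map_one, div_one]; rfl
  · rw [map_one, map_one, div_one, substVar, MvPolynomial.aeval_X, Function.update_of_ne h]; rfl

theorem uVar_ne_const (j : Fin N) (z : ℂ) : uVar j - algebraMap ℂ (RatField N) z ≠ 0 := by
  rw [sub_ne_zero]
  intro h
  have h1 : (MvPolynomial.X j : MvPolynomial (Fin N) ℂ) = MvPolynomial.C z :=
    IsFractionRing.injective (MvPolynomial (Fin N) ℂ) (RatField N) h
  have h2 := congrArg (MvPolynomial.eval fun _ => z + 1) h1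
  simp at h2

theorem uVar_ne_intCast (j : Fin N) (z : ℤ) : (uVar j : RatField N) - z ≠ 0 := by
  simpa using uVar_ne_const j z

theorem uVar_sub_ne_zero {j k : Fin N} (h : j ≠ k) : (uVar j : RatField N) - uVar k ≠ 0 := by
  rw [sub_ne_zero]
  intro h0
  exact h (MvPolynomial.X_injective
    (IsFractionRing.injective (MvPolynomial (Fin N) ℂ) (RatField N) h0))

/-- Evaluation of all coefficients of an element of a group algebra. -/
def AlgEvaluatesTo {Γ : Type*} (i : Fin N) (c : ℂ) (A A' : MonoidAlgebra (RatField N) Γ) : Prop :=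
  ∀ g, EvaluatesTo i c (A.coeff g) (A'.coeff g)

variable {Γ : Type*} {A A' B B' : MonoidAlgebra (RatField N) Γ}

theorem AlgEvaluatesTo.add (h : AlgEvaluatesTo i c A A') (h' : AlgEvaluatesTo i c B B') :
    AlgEvaluatesTo i c (A + B) (A' + B') := fun g => (h g).add (h' g)

theorem coeff_mul_eq_sum {R : Type*} [Semiring R] [Group Γ] [Fintype Γ] (x y : MonoidAlgebra R Γ) (g : Γ) :
    (x * y).coeff g = ∑ h, x.coeff h * y.coeff (h⁻¹ * g) := by
  classical
  rw [MonoidAlgebra.coeff_mul, Finsupp.sum_fintype _ _ (by simp)]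
  refine sum_congr rfl fun h _ => ?_
  rw [Finsupp.sum_fintype _ _ (by simp)]
  simp [← eq_inv_mul_iff_mul_eq]

theorem AlgEvaluatesTo.mul [Group Γ] [Finite Γ] (h : AlgEvaluatesTo i c A A')
    (h' : AlgEvaluatesTo i c B B') : AlgEvaluatesTo i c (A * B) (A' * B') := by
  have := Fintype.ofFinite Γ
  intro g
  rw [coeff_mul_eq_sum, coeff_mul_eq_sum]
  exact EvaluatesTo.sum _ fun k _ => (h k).mul (h' _)

theorem AlgEvaluatesTo.single (g : Γ) (h : EvaluatesTo i c r r') :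
    AlgEvaluatesTo i c (MonoidAlgebra.single g r) (MonoidAlgebra.single g r') := by
  classical
  intro k
  rw [MonoidAlgebra.coeff_single, MonoidAlgebra.coeff_single, Finsupp.single_apply,
    Finsupp.single_apply]
  split_ifs
  · exact h
  · exact EvaluatesTo.zero i c

theorem AlgEvaluatesTo.sum {ι : Type*} (t : Finset ι)
    {f f' : ι → MonoidAlgebra (RatField N) Γ} (h : ∀ j ∈ t, AlgEvaluatesTo i c (f j) (f' j)) :
    AlgEvaluatesTo i c (∑ j ∈ t, f j) (∑ j ∈ t, f' j) := by
  intro g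
  simp only [MonoidAlgebra.coeff_sum, Finsupp.finsetSum_apply]
  exact EvaluatesTo.sum t fun j hj => h j hj g

theorem AlgEvaluatesTo.list_prod [Group Γ] [Finite Γ] {ι : Type*} (l : List ι)
    {f f' : ι → MonoidAlgebra (RatField N) Γ} (h : ∀ j ∈ l, AlgEvaluatesTo i c (f j) (f' j)) :
    AlgEvaluatesTo i c (l.map f).prod (l.map f').prod := by
  induction l with
  | nil =>
    rw [List.map_nil, List.map_nil, List.prod_nil]
    exact AlgEvaluatesTo.single 1 (EvaluatesTo.one i c)
  | cons a l ih =>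
    rw [List.map_cons, List.map_cons, List.prod_cons, List.prod_cons]
    exact (h a (List.mem_cons_self ..)).mul (ih fun j hj => h j (List.mem_cons_of_mem _ hj))

end Evaluation

/-! ### Regularity of a single factor -/

section PhiEvaluation

variable {m n N : ℕ} {i : Fin N} {c : ℂ}

/-- The only denominators are differences of `u` with earlier parameters, so it is enough that these
stay nonzero after the evaluation. -/
theorem AlgEvaluatesTo.phi [Finite (G m n)] {vs : Fin (n + 1) → ℂ}
    {us us' : Fin (n + 1) → RatField N} {u u' : RatField N} (v : ℂ) (k : Fin (n + 1))
    (hu : EvaluatesTo i c u u') (hus : ∀ j, j < k → EvaluatesTo i c (us j) (us' j))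
    (hne : ∀ j, j < k → u' - us' j ≠ 0) :
    AlgEvaluatesTo i c (phi m vs us v u k) (phi m vs us' v u' k) := by
  induction k using Fin.induction with
  | zero =>
    change AlgEvaluatesTo i c (bt m _ n v) (bt m _ n v)
    exact AlgEvaluatesTo.sum _ fun j _ => AlgEvaluatesTo.single _ (EvaluatesTo.const i c _)
  | succ l ih =>
    have hlt : l.castSucc < l.succ := Fin.castSucc_lt_succ
    have e : ∀ (us : Fin (n + 1) → RatField N) (u : RatField N), CyclotomicFusion.phi m vs us v u l.succ =
        bs m l v (vs l.castSucc) u (us l.castSucc) * CyclotomicFusion.phi m vs us v u l.castSucc *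
          MonoidAlgebra.single (gs m l) 1 := fun us u => by
      rw [CyclotomicFusion.phi, Fin.induction_succ]; rfl
    rw [e, e]
    refine AlgEvaluatesTo.mul (AlgEvaluatesTo.mul ?_ (ih (fun j hj => hus j (hj.trans hlt))
      fun j hj => hne j (hj.trans hlt))) (AlgEvaluatesTo.single _ (EvaluatesTo.one i c))
    refine (AlgEvaluatesTo.single _ (EvaluatesTo.one i c)).add (AlgEvaluatesTo.single _ ?_)
    split_ifs
    · exact (EvaluatesTo.one i c).div (hu.sub (hus _ hlt)) (hne _ hlt)
    · exact EvaluatesTo.zero i c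

end PhiEvaluation

/-! ### Values of the eigenvalues in terms of hook weights -/

section ScalarEvaluation

variable {m n : ℕ} {μ : Fin m → YoungDiagram}

theorem prod_partialShape {M : Type*} [CommMonoid M] {w : Fin (n + 1) → Node m}
    (h : IsStandard μ w) (k : Fin (n + 1)) (κ : Fin m) (f : ℕ × ℕ → M) :
    ∏ i ∈ Iio k, (if (w i).1 = κ then f (w i).2 else 1) =
      ∏ q ∈ (partialShape h k κ).cells, f q := by
  rw [← prod_filter]
  refine prod_bij (fun i _ => (w i).2) ?_ ?_ ?_ fun _ _ => rfl
  · intro i hi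
    rw [mem_filter, mem_Iio] at hi
    rw [YoungDiagram.mem_cells, ← hi.2, mem_partialShape]
    exact ⟨i, hi.1, rfl⟩
  · intro i hi j hj hij
    rw [mem_filter] at hi hj
    exact h.inj (Prod.ext (hi.2.trans hj.2.symm) hij)
  · intro q hq
    rw [YoungDiagram.mem_cells, mem_partialShape (q := (κ, q))] at hq
    obtain ⟨i, hi, hw⟩ := hq
    exact ⟨i, by rw [mem_filter, mem_Iio, hw]; exact ⟨hi, rfl⟩, by rw [hw]⟩

theorem partialShape_congr {μ' : Fin m → YoungDiagram} {w w' : Fin (n + 1) → Node m}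
    (h : IsStandard μ w) (h' : IsStandard μ' w') {k : ℕ}
    (hww : ∀ i : Fin (n + 1), i.1 < k → w i = w' i) : partialShape h k = partialShape h' k :=
  shape_ext fun q => by
    rw [mem_partialShape, mem_partialShape]
    constructor
    · rintro ⟨i, hi, hq⟩; exact ⟨i, hi, (hww i hi).symm.trans hq⟩
    · rintro ⟨i, hi, hq⟩; exact ⟨i, hi, (hww i hi).trans hq⟩

/-- The prefactor `u / (u - c)` supplies the `u` needed for telescoping and cancels the factor of
row `x`, whose end has content `c`. The potential pole at `u = c` is thereby removed. -/
theorem phiScalar_eq {K : Type*} [Field K] {u : K} (hu : ∀ z : ℤ, u - z ≠ 0)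
    {w : Fin (n + 1) → Node m} (h : IsStandard μ w) (k : Fin (n + 1)) {ν : YoungDiagram}
    (hν : partialShape h k (w k).1 = ν) {x : ℕ} (hx : x ≤ ν.colLen 0)
    (hc : content (w k) = rowContent ν x) :
    phiScalar u (w k).1 w k = (∏ i ∈ (range (ν.colLen 0 + 1 + 1)).erase x, (u - rowContent ν i)) /
      ∏ i ∈ range (ν.colLen 0 + 1), (u + 1 - rowContent ν i) := by
  rw [phiScalar, if_pos rfl]
  have e := prod_partialShape h k (w k).1 fun q => 1 - 1 / (u - (((q.2 : ℤ) - q.1 : ℤ) : K)) ^ 2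
  simp only [content] at e hc ⊢
  rw [e, hν, div_mul_eq_mul_div, prod_cells_telescope hu (Nat.le_succ _), hc,
    ← mul_prod_erase _ _ (mem_range.2 (by omega : x < ν.colLen 0 + 1 + 1))]
  have := hu (rowContent ν x)
  simp only [Nat.succ_eq_add_one]
  field_simp

/-- Rows from `x` on have smaller or equal ends, and the earlier rows are strictly longer. This is
the regularity of the eigenvalue at an addable content. -/
theorem IsAddable.rowContent_ne {ν : YoungDiagram} {x : ℕ} (hx : IsAddable ν x) (i : ℕ) :
    (rowContent ν x : ℂ) + 1 - rowContent ν i ≠ 0 := by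
  have : rowContent ν x + 1 - rowContent ν i ≠ 0 := by
    rcases le_or_gt x i with h | h
    · have := (rowContent_strictAnti ν).antitone h; omega
    · have := hx i h
      simp only [rowContent]; omega
  exact_mod_cast this

/-- The eigenvalue of `φ_{k+1}` is non-singular at the content of the node with the number `k + 1`,
and its value is a quotient of products of hook lengths. -/
theorem phiScalar_evaluatesTo {μ' : Fin m → YoungDiagram} {w w' : Fin (n + 1) → Node m}
    (h : IsStandard μ w) (h' : IsStandard μ' w') (k : Fin (n + 1))
    (hww : ∀ i, i < k → w' i = w i) :
    EvaluatesTo k (content (w k)) (phiScalar (uVar k) (w k).1 w' k)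
      (algebraMap ℂ (RatField (n + 1)) (if w' k = w k then
        fCoeff (partialShape h k) / fCoeff (partialShape h (k + 1)) else 0)) := by
  by_cases hκ : (w' k).1 = (w k).1
  swap
  · rw [phiScalar, if_neg hκ, if_neg fun e => hκ (congrArg Prod.fst e), map_zero]
    exact EvaluatesTo.zero _ _
  obtain ⟨a, ha, hadd⟩ := exists_addNode h k
  obtain ⟨a', ha', -⟩ := exists_addNode h' k
  have hsh : partialShape h' k = partialShape h k := partialShape_congr h' h hww
  -- The two fillings agree before `k`, so their nodes at `k` are addable to the same partial shape
  -- and can be compared there.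
  generalize partialShape h' k = ν' at a' ha' hsh
  subst hsh
  have hsh : partialShape h' k = partialShape h k := partialShape_congr h' h hww
  obtain ⟨κ, x⟩ := a
  obtain ⟨κ', x'⟩ := a'
  have e1 : κ = (w k).1 := congrArg Prod.fst ha
  have e2 : κ' = (w k).1 := (congrArg Prod.fst ha').trans hκ
  subst e1
  subst e2
  have hf := fCoeff_addNode (μ := partialShape h k) ⟨(w k).1, x⟩
  rw [hadd] at hf
  have hc : content (w k) = rowContent (partialShape h k (w k).1) x.1 :=
    (congrArg content ha).symm.trans (content_addNode _)
  have hc' : content (w' k) = rowContent (partialShape h k (w k).1) x'.1 :=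
    (congrArg content ha').symm.trans (content_addNode _)
  have hwx : w' k = w k ↔ x'.1 = x.1 := by
    constructor
    · intro e; exact congrArg (fun q : Node m => q.2.1) (ha'.trans (e.trans ha.symm))
    · intro e
      obtain rfl : x' = x := Subtype.ext e
      exact ha'.symm.trans ha
  clear ha ha' hadd
  simp only at hf
  have hsh' : partialShape h' k (w' k).1 = partialShape h k (w k).1 := by rw [hsh, hκ]
  rw [← hκ, phiScalar_eq (uVar_ne_intCast k) h' k hsh' x'.2.le_colLen hc']
  have hcoef := fCoeff_ne_zero (partialShape h k)
  have hratio := hookProd_eq_mul_residue (Nat.lt_succ_self _) x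
  generalize partialShape h k (w k).1 = ν at *
  set L := ν.colLen 0 + 1 with hL
  have hK : ∀ z : ℂ, (algebraMap ℂ (RatField (n + 1)) z ≠ 0) ↔ z ≠ 0 := fun z =>
    map_ne_zero (algebraMap ℂ (RatField (n + 1)))
  have hval : (if w' k = w k then
      fCoeff (partialShape h k) / fCoeff (partialShape h (k + 1)) else 0) =
      (∏ i ∈ (range (L + 1)).erase x'.1, ((content (w k) : ℂ) - rowContent ν i)) /
        ∏ i ∈ range L, ((content (w k) : ℂ) + 1 - rowContent ν i) := by
    rw [hc]
    by_cases hxx : x'.1 = x.1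
    · rw [if_pos (hwx.2 hxx), hxx, hf]
      rw [residue] at hratio
      have n1 : ∏ i ∈ range L, ((rowContent ν x.1 : ℂ) + 1 - rowContent ν i) ≠ 0 :=
        prod_ne_zero_iff.2 fun i _ => x.2.rowContent_ne i
      have n2 : ∏ i ∈ (range (L + 1)).erase x.1, ((rowContent ν x.1 : ℂ) - rowContent ν i) ≠ 0 :=
        prod_ne_zero_iff.2 fun i hi => rowContent_sub_ne_zero ν (ne_of_mem_erase hi).symm
      have n3 := hookProd_ne_zero ν
      have n4 := hookProd_ne_zero (addCell ν x)
      rw [Nat.succ_eq_add_one, ← hL, mul_div_assoc', eq_div_iff n2] at hratio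
      field_simp
      linear_combination -hratio
    · rw [if_neg (mt hwx.1 hxx), eq_comm, div_eq_zero_iff]
      left
      -- If the rows differ, the factor of row `x` remains in the numerator and vanishes at the
      -- content of `w k`.
      refine prod_eq_zero (i := x.1) ?_ (sub_self _)
      have := x.2.le_colLen
      rw [mem_erase, mem_range]
      exact ⟨fun e => hxx e.symm, by omega⟩
  rw [hval, map_div₀, map_prod, map_prod]
  refine EvaluatesTo.div (EvaluatesTo.prod _ fun i _ => ?_) (EvaluatesTo.prod _ fun i _ => ?_) ?_
  · rw [map_sub]
    simpa using (EvaluatesTo.uVar_self k (content (w k) : ℂ)).sub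
      (EvaluatesTo.const k _ (rowContent ν i : ℂ))
  · rw [map_sub, map_add]
    simpa using ((EvaluatesTo.uVar_self k (content (w k) : ℂ)).add
      (EvaluatesTo.const k _ 1)).sub (EvaluatesTo.const k _ (rowContent ν i : ℂ))
  · rw [← map_prod, hK, hc]
    exact prod_ne_zero_iff.2 fun i _ => x.2.rowContent_ne i

end ScalarEvaluation

end CyclotomicFusion

namespace CyclotomicFusion

open Finset

/-! ### The chain of consecutive evaluations -/

section Chain

variable {m n : ℕ} {lam : Fin m → YoungDiagram} (ξ : Fin m ≃ rootsOfUnity m ℂ)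
  (T : StdTableau n lam)

/-- The spectral parameters after the evaluation of the first `k` variables at the contents. -/
noncomputable def params (k : ℕ) (i : Fin (n + 1)) : RatField (n + 1) :=
  if i.1 < k then algebraMap ℂ _ (content (T.node i) : ℂ) else uVar i

theorem params_evaluatesTo (k i : Fin (n + 1)) :
    EvaluatesTo k (T.c k : ℂ) (params T k i) (params T (k + 1) i) := by
  rcases lt_trichotomy i k with h | rfl | h
  · have h' := Fin.lt_def.1 h
    rw [params, params, if_pos h', if_pos (by omega)]
    exact EvaluatesTo.const _ _ _
  · rw [params, params, if_neg (lt_irrefl _), if_pos (by omega)]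
    exact EvaluatesTo.uVar_self _ _
  · have h' := Fin.lt_def.1 h
    rw [params, params, if_neg (by omega), if_neg (by omega)]
    exact EvaluatesTo.uVar_ne h.ne' _

/-- The product of the factors of `Φ` with indices at least `l`. -/
noncomputable def phiTail (us : Fin (n + 1) → RatField (n + 1)) (l : ℕ) :
    MonoidAlgebra (RatField (n + 1)) (G m n) :=
  (((List.finRange (n + 1)).drop l).reverse.map fun j =>
    phi m (T.p ξ) us (T.p ξ j) (us j) j).prod

theorem phiTail_eq_mul (us : Fin (n + 1) → RatField (n + 1)) (k : Fin (n + 1)) :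
    phiTail ξ T us k = phiTail ξ T us (k + 1) * phi m (T.p ξ) us (T.p ξ k) (us k) k := by
  rw [phiTail, phiTail, List.drop_eq_getElem_cons (by rw [List.length_finRange]; exact k.2), List.reverse_cons, List.map_append,
    List.prod_append]
  simp

/-- The later factors cause no singularity: their own parameter is still a free variable, different
from every constant and from every other variable. -/
theorem phiTail_evaluatesTo [Finite (G m n)] (k : Fin (n + 1)) :
    AlgEvaluatesTo k (T.c k : ℂ) (phiTail ξ T (params T k) (k + 1))
      (phiTail ξ T (params T (k + 1)) (k + 1)) := by
  refine AlgEvaluatesTo.list_prod _ fun j hj => ?_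
  have hkj : k < j := by
    rw [List.mem_reverse] at hj
    obtain ⟨i, hi, rfl⟩ := List.mem_iff_getElem.1 hj
    simp [Fin.lt_def]
    omega
  refine AlgEvaluatesTo.phi _ _ (params_evaluatesTo T k j)
    (fun i _ => params_evaluatesTo T k i) fun i hi => ?_
  have h1 : ¬ j.1 < k.1 + 1 := by have := Fin.lt_def.1 hkj; omega
  simp only [params, if_neg h1]
  split_ifs
  · exact uVar_ne_const _ _
  · exact uVar_sub_ne_zero hi.ne'

open Classical in
/-- The eigenvalues of the element obtained after `k` evaluations. -/
noncomputable def stageScalar (k : ℕ) (μ : Fin m → YoungDiagram) (S : StdTableau n μ) : ℂ :=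
  if ∀ i : Fin (n + 1), i.1 < k → S.node i = T.node i then (fCoeff (partialShape T.std k))⁻¹ else 0

/-- `Y` is the element obtained after `k` evaluations from the last `k` factors of `Φ`. -/
def IsStage (k : ℕ) (Y : MonoidAlgebra ℂ (G m n)) : Prop :=
  ∀ μ : Fin m → YoungDiagram, matAlg ξ μ ℂ Y = Matrix.diagonal (stageScalar T k μ)

theorem isStage_zero : IsStage ξ T 0 1 := by
  intro μ
  have : stageScalar T 0 μ = fun _ => 1 := by
    funext S
    simp only [stageScalar, partialShape_zero, fCoeff_bot]
    simp
  rw [this, map_one, Matrix.diagonal_one]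

theorem eq_of_matAlg (hm : 1 ≤ m) {X Y : MonoidAlgebra ℂ (G m n)}
    (h : ∀ μ : Shape m n, matAlg ξ μ.1 ℂ X = matAlg ξ μ.1 ℂ Y) : X = Y := by
  rw [← sub_eq_zero]
  exact eq_zero_of_matAlg ξ hm _ fun μ => by rw [map_sub, h μ, sub_self]

/-- The eigenvalue formula for `φ_{k+1}` holds only on tableaux agreeing with `T` so far; on all
others `Y` already acts by zero. -/
theorem matAlg_phi_mul (hm : 1 ≤ m) {k : Fin (n + 1)} {Y : MonoidAlgebra ℂ (G m n)}
    (hY : IsStage ξ T k Y) (μ : Fin m → YoungDiagram) :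
    matAlg ξ μ (RatField (n + 1))
      (phi m (T.p ξ) (params T k) (T.p ξ k) (params T k k) k *
        MonoidAlgebra.mapRingHom (G m n) (algebraMap ℂ (RatField (n + 1))) Y) =
      Matrix.diagonal fun S => phiScalar (uVar k) (T.node k).1 S.node k *
        algebraMap ℂ _ (stageScalar T k μ S) := by
  have hk : params T k k = uVar k := by rw [params, if_neg (lt_irrefl _)]
  rw [map_mul, matAlg_mapRingHom, hY μ, hk]
  have hdiag : (Matrix.diagonal (stageScalar T k μ)).map (algebraMap ℂ (RatField (n + 1))) =
      Matrix.diagonal fun S => algebraMap ℂ (RatField (n + 1)) (stageScalar T k μ S) :=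
    Matrix.diagonal_map (map_zero _)
  rw [hdiag]
  ext S' S
  rw [Matrix.mul_diagonal]
  by_cases hS : ∀ i : Fin (n + 1), i.1 < k → S.node i = T.node i
  · have := congrFun (matAlg_phi_mulVec ξ (μ := μ) hm (vs := T.p ξ) (us := params T k)
      (uVar_ne_intCast k) (T.node k).1 k S.node fun i hi => by
        rw [hS i hi, params, if_pos (Fin.lt_def.1 hi)]
        exact ⟨rfl, by simp⟩) S'
    rw [vec_coe, castVec_single, Matrix.mulVec_single_one] at this
    rw [show matAlg ξ μ (RatField (n + 1)) (phi m (T.p ξ) (params T k) (T.p ξ k) (uVar k) k) S' S =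
      _ from this]
    by_cases h : S' = S
    · subst h; simp
    · simp [h]
  · have h0 : stageScalar T k μ S = 0 := if_neg hS
    by_cases h : S' = S
    · subst h; simp [h0]
    · simp [h, h0]

theorem stageScalar_evaluatesTo (k : Fin (n + 1)) {μ : Fin m → YoungDiagram}
    (S : StdTableau n μ) :
    EvaluatesTo k (T.c k : ℂ) (phiScalar (uVar k) (T.node k).1 S.node k *
      algebraMap ℂ _ (stageScalar T k μ S)) (algebraMap ℂ _ (stageScalar T (k + 1) μ S)) := by
  by_cases hS : ∀ i : Fin (n + 1), i.1 < k → S.node i = T.node i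
  · have h := (phiScalar_evaluatesTo T.std S.std k fun i hi => hS i hi).mul
      (EvaluatesTo.const k (T.c k : ℂ) (stageScalar T k μ S))
    refine (congrArg (EvaluatesTo k (T.c k : ℂ) _) ?_).mpr h
    rw [← map_mul]
    congr 1
    have hiff : (∀ i : Fin (n + 1), i.1 < k.1 + 1 → S.node i = T.node i) ↔
        S.node k = T.node k := by
      refine ⟨fun h => h k (Nat.lt_succ_self _), fun h i hi => ?_⟩
      rcases (Nat.lt_succ_iff.1 hi).lt_or_eq with hi | hi
      · exact hS i hi
      · rwa [Fin.ext hi]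
    have n1 := fCoeff_ne_zero (partialShape T.std k)
    rw [stageScalar, stageScalar, if_pos hS]
    by_cases h : S.node k = T.node k
    · rw [if_pos (hiff.2 h), if_pos h]
      field_simp
    · rw [if_neg (mt hiff.1 h), if_neg h, zero_mul]
  · have h0 : stageScalar T k μ S = 0 := if_neg hS
    have h1 : stageScalar T (k + 1) μ S = 0 :=
      if_neg fun h => hS fun i hi => h i (hi.trans (Nat.lt_succ_self _))
    rw [h0, h1, map_zero, mul_zero]
    exact EvaluatesTo.zero _ _

/-- Multiplication by `Y` makes the product with `φ_{k+1}` diagonal, with regular eigenvalues. The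
inversion formula then makes all its coefficients regular. -/
theorem exists_stage_succ (hm : 1 ≤ m) {k : Fin (n + 1)} {Y : MonoidAlgebra ℂ (G m n)}
    (hY : IsStage ξ T k Y) :
    ∃ Y', IsStage ξ T (k + 1) Y' ∧ AlgEvaluatesTo k (T.c k : ℂ)
      (phi m (T.p ξ) (params T k) (T.p ξ k) (params T k k) k *
        MonoidAlgebra.mapRingHom (G m n) (algebraMap ℂ (RatField (n + 1))) Y)
      (MonoidAlgebra.mapRingHom (G m n) (algebraMap ℂ (RatField (n + 1))) Y') := by
  have := finite_G (n := n) ξ hm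
  have := Fintype.ofFinite (G m n)
  set a := phi m (T.p ξ) (params T k) (T.p ξ k) (params T k k) k *
        MonoidAlgebra.mapRingHom (G m n) (algebraMap ℂ (RatField (n + 1))) Y with ha
  let y : G m n → ℂ := fun g => ∑ μ : Shape m n, ∑ S : StdTableau n μ.1,
    ((m : ℂ) ^ (n + 1))⁻¹ * fCoeff μ.1 * matRep ξ μ.1 g⁻¹ S S * stageScalar T (k + 1) μ.1 S
  -- The coefficients are those prescribed by `coeff_of_diagonal` for the evaluated eigenvalues.
  let Y' : MonoidAlgebra ℂ (G m n) := MonoidAlgebra.ofCoeff (Finsupp.equivFunOnFinite.symm y)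
  have hev : AlgEvaluatesTo k (T.c k : ℂ) a
      (MonoidAlgebra.mapRingHom (G m n) (algebraMap ℂ (RatField (n + 1))) Y') := by
    intro g
    rw [coeff_of_diagonal ξ hm a (fun μ S => phiScalar (uVar k) (T.node k).1 S.node k *
      algebraMap ℂ _ (stageScalar T k μ S)) (fun μ => matAlg_phi_mul ξ T hm hY μ.1),
      MonoidAlgebra.coeff_mapRingHom]
    have : Y'.coeff g = y g := rfl
    rw [this]
    simp only [y, map_sum]
    refine EvaluatesTo.sum _ fun μ _ => EvaluatesTo.sum _ fun S _ => ?_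
    rw [map_mul (algebraMap ℂ (RatField (n + 1))) _ (stageScalar T (k + 1) μ.1 S)]
    exact (EvaluatesTo.const _ _ _).mul (stageScalar_evaluatesTo T k S)
  refine ⟨Y', fun μ => ?_, hev⟩
  have hentry : ∀ (X : MonoidAlgebra (RatField (n + 1)) (G m n)) (S S' : StdTableau n μ),
      matAlg ξ μ _ X S S' = ∑ g, X.coeff g * algebraMap ℂ _ (matRep ξ μ g S S') := fun X S S' => by
    rw [matAlg_apply, Finsupp.sum_fintype _ _ (by simp)]
  ext S S'
  apply (algebraMap ℂ (RatField (n + 1))).injective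
  have h1 : EvaluatesTo k (T.c k : ℂ) (matAlg ξ μ _ a S S')
      (matAlg ξ μ _ (MonoidAlgebra.mapRingHom (G m n) (algebraMap ℂ (RatField (n + 1))) Y') S S') := by
    rw [hentry, hentry]
    exact EvaluatesTo.sum _ fun g _ => (hev g).mul (EvaluatesTo.const _ _ _)
  rw [matAlg_mapRingHom, Matrix.map_apply, ha, matAlg_phi_mul ξ T hm hY μ] at h1
  -- The matrix entry of `Y'` and the prescribed diagonal entry are values of the same rational
  -- function, hence equal.
  refine h1.unique ?_
  by_cases h : S = S'
  · subst h
    rw [Matrix.diagonal_apply_eq, Matrix.diagonal_apply_eq]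
    exact stageScalar_evaluatesTo T k S
  · rw [Matrix.diagonal_apply_ne _ h, Matrix.diagonal_apply_ne _ h, map_zero]
    exact EvaluatesTo.zero _ _

theorem exists_stage (hm : 1 ≤ m) : ∀ k : ℕ, k ≤ n + 1 → ∃ Y, IsStage ξ T k Y
  | 0, _ => ⟨1, isStage_zero ξ T⟩
  | k + 1, hk => by
    obtain ⟨Y, hY⟩ := exists_stage hm k (by omega)
    obtain ⟨Y', hY', _⟩ := exists_stage_succ ξ T hm (k := ⟨k, hk⟩) hY
    exact ⟨Y', hY'⟩

theorem exists_consecutiveEvaluation (hm : 1 ≤ m) :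
    ∃ X, IsStage ξ T (n + 1) X ∧
      ConsecutiveEvaluation (Phi m (T.p ξ) uVar) (fun i => ((T.c i : ℤ) : ℂ)) X := by
  have := finite_G (n := n) ξ hm
  have hY : ∀ k : Fin (n + 2), ∃ Y, IsStage ξ T k Y := fun k =>
    exists_stage ξ T hm k (Nat.lt_succ_iff.1 k.2)
  choose Y hY using hY
  -- After `k` evaluations the function is `φ_{n+1} ⋯ φ_{k+1}`, with the first `k` parameters
  -- specialised, times the constant `Y k`.
  refine ⟨Y (Fin.last _), hY _, fun k => phiTail ξ T (params T k) k *
    MonoidAlgebra.mapRingHom (G m n) (algebraMap ℂ (RatField (n + 1))) (Y k), ?_, ?_, ?_⟩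
  · have h0 : Y 0 = 1 := eq_of_matAlg ξ hm fun μ =>
      (hY 0 μ.1).trans (isStage_zero ξ T μ.1).symm
    beta_reduce
    rw [h0, map_one, mul_one]
    have : params T 0 = uVar := by funext i; simp [params]
    simp only [Fin.val_zero, this]
    rfl
  · intro k
    obtain ⟨Y', hY', hev⟩ := exists_stage_succ ξ T hm (k := k) (hY k.castSucc)
    -- The stages were chosen independently for each `k`; joint faithfulness makes the choices
    -- compatible.
    have hYY : Y k.succ = Y' := eq_of_matAlg ξ hm fun μ => by
      rw [hY k.succ μ.1, hY' μ.1]; rfl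
    simp only [Fin.val_castSucc, Fin.val_succ, hYY]
    rw [phiTail_eq_mul, mul_assoc]
    exact (phiTail_evaluatesTo ξ T k).mul hev
  · have : phiTail ξ T (params T (n + 1)) (n + 1) = 1 := by
      rw [phiTail, List.drop_eq_nil_of_le (by simp)]; rfl
    simp only [Fin.val_last, this, one_mul]

end Chain

/-! ### Identification, uniqueness and primitivity of the idempotent -/

section Idempotent

variable {m n : ℕ} {lam : Fin m → YoungDiagram} {ξ : Fin m ≃ rootsOfUnity m ℂ}
  {T : StdTableau n lam}

/-- At the last stage a tableau with nonzero eigenvalue has the same filling as `T`, hence the same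
shape and is `T` itself; there the eigenvalue is `f⁻¹` of the full shape. -/
theorem IsStage.isTableauIdempotent {X : MonoidAlgebra ℂ (G m n)} (h : IsStage ξ T (n + 1) X) :
    IsTableauIdempotent ξ T (fCoeff lam • X) := by
  have hentry : ∀ (μ : Fin m → YoungDiagram) (S S' : StdTableau n μ),
      (seminormalRep n ξ μ).asAlgebraHom X (Finsupp.single S' 1) S =
        Matrix.diagonal (stageScalar T (n + 1) μ) S S' := fun μ S S' => by
    rw [← matAlg_eq_asAlgebraHom, h μ]
  have hscal : ∀ (μ : Fin m → YoungDiagram) (S : StdTableau n μ), S.node ≠ T.node →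
      stageScalar T (n + 1) μ S = 0 := fun μ S hS =>
    if_neg fun hh => hS (funext fun i => hh i i.2)
  have hT : stageScalar T (n + 1) lam T = (fCoeff lam)⁻¹ := by
    rw [stageScalar, if_pos fun _ _ => rfl, partialShape_full]
  refine ⟨?_, fun S hS => ?_, fun μ hμ => ?_⟩
  · ext S
    rw [map_smul, LinearMap.smul_apply, Finsupp.smul_apply, hentry]
    by_cases hS : S = T
    · subst hS
      rw [Matrix.diagonal_apply_eq, hT, Finsupp.single_eq_same, smul_eq_mul,
        mul_inv_cancel₀ (fCoeff_ne_zero _)]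
    · rw [Matrix.diagonal_apply_ne _ hS, smul_zero, Finsupp.single_eq_of_ne hS]
  · ext S'
    rw [map_smul, LinearMap.smul_apply, Finsupp.smul_apply, hentry]
    by_cases h' : S' = S
    · subst h'
      rw [Matrix.diagonal_apply_eq, hscal _ _ fun e => hS (StdTableau.ext' e), smul_zero]; rfl
    · rw [Matrix.diagonal_apply_ne _ h', smul_zero]; rfl
  · refine Finsupp.lhom_ext' fun S => LinearMap.ext_ring ?_
    ext S'
    rw [LinearMap.comp_apply, Finsupp.lsingle_apply, map_smul, LinearMap.smul_apply,
      Finsupp.smul_apply, hentry]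
    by_cases h' : S' = S
    · subst h'
      rw [Matrix.diagonal_apply_eq, hscal _ _ fun e => hμ ?_, smul_zero]
      · rfl
      · exact S'.std.shape_unique (e ▸ T.std)
    · rw [Matrix.diagonal_apply_ne _ h', smul_zero]; rfl

theorem eq_of_asAlgebraHom (hm : 1 ≤ m) {X Y : MonoidAlgebra ℂ (G m n)}
    (h : ∀ μ : Fin m → YoungDiagram,
      (seminormalRep n ξ μ).asAlgebraHom X = (seminormalRep n ξ μ).asAlgebraHom Y) : X = Y :=
  eq_of_matAlg ξ hm fun μ => by
    ext S S'
    rw [matAlg_eq_asAlgebraHom, matAlg_eq_asAlgebraHom, h]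

theorem IsTableauIdempotent.eq (hm : 1 ≤ m) {E E' : MonoidAlgebra ℂ (G m n)}
    (h : IsTableauIdempotent ξ T E) (h' : IsTableauIdempotent ξ T E') : E = E' := by
  refine eq_of_asAlgebraHom (ξ := ξ) hm fun μ => ?_
  by_cases hμ : μ = lam
  · subst hμ
    refine Finsupp.lhom_ext' fun S => LinearMap.ext_ring ?_
    simp only [LinearMap.comp_apply, Finsupp.lsingle_apply]
    by_cases hS : S = T
    · rw [hS, h.self, h'.self]
    · rw [h.of_ne S hS, h'.of_ne S hS]
  · rw [h.of_shape_ne μ hμ, h'.of_shape_ne μ hμ]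

theorem IsTableauIdempotent.isIdempotentElem (hm : 1 ≤ m) {E : MonoidAlgebra ℂ (G m n)}
    (h : IsTableauIdempotent ξ T E) : IsIdempotentElem E := by
  refine IsTableauIdempotent.eq (ξ := ξ) (T := T) hm ⟨?_, fun S hS => ?_, fun μ hμ => ?_⟩ h
  · rw [map_mul, Module.End.mul_apply, h.self, h.self]
  · rw [map_mul, Module.End.mul_apply, h.of_ne S hS, map_zero]
  · rw [map_mul, h.of_shape_ne μ hμ, zero_mul]

/-- An element of `E R E` is a multiple of the idempotent `E` of a standard tableau. -/
theorem IsTableauIdempotent.eq_smul (hm : 1 ≤ m) {E a : MonoidAlgebra ℂ (G m n)}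
    (h : IsTableauIdempotent ξ T E) (h1 : E * a = a) (h2 : a * E = a) : ∃ c : ℂ, a = c • E := by
  have hright : ∀ μ x, (seminormalRep n ξ μ).asAlgebraHom a x =
      (seminormalRep n ξ μ).asAlgebraHom a ((seminormalRep n ξ μ).asAlgebraHom E x) := fun μ x => by
    rw [← Module.End.mul_apply, ← map_mul, h2]
  have hleft : ∀ μ x, (seminormalRep n ξ μ).asAlgebraHom a x =
      (seminormalRep n ξ μ).asAlgebraHom E ((seminormalRep n ξ μ).asAlgebraHom a x) := fun μ x => by
    rw [← Module.End.mul_apply, ← map_mul, h1]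
  have hE : ∀ x : V n lam, (seminormalRep n ξ lam).asAlgebraHom E x = x T • Finsupp.single T 1 := by
    intro x
    induction x using Finsupp.induction_linear with
    | zero => simp
    | add x y hx hy => rw [map_add, hx, hy, Finsupp.add_apply, add_smul]
    | single S c =>
      have : (Finsupp.single S c : V n lam) = c • Finsupp.single S 1 := by simp
      rw [this, map_smul]
      by_cases hS : S = T
      · subst hS; rw [h.self]; simp
      · rw [h.of_ne S hS]; simp [Ne.symm hS]
  refine ⟨(seminormalRep n ξ lam).asAlgebraHom a (Finsupp.single T 1) T, ?_⟩
  refine eq_of_asAlgebraHom (ξ := ξ) hm fun μ => ?_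
  by_cases hμ : μ = lam
  · subst hμ
    refine Finsupp.lhom_ext' fun S => LinearMap.ext_ring ?_
    simp only [LinearMap.comp_apply, Finsupp.lsingle_apply]
    rw [map_smul, LinearMap.smul_apply]
    by_cases hS : S = T
    · subst hS
      rw [h.self]
      conv_lhs => rw [hleft, hE]
    · rw [hright, h.of_ne S hS, map_zero, smul_zero]
  · rw [map_smul, h.of_shape_ne μ hμ, smul_zero]
    refine LinearMap.ext fun x => ?_
    rw [hleft, h.of_shape_ne μ hμ]
    rfl

/-- An orthogonal summand of `E` is fixed by `E` on both sides, hence a scalar multiple of `E`;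
idempotence forces the scalar to be `0` or `1`. -/
theorem IsTableauIdempotent.isPrimitiveIdempotent (hm : 1 ≤ m) {E : MonoidAlgebra ℂ (G m n)}
    (h : IsTableauIdempotent ξ T E) : IsPrimitiveIdempotent E := by
  have hid := h.isIdempotentElem hm
  have hne : E ≠ 0 := by
    rintro rfl
    have := h.self
    rw [map_zero, LinearMap.zero_apply, eq_comm, Finsupp.single_eq_zero] at this
    exact one_ne_zero this
  refine ⟨hid, hne, fun a b ha hb hab hba hsum => ?_⟩
  have h1 : E * a = a := by rw [← hsum, add_mul, ha.eq, hba, add_zero]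
  have h2 : a * E = a := by rw [← hsum, mul_add, ha.eq, hab, add_zero]
  obtain ⟨c, hc⟩ := h.eq_smul hm h1 h2
  have h3 : (c * c - c) • E = 0 := by
    have := ha.eq
    rw [hc, smul_mul_smul_comm, hid.eq] at this
    rw [sub_smul, this, sub_self]
  rcases smul_eq_zero.1 h3 with h3 | h3
  · have h4 : c * (c - 1) = 0 := by linear_combination h3
    rcases mul_eq_zero.1 h4 with h4 | h4
    · left; rw [hc, h4, zero_smul]
    · right
      rw [sub_eq_zero.1 h4, one_smul] at hc
      rw [hc] at hsum
      exact add_eq_left.1 hsum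
  · exact absurd h3 hne

end Idempotent

end CyclotomicFusion

open CyclotomicFusion in
theorem theorem2 (m n : ℕ) (hm : 1 ≤ m) (ξ : Fin m ≃ rootsOfUnity m ℂ)
    (lam : Fin m → YoungDiagram) (hlam : ∑ k, (lam k).card = n + 1) (T : StdTableau n lam) :
    ∃ E : MonoidAlgebra ℂ (G m n),
      IsPrimitiveIdempotent E ∧
      (∀ E' : MonoidAlgebra ℂ (G m n), IsTableauIdempotent ξ T E' ↔ E' = E) ∧
      ∃ X : MonoidAlgebra ℂ (G m n),
        ConsecutiveEvaluation (Phi m (T.p ξ) uVar) (fun i => ((T.c i : ℤ) : ℂ)) X ∧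
        E = fCoeff lam • X := by
  obtain ⟨X, hX, hev⟩ := exists_consecutiveEvaluation ξ T hm
  have hE := hX.isTableauIdempotent
  exact ⟨fCoeff lam • X, hE.isPrimitiveIdempotent hm,
    fun E' => ⟨fun h => h.eq hm hE, fun h => h ▸ hE⟩, X, hev, rfl⟩
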